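/- Let $k\ge 3$ and $n\ge 1$. A \emph{$(k,n)$-ladder} is a graph obtained as follows. Start with a $k$-cycle $C_1$, all of whose edges are free. For $i=2,\dots,n$, choose a free edge and add a $k$-cycle $C_i$ that consists of this edge and a path through $k-2$ new vertices; then the free edges are exactly the edges whose two end points are both among these new vertices. Given a ladder $L$ with edge set $E$, real costs $c_e$ ($e\in E$) and $q(e,f)$ ($e\ne f$ in $E$) with $q(e,f)=0$ whenever $e$ and $f$ have no common vertex, the adjacent-only quadratic minimum spanning tree problem (AQMST) asks for a spanning tree $T$ of $L$ that minimizes $$z(T)=\sum_{e\in T}\ \sum_{f\in T,\,f\ne e}q(e,f)+\sum_{e\in T}c_e .$$ \textbf{Notation.} Let $L^i$ be the ladder formed by $C_1,\dots,C_i$. Let $k\ge 4$. Label the edges of $C_i$ by $e^i_1,\dots,e^i_k$ so that $e^i_1$ is shared with $C_{i-1}$ (if $i\ge 2$), $e^i_k$ is shared with $C_{i+1}$ (if $i<n$; for $i=n$ it is an edge of $C_n$ whose two end points are not in $L^{n-1}$), $e^i_{k-1}$ and $e^i_{k-2}$ are the two edges of $C_i$ adjacent to $e^i_k$, and $e^i_1,e^i_{k-2},e^i_{k-1},e^i_k$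 are distinct. Let $T^i_1,T^i_2,T^i_3,T^i_4$ denote spanning trees of $L^i$ of minimum cost $z$ among those whose intersection with $\{e^i_k,e^i_{k-1},e^i_{k-2}\}$ is, respectively, $\{e^i_k,e^i_{k-1}\}$, $\{e^i_k,e^i_{k-2}\}$, $\{e^i_{k-1},e^i_{k-2}\}$, $\{e^i_k,e^i_{k-1},e^i_{k-2}\}$. Let $F^i_1,F^i_2,F^i_3$ denote spanning forests of $L^i$ of minimum cost $z$ among those that consist of exactly two trees, one containing one end point of $e^i_k$ and the other one the other end point, and whose intersection with $\{e^i_k,e^i_{k-1},e^i_{k-2}\}$ is, respectively, $\{e^i_{k-1}\}$, $\{e^i_{k-2}\}$, $\{e^i_{k-1},e^i_{k-2}\}$. \textbf{Algorithm (AQMST-$(k,n)$-ladder).} The input is the ladder, given by its cycles $C_1,\dots,C_n$ in order, each listed cyclically, with the shared edges marked, together with the costs. For $k\ge 4$, compute $T^1_1,\dots,T^1_4,F^1_1,F^1_2,F^1_3$ and their costs, and then for $i=2,\dots,n$ compute from the corresponding objects for $i-1$, with their costs, the following minimum cost objects with their costs, where $j$ runs over $1,\dots,4$ for trees and over $1,2,3$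 for forests, and $\ell$ runs over $2,\dots,k-3$: \begin{itemize} \item $T^i_1,\ T^i_2,\ T^i_3$: the best $T^{i-1}_j+(C_i-e^i_1-e)$ with $e=e^i_{k-2},\ e^i_{k-1},\ e^i_k$, respectively; \item $T^i_4$: the best among all $F^{i-1}_j+(C_i-e^i_1)$ and all $T^{i-1}_j+(C_i-e^i_1-e^i_\ell)$; \item $F^i_1,\ F^i_2$: the best $T^{i-1}_j+(C_i-e^i_1-e^i_k-e)$ with $e=e^i_{k-2},\ e^i_{k-1}$, respectively; \item $F^i_3$: the best among all $F^{i-1}_j+(C_i-e^i_1-e^i_k)$ and all $T^{i-1}_j+(C_i-e^i_1-e^i_k-e^i_\ell)$. \end{itemize} Finally output the cheapest of $T^n_1,\dots,T^n_4$ and its cost. For $k=3$, where necessarily $n\le 2$, output the cheapest of the three (if $n=1$) or eight (if $n=2$) spanning trees and its cost. \textbf{Theorem.} Every $(k,n)$-ladder can be presented to the algorithm in this way. On a random access machine on which additions, subtractions and comparisons of real numbers, index arithmetic, input reads and insertions at the head of a linked list take unit time, the algorithm has an implementation and there is an absolute constant $C$ such that for all $k\ge 3$, $n\ge 1$, every $(k,n)$-ladder,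 every presentation of it and all adjacent-only costs, it halts after at most $C\,k\,n$ steps and outputs an optimal solution $T$ of the AQMST on the ladder together with $z(T)$. Moreover, for $k\ge 4$ and every $i=1,\dots,n$, the seven objects that it holds after processing $C_1,\dots,C_i$ are minimum cost objects $T^i_1,\dots,T^i_4,F^i_1,F^i_2,F^i_3$ as defined above, together with their costs. -/

import Mathlib

namespace AQMST

/-! ### Graphs: `(k,n)`-ladders -/

/-- The edges of the cycle `x 0, x 1, …, x (k-1)`, closed by the edge from `x (k-1)` to `x 0`. -/
def cycleEdges {V : Type*} (k : ℕ) (x : ℕ → V) : Set (Sym2 V) :=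
  {e | ∃ t, t < k ∧ e = s(x t, x ((t + 1) % k))}

/-- The recursive construction of `(k,n)`-ladders. `LadderBuild k n W E F` says that fusing `n`
`k`-cycles can produce the graph with vertex set `W`, edge set `E` and set of free edges `F`.
One starts from a `k`-cycle, all of whose edges are free. In each further step a new `k`-cycle
`x 0, …, x (k-1)` is fused along a free edge `s(x 0, x 1)`, its other `k - 2` vertices being new;
afterwards the free edges are those whose two end points are both new. -/
inductive LadderBuild {V : Type*} (k : ℕ) :
    ℕ → Set V → Set (Sym2 V) → Set (Sym2 V) → Prop
  | cycle (x : ℕ → V) (inj : Set.InjOn x (Set.Iio k)) :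
      LadderBuild k 1 (x '' Set.Iio k) (cycleEdges k x) (cycleEdges k x)
  | fuse (n : ℕ) (W : Set V) (E F : Set (Sym2 V)) (x : ℕ → V)
      (prev : LadderBuild k n W E F)
      (inj : Set.InjOn x (Set.Iio k))
      (free : s(x 0, x 1) ∈ F)
      (fresh : ∀ t, 2 ≤ t → t < k → x t ∉ W) :
      LadderBuild k (n + 1) (W ∪ x '' Set.Iio k) (E ∪ cycleEdges k x)
        {e | ∃ t, 2 ≤ t ∧ t + 1 < k ∧ e = s(x t, x (t + 1))}

/-- `G` is a `(k,n)`-ladder (here `k ≥ 3`; the construction forces `n ≥ 1`). -/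
def IsLadder {V : Type*} (k n : ℕ) (G : SimpleGraph V) : Prop :=
  3 ≤ k ∧ ∃ F : Set (Sym2 V), LadderBuild k n Set.univ G.edgeSet F

/-- The way in which a `(k,n)`-ladder is presented to the algorithm: its cycles `C 0, …, C (n-1)`
in the order of the construction, each as a cyclic list `x i 0, …, x i (k-1)` of vertices.
The edge at position `t` of `C i` joins `x i t` and `x i (t+1)`; the edge at position `0` is the
one shared with `C (i-1)`, and the edge at position `pos i` is the one shared with `C (i+1)`
(for the last cycle: any edge both of whose end points are new). The listing of `C 0` may start
anywhere; for `k ≥ 4` it is started so that its edge at position `0` is disjoint from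
its edge at position `pos 0`. -/
structure Labelling {V : Type*} (G : SimpleGraph V) (k n : ℕ) where
  x : ℕ → ℕ → V
  pos : ℕ → ℕ
  inj : ∀ i, i < n → Set.InjOn (x i) (Set.Iio k)
  pos_lt : ∀ i, i < n → pos i < k
  pos_free : 4 ≤ k → ∀ i, i < n → 2 ≤ pos i ∧ pos i + 2 ≤ k
  glue : ∀ i, i + 1 < n →
    s(x (i + 1) 0, x (i + 1) 1) = s(x i (pos i), x i ((pos i + 1) % k))
  fresh : ∀ i, i + 1 < n → ∀ t, 2 ≤ t → t < k →
    ∀ j, j ≤ i → ∀ u, u < k → x (i + 1) t ≠ x j u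
  verts_eq : ∀ v, ∃ i, i < n ∧ ∃ t, t < k ∧ x i t = v
  edges_eq : ∀ e, e ∈ G.edgeSet ↔ ∃ i, i < n ∧ e ∈ cycleEdges k (x i)

namespace Labelling

variable {V : Type*} {G : SimpleGraph V} {k n : ℕ}

/-- The edge at position `t` of the cycle `C i`. -/
def edge (L : Labelling G k n) (i t : ℕ) : Sym2 V := s(L.x i t, L.x i ((t + 1) % k))

/-- The vertices of the ladder formed by the first `m` cycles. -/
def verts (L : Labelling G k n) (m : ℕ) : Set V :=
  {v | ∃ i, i < m ∧ ∃ t, t < k ∧ L.x i t = v}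

/-- The edges of the ladder formed by the first `m` cycles. -/
def edges (L : Labelling G k n) (m : ℕ) : Set (Sym2 V) :=
  {e | ∃ i, i < m ∧ ∃ t, t < k ∧ L.edge i t = e}

/-- The set of edges named by a list of pairs (cycle, position). -/
def edgeFinset [DecidableEq V] (L : Labelling G k n) (l : List (ℕ × ℕ)) : Finset (Sym2 V) :=
  (l.map fun a => L.edge a.1 a.2).toFinset

end Labelling

/-! ### The optimization problem -/

/-- `T` is the edge set of a spanning tree of `G`. -/
def IsSpanningTree {V : Type*} (G : SimpleGraph V) (T : Finset (Sym2 V)) : Prop :=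
  (T : Set (Sym2 V)) ⊆ G.edgeSet ∧ (SimpleGraph.fromEdgeSet (T : Set (Sym2 V))).IsTree

/-- The quadratic objective `z(T)`, a sum over ordered pairs of distinct edges plus linear costs. -/
def cost {V : Type*} [DecidableEq V] (c : Sym2 V → ℝ) (q : Sym2 V → Sym2 V → ℝ)
    (T : Finset (Sym2 V)) : ℝ :=
  (∑ e ∈ T, ∑ f ∈ T.erase e, q e f) + ∑ e ∈ T, c e

/-- Two edges that do not share a vertex have no interaction cost. -/
def AdjacentOnly {V : Type*} (G : SimpleGraph V) (q : Sym2 V → Sym2 V → ℝ) : Prop :=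
  ∀ e ∈ G.edgeSet, ∀ f ∈ G.edgeSet, e ≠ f → (¬ ∃ v, v ∈ e ∧ v ∈ f) → q e f = 0

/-- `T` satisfies `P` and has minimum cost among all edge sets that satisfy `P`. -/
def IsOptimal {V : Type*} (z : Finset (Sym2 V) → ℝ) (P : Finset (Sym2 V) → Prop)
    (T : Finset (Sym2 V)) : Prop :=
  P T ∧ ∀ T', P T' → z T ≤ z T'

/-- The seven objects maintained by the algorithm: four trees and three forests. -/
inductive Entry
  | T1 | T2 | T3 | T4 | F1 | F2 | F3
  deriving DecidableEq

namespace Labelling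

variable {V : Type*} {G : SimpleGraph V} {k n : ℕ}

/-- `T` is a spanning tree of the ladder formed by the first `m` cycles. -/
def SpanningTree (L : Labelling G k n) (m : ℕ) (T : Finset (Sym2 V)) : Prop :=
  (T : Set (Sym2 V)) ⊆ L.edges m ∧
    (SimpleGraph.fromEdgeSet (T : Set (Sym2 V))).IsAcyclic ∧
    ∀ u ∈ L.verts m, ∀ w ∈ L.verts m,
      (SimpleGraph.fromEdgeSet (T : Set (Sym2 V))).Reachable u w

/-- `T` is a spanning forest, made of exactly two trees, of the ladder formed by the first `m`
cycles; one tree contains one end point of the edge at position `pos (m-1)` of the last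
cycle, and the other tree contains the other end point. -/
def SplitForest (L : Labelling G k n) (m : ℕ) (T : Finset (Sym2 V)) : Prop :=
  let H := SimpleGraph.fromEdgeSet (T : Set (Sym2 V))
  let v₁ := L.x (m - 1) (L.pos (m - 1))
  let v₂ := L.x (m - 1) (L.pos (m - 1) + 1)
  (T : Set (Sym2 V)) ⊆ L.edges m ∧ H.IsAcyclic ∧ ¬ H.Reachable v₁ v₂ ∧
    ∀ u ∈ L.verts m, H.Reachable u v₁ ∨ H.Reachable u v₂

/-- The constraint that defines each of the seven objects on the first `m` cycles (`m ≥ 1`).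
In the last of these cycles, `a` is the edge that the next cycle is fused to, and `b`, `b'` are
the two edges of the cycle adjacent to `a`. -/
def Admissible (L : Labelling G k n) (m : ℕ) (j : Entry) (T : Finset (Sym2 V)) : Prop :=
  let a := L.edge (m - 1) (L.pos (m - 1))
  let b := L.edge (m - 1) (L.pos (m - 1) - 1)
  let b' := L.edge (m - 1) (L.pos (m - 1) + 1)
  match j with
  | .T1 => L.SpanningTree m T ∧ a ∈ T ∧ b ∈ T ∧ b' ∉ T
  | .T2 => L.SpanningTree m T ∧ a ∈ T ∧ b ∉ T ∧ b' ∈ T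
  | .T3 => L.SpanningTree m T ∧ a ∉ T ∧ b ∈ T ∧ b' ∈ T
  | .T4 => L.SpanningTree m T ∧ a ∈ T ∧ b ∈ T ∧ b' ∈ T
  | .F1 => L.SplitForest m T ∧ a ∉ T ∧ b ∈ T ∧ b' ∉ T
  | .F2 => L.SplitForest m T ∧ a ∉ T ∧ b ∉ T ∧ b' ∈ T
  | .F3 => L.SplitForest m T ∧ a ∉ T ∧ b ∈ T ∧ b' ∈ T

end Labelling

/-! ### The machine

A random access machine with finitely many registers, which hold natural numbers, real numbers, or
(pointers to) immutable linked lists of edge names. An edge name is a pair (cycle, position). The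
input can be read at random. Every node of every evaluated expression, every assignment, every
test and every round of a loop costs one step. -/

/-- The input: `k`, `n`, the positions of the shared edges, and the costs by edge names. -/
structure Input where
  k : ℕ
  n : ℕ
  pos : ℕ → ℕ
  c : ℕ × ℕ → ℝ
  q : ℕ × ℕ → ℕ × ℕ → ℝ

/-- Registers for natural numbers. -/
inductive NReg
  | cyc | pos | t | del₁ | del₂ | bestDel₁ | bestDel₂
  deriving DecidableEq

/-- Registers for real numbers. -/
inductive RReg
  | z (j : Entry) | newZ (j : Entry) | x (j : Entry) | y (j : Entry)
  | path | rest | cand | best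
  deriving DecidableEq

/-- Registers for lists of edge names. -/
inductive LReg
  | tree (j : Entry) | newTree (j : Entry) | src | out
  deriving DecidableEq

/-- The contents of the registers. -/
structure State where
  nat : NReg → ℕ
  real : RReg → ℝ
  list : LReg → List (ℕ × ℕ)

/-- Expressions for natural numbers; `sub` is truncated subtraction. -/
inductive NExp
  | reg (r : NReg) | num (m : ℕ) | k | n | pos (a : NExp) | add (a b : NExp) | sub (a b : NExp)

/-- Expressions for edge names. -/
structure EExp where
  cyc : NExp
  pos : NExp

/-- Expressions for real numbers. -/
inductive RExp
  | reg (r : RReg) | zero | c (e : EExp) | q (e f : EExp) | add (a b : RExp) | sub (a b : RExp)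

/-- Expressions for lists. -/
inductive LExp
  | nil | reg (r : LReg) | cons (e : EExp) (r : LReg)

/-- Tests. -/
inductive BExp
  | lt (a b : NExp) | eq (a b : NExp) | rlt (a b : RExp) | or (a b : BExp) | not (a : BExp)

/-- Programs. `loop r lo hi p` runs `p` for `r = lo, …, hi - 1`, the bounds being evaluated once. -/
inductive Cmd
  | skip
  | nat (r : NReg) (e : NExp)
  | real (r : RReg) (e : RExp)
  | list (r : LReg) (e : LExp)
  | seq (p p' : Cmd)
  | ite (b : BExp) (p p' : Cmd)
  | loop (r : NReg) (lo hi : NExp) (p : Cmd)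

def NExp.eval (I : Input) (s : State) : NExp → ℕ
  | .reg r => s.nat r
  | .num m => m
  | .k => I.k
  | .n => I.n
  | .pos a => I.pos (a.eval I s)
  | .add a b => a.eval I s + b.eval I s
  | .sub a b => a.eval I s - b.eval I s

def NExp.size : NExp → ℕ
  | .reg _ => 1
  | .num _ => 1
  | .k => 1
  | .n => 1
  | .pos a => a.size + 1
  | .add a b => a.size + b.size + 1
  | .sub a b => a.size + b.size + 1

def EExp.eval (I : Input) (s : State) (e : EExp) : ℕ × ℕ := (e.cyc.eval I s, e.pos.eval I s)

def EExp.size (e : EExp) : ℕ := e.cyc.size + e.pos.size + 1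

def RExp.eval (I : Input) (s : State) : RExp → ℝ
  | .reg r => s.real r
  | .zero => 0
  | .c e => I.c (e.eval I s)
  | .q e f => I.q (e.eval I s) (f.eval I s)
  | .add a b => a.eval I s + b.eval I s
  | .sub a b => a.eval I s - b.eval I s

def RExp.size : RExp → ℕ
  | .reg _ => 1
  | .zero => 1
  | .c e => e.size + 1
  | .q e f => e.size + f.size + 1
  | .add a b => a.size + b.size + 1
  | .sub a b => a.size + b.size + 1

def LExp.eval (I : Input) (s : State) : LExp → List (ℕ × ℕ)
  | .nil => []
  | .reg r => s.list r
  | .cons e r => e.eval I s :: s.list r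

def LExp.size : LExp → ℕ
  | .nil => 1
  | .reg _ => 1
  | .cons e _ => e.size + 2

def BExp.holds (I : Input) (s : State) : BExp → Prop
  | .lt a b => a.eval I s < b.eval I s
  | .eq a b => a.eval I s = b.eval I s
  | .rlt a b => a.eval I s < b.eval I s
  | .or a b => a.holds I s ∨ b.holds I s
  | .not a => ¬ a.holds I s

def BExp.size : BExp → ℕ
  | .lt a b => a.size + b.size + 1
  | .eq a b => a.size + b.size + 1
  | .rlt a b => a.size + b.size + 1
  | .or a b => a.size + b.size + 1
  | .not a => a.size + 1

def State.setNat (s : State) (r : NReg) (v : ℕ) : State :=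
  { s with nat := Function.update s.nat r v }

def State.setReal (s : State) (r : RReg) (v : ℝ) : State :=
  { s with real := Function.update s.real r v }

def State.setList (s : State) (r : LReg) (v : List (ℕ × ℕ)) : State :=
  { s with list := Function.update s.list r v }

open Classical in
/-- Runs a program; returns the final state and the number of steps. -/
noncomputable def Cmd.exec (I : Input) : Cmd → State → State × ℕ
  | .skip, s => (s, 1)
  | .nat r e, s => (s.setNat r (e.eval I s), e.size + 1)
  | .real r e, s => (s.setReal r (e.eval I s), e.size + 1)
  | .list r e, s => (s.setList r (e.eval I s), e.size + 1)
  | .seq p p', s => ((p'.exec I (p.exec I s).1).1, (p.exec I s).2 + (p'.exec I (p.exec I s).1).2)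
  | .ite b p p', s =>
      if b.holds I s then ((p.exec I s).1, (p.exec I s).2 + b.size + 1)
      else ((p'.exec I s).1, (p'.exec I s).2 + b.size + 1)
  | .loop r lo hi p, s =>
      (List.range' (lo.eval I s) (hi.eval I s - lo.eval I s)).foldl
        (fun o v => ((p.exec I (o.1.setNat r v)).1, o.2 + (p.exec I (o.1.setNat r v)).2 + 1))
        (s, lo.size + hi.size + 1)

/-! ### The algorithm -/

/-- Sequential composition of a list of programs. -/
def seqs : List Cmd → Cmd
  | [] => .skip
  | p :: ps => .seq p (seqs ps)

/-- `if b then p`. -/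
def cond (b : BExp) (p : Cmd) : Cmd := .ite b p .skip

/-- The cost of the unordered pair of edges `e`, `f`. -/
def pairCost (e f : EExp) : RExp := .add (.q e f) (.q f e)

/-- The sum of a list of expressions. -/
def sumExp : List RExp → RExp
  | [] => .zero
  | a :: as => .add a (sumExp as)

/-- The edge at position `p` of the current cycle. -/
def here (p : NExp) : EExp := ⟨.reg .cyc, p⟩

/-- `r := r + e`. -/
def incr (r : RReg) (e : RExp) : Cmd := .real r (.add (.reg r) e)

/-- `r := r - e`. -/
def decr (r : RReg) (e : RExp) : Cmd := .real r (.sub (.reg r) e)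

/-- The names of the four trees. -/
def trees : List Entry := [.T1, .T2, .T3, .T4]

/-- The names of the three forests. -/
def forests : List Entry := [.F1, .F2, .F3]

/-- `path` := cost of the edges at positions `1, …, k-1` of the current cycle. -/
def pathCost : Cmd :=
  seqs [.real .path (.c (here (.num 1))),
    .loop .t (.num 2) .k
      (incr .path (.add (.c (here (.reg .t)))
        (pairCost (here (.sub (.reg .t) (.num 1))) (here (.reg .t)))))]

/-- Chooses the edges to be deleted from the current cycle besides the one at position `0`,
and sets `rest` to the cost of the remaining edges; the position `0` stands for no
further deletion. -/
def setDel (a b : NExp) : Cmd :=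
  seqs [.nat .del₁ a, .nat .del₂ b, .real .rest (.reg .path),
    cond (.lt (.num 0) (.reg .del₁))
      (seqs [decr .rest (.c (here (.reg .del₁))),
        cond (.lt (.num 1) (.reg .del₁))
          (decr .rest (pairCost (here (.sub (.reg .del₁) (.num 1))) (here (.reg .del₁)))),
        cond (.lt (.add (.reg .del₁) (.num 1)) .k)
          (decr .rest (pairCost (here (.reg .del₁)) (here (.add (.reg .del₁) (.num 1)))))]),
    cond (.lt (.num 0) (.reg .del₂))
      (seqs [decr .rest (.c (here (.reg .del₂))),
        cond (.lt (.num 1) (.reg .del₂))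
          (cond (.not (.eq (.sub (.reg .del₂) (.num 1)) (.reg .del₁)))
            (decr .rest (pairCost (here (.sub (.reg .del₂) (.num 1))) (here (.reg .del₂))))),
        cond (.lt (.add (.reg .del₂) (.num 1)) .k)
          (cond (.not (.eq (.add (.reg .del₂) (.num 1)) (.reg .del₁)))
            (decr .rest (pairCost (here (.reg .del₂)) (here (.add (.reg .del₂) (.num 1))))))])]

/-- `cand` := cost of the old object `j` together with the remaining edges of the current cycle.
The registers `x j` and `y j` hold the interaction costs of the old object `j` with the edges at
positions `1` and `k-1`. -/
def candidate (j : Entry) : Cmd :=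
  seqs [.real .cand (.add (.reg .rest) (.reg (.z j))),
    cond (.not (.or (.eq (.reg .del₁) (.num 1)) (.eq (.reg .del₂) (.num 1))))
      (incr .cand (.reg (.x j))),
    cond (.not (.or (.eq (.reg .del₁) (.sub .k (.num 1))) (.eq (.reg .del₂) (.sub .k (.num 1)))))
      (incr .cand (.reg (.y j)))]

/-- Makes the candidate built on the old object `j` the best one. -/
def take (j : Entry) : Cmd :=
  seqs [.real .best (.reg .cand), .nat .bestDel₁ (.reg .del₁), .nat .bestDel₂ (.reg .del₂),
    .list .src (.reg (.tree j))]

/-- The first candidate of a minimization. -/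
def start (j : Entry) : Cmd := seqs [candidate j, take j]

/-- A further candidate of a minimization. -/
def consider (j : Entry) : Cmd :=
  seqs [candidate j, cond (.rlt (.reg .cand) (.reg .best)) (take j)]

/-- Stores the best candidate as the new object `j`. -/
def commit (j : Entry) : Cmd :=
  seqs [.loop .t (.num 1) .k
      (cond (.not (.or (.eq (.reg .t) (.reg .bestDel₁)) (.eq (.reg .t) (.reg .bestDel₂))))
        (.list .src (.cons (here (.reg .t)) .src))),
    .list (.newTree j) (.reg .src), .real (.newZ j) (.reg .best)]

/-- The new object `j` is the best of the four old trees, each with the current cycle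
minus the edges at positions `0`, `a`, `b`. -/
def fromTrees (j : Entry) (a b : NExp) : Cmd :=
  seqs [setDel a b, start .T1, consider .T2, consider .T3, consider .T4, commit j]

/-- The new object `j` is the best of the following: the three old forests, each with the current
cycle minus the edges at positions `0`, `a`; and the four old trees, each with the current
cycle minus the edges at positions `0`, `a` and one further edge that is neither at
position `pos` nor adjacent to the edge at position `pos`. -/
def fromForests (j : Entry) (a : NExp) : Cmd :=
  seqs [setDel a (.num 0), start .F1, consider .F2, consider .F3,
    .loop .t (.num 1) .k
      (cond (.or (.lt (.add (.reg .t) (.num 1)) (.reg .pos))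
          (.lt (.add (.reg .pos) (.num 1)) (.reg .t)))
        (seqs [setDel a (.reg .t), consider .T1, consider .T2, consider .T3, consider .T4])),
    commit j]

/-- Replaces the seven objects by those of the ladder with the current cycle included. -/
def update : Cmd :=
  seqs [.nat .pos (.pos (.reg .cyc)), pathCost,
    fromTrees .T1 (.add (.reg .pos) (.num 1)) (.num 0),
    fromTrees .T2 (.sub (.reg .pos) (.num 1)) (.num 0),
    fromTrees .T3 (.reg .pos) (.num 0),
    fromForests .T4 (.num 0),
    fromTrees .F1 (.reg .pos) (.add (.reg .pos) (.num 1)),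
    fromTrees .F2 (.reg .pos) (.sub (.reg .pos) (.num 1)),
    fromForests .F3 (.reg .pos),
    seqs ((trees ++ forests).map fun j =>
      seqs [.real (.z j) (.reg (.newZ j)), .list (.tree j) (.reg (.newTree j))])]

/-- The first cycle: its trees and forests are obtained by fusing it to the single edge at
position `0` (whose only spanning tree is the edge itself, and whose only spanning forest
made of two trees is empty). -/
def init : Cmd :=
  seqs [.nat .cyc (.num 0),
    seqs (trees.map fun j =>
      seqs [.real (.z j) (.c (here (.num 0))), .list .src .nil,
        .list (.tree j) (.cons (here (.num 0)) .src),
        .real (.x j) (pairCost (here (.num 1)) (here (.num 0))),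
        .real (.y j) (pairCost (here (.sub .k (.num 1))) (here (.num 0)))]),
    seqs (forests.map fun j =>
      seqs [.real (.z j) .zero, .list (.tree j) .nil, .real (.x j) .zero, .real (.y j) .zero]),
    update]

/-- The index of the previous cycle. -/
def prevCyc : NExp := .sub (.reg .cyc) (.num 1)

/-- The edge of the previous cycle that is shared with the current one. -/
def prevA : EExp := ⟨prevCyc, .pos prevCyc⟩

/-- One neighbour of the shared edge in the previous cycle. -/
def prevB : EExp := ⟨prevCyc, .sub (.pos prevCyc) (.num 1)⟩

/-- The other neighbour of the shared edge in the previous cycle. -/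
def prevB' : EExp := ⟨prevCyc, .add (.pos prevCyc) (.num 1)⟩

/-- Which of the three edges `prevA`, `prevB`, `prevB'` belong to the old object `j`. -/
def contents : Entry → List EExp
  | .T1 => [prevA, prevB]
  | .T2 => [prevA, prevB']
  | .T3 => [prevB, prevB']
  | .T4 => [prevA, prevB, prevB']
  | .F1 => [prevB]
  | .F2 => [prevB']
  | .F3 => [prevB, prevB']

/-- One round of the main loop, for the current cycle `cyc ≥ 1`. -/
def round : Cmd :=
  seqs [seqs ((trees ++ forests).map fun j =>
      seqs [.real (.x j) (sumExp ((contents j).map (pairCost (here (.num 1))))),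
        .real (.y j) (sumExp ((contents j).map (pairCost (here (.sub .k (.num 1))))))]),
    update]

/-- Processes the cycles `0, …, m-1` (`m ≥ 1`). -/
def sweep (m : NExp) : Cmd := .seq init (.loop .cyc (.num 1) m round)

/-- Selects the best of the four trees of the whole ladder. -/
def finish : Cmd :=
  seqs [.real .best (.reg (.z .T1)), .list .out (.reg (.tree .T1)),
    seqs ([Entry.T2, .T3, .T4].map fun j =>
      cond (.rlt (.reg (.z j)) (.reg .best))
        (seqs [.real .best (.reg (.z j)), .list .out (.reg (.tree j))]))]

/-- The cost of an explicitly listed set of edges. -/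
def listCost : List EExp → RExp
  | [] => .zero
  | e :: es => .add (.add (.c e) (sumExp (es.map (pairCost e)))) (listCost es)

/-- Makes an explicitly listed tree, of cost `cand`, the best one. -/
def takeList (es : List EExp) : Cmd :=
  seqs [.real .best (.reg .cand), .list .out .nil, seqs (es.map fun e => .list .out (.cons e .out))]

/-- The first explicitly listed tree. -/
def startList (es : List EExp) : Cmd := seqs [.real .cand (listCost es), takeList es]

/-- A further explicitly listed tree. -/
def considerList (es : List EExp) : Cmd :=
  seqs [.real .cand (listCost es), cond (.rlt (.reg .cand) (.reg .best)) (takeList es)]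

/-- The edge at position `t` of cycle `i`, for fixed numbers `i`, `t`. -/
def fixed (i t : ℕ) : EExp := ⟨.num i, .num t⟩

/-- The case `k = 3`, in which `n ≤ 2`: the three spanning trees of a triangle, or the eight
spanning trees of two triangles with a common edge. -/
def small : Cmd :=
  .ite (.eq .n (.num 1))
    (seqs [startList [fixed 0 0, fixed 0 1], considerList [fixed 0 0, fixed 0 2],
      considerList [fixed 0 1, fixed 0 2]])
    (seqs [startList [fixed 0 0, fixed 0 1, fixed 1 1],
      considerList [fixed 0 0, fixed 0 1, fixed 1 2],
      considerList [fixed 0 0, fixed 0 2, fixed 1 1],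
      considerList [fixed 0 0, fixed 0 2, fixed 1 2],
      considerList [fixed 0 1, fixed 0 2, fixed 1 1],
      considerList [fixed 0 1, fixed 0 2, fixed 1 2],
      .loop .t (.num 0) (.num 3)
        (cond (.not (.eq (.reg .t) (.pos (.num 0))))
          (considerList [⟨.num 0, .reg .t⟩, fixed 1 1, fixed 1 2]))])

/-- The AQMST-`(k,n)`-ladder algorithm. It leaves the tree in the list register `out` and its cost
in the real register `best`. -/
def ladderAlgorithm : Cmd :=
  .ite (.lt .k (.num 4)) small (.seq (sweep .n) finish)

/-- The instance of the problem as it is presented to the machine. -/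
def Labelling.input {V : Type*} {G : SimpleGraph V} {k n : ℕ} (L : Labelling G k n)
    (c : Sym2 V → ℝ) (q : Sym2 V → Sym2 V → ℝ) : Input where
  k := k
  n := n
  pos := L.pos
  c := fun a => c (L.edge a.1 a.2)
  q := fun a b => q (L.edge a.1 a.2) (L.edge b.1 b.2)

end AQMST

/-! A ladder grows by gluing to the old graph, along one old edge, a path through new vertices. Let
`A` be a set of old edges and `S` the set of positions of the chosen path edges. Whether `A` and `S`
together form a spanning tree depends only on the number of missing path edges. If none is missing,
`A` must be a forest of two trees that separate the ends of the shared edge. If exactly one is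
missing, `A` must itself be a spanning tree. If two or more are missing, no `A` works. This is
`spanningTree_combine_iff`. It is proved by growing the path vertex by vertex
(`Attached.spans_splits_path`) and closing it with the fact that an edge joining the two trees of a
split forest produces a spanning tree, and conversely (`spans_insert_iff`). The same fact shows that
a split forest is a spanning tree minus the marked edge (`splitForest_iff`), so the count also
describes the forests.

Interaction costs are local. A path edge at one of the positions `2, …, k - 2` has two new ends and
meets no old edge; the edges at positions `1` and `k - 1` meet the old graph only in the ends of the
shared edge. For `k ≥ 4` these ends were new in the previous cycle, so the only old edges at them
are the shared edge and its two neighbours there. The seven names record exactly which of these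
three edges belong to the object. Hence, for `A` with a given name and given deletions, the cost of
the combination is the cost of `A` plus a constant (`sum_near`, `cost_combine`,
`cost_combine_keep`), and it suffices to know one cheapest object of each name.

A tree misses at most one path edge, and a split forest misses the marked edge and at most one more.
So four tree patterns and three forest patterns are exhaustive, and the combinations listed by the
algorithm are precisely the admissible ones (`admissible_iff`). Optimality passes from one cycle to
the next in `Solved.next`. The first cycle needs no separate argument: it is regarded as glued to a
single edge, whose only tree is that edge and whose only split forest is empty.

On the machine side, loop invariants (`exec_loop`) and two syntactic frame rules (`agrees_exec`,
`spares_exec`) show that each round stores a minimum over the candidates. The path cost after a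
deletion comes from the full path cost by constantly many subtractions, so each round takes `O(k)`
steps and the sweep `O(k n)` (`runs_ladderAlgorithm`). For `k = 3` no free edge remains after the
second triangle, so `n ≤ 2` and the trees are listed explicitly. -/

namespace AQMST

/-! ### Spanning trees and split forests of vertex sets -/

section Forests

variable {V : Type*}

/-- `A` is the edge set of a forest that connects all vertices of `W`. -/
def Spans (A : Set (Sym2 V)) (W : Set V) : Prop :=
  (SimpleGraph.fromEdgeSet A).IsAcyclic ∧
    ∀ u ∈ W, ∀ w ∈ W, (SimpleGraph.fromEdgeSet A).Reachable u w

/-- `A` is the edge set of a forest that connects every vertex of `W` to exactly one of the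
vertices `u` and `v`. -/
def Splits (A : Set (Sym2 V)) (W : Set V) (u v : V) : Prop :=
  (SimpleGraph.fromEdgeSet A).IsAcyclic ∧ ¬ (SimpleGraph.fromEdgeSet A).Reachable u v ∧
    ∀ w ∈ W, (SimpleGraph.fromEdgeSet A).Reachable w u ∨ (SimpleGraph.fromEdgeSet A).Reachable w v

theorem Splits.symm {A : Set (Sym2 V)} {W : Set V} {u v : V} (h : Splits A W u v) :
    Splits A W v u :=
  ⟨h.1, fun hr => h.2.1 hr.symm, fun w hw => (h.2.2 w hw).symm⟩

theorem splits_comm {A : Set (Sym2 V)} {W : Set V} {u v : V} :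
    Splits A W u v ↔ Splits A W v u :=
  ⟨Splits.symm, Splits.symm⟩

/-- One passage through the new edge is enough. In the induction along the walk, a passage that
later returns is cut out, which leaves only the three alternatives. -/
theorem reachable_insert {A : Set (Sym2 V)} {u v a b : V} :
    (SimpleGraph.fromEdgeSet (insert s(u, v) A)).Reachable a b ↔
      (SimpleGraph.fromEdgeSet A).Reachable a b ∨
      ((SimpleGraph.fromEdgeSet A).Reachable a u ∧ (SimpleGraph.fromEdgeSet A).Reachable v b) ∨
      ((SimpleGraph.fromEdgeSet A).Reachable a v ∧ (SimpleGraph.fromEdgeSet A).Reachable u b) := by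
  have hle : SimpleGraph.fromEdgeSet A ≤ SimpleGraph.fromEdgeSet (insert s(u, v) A) :=
    SimpleGraph.fromEdgeSet_mono (Set.subset_insert _ _)
  have huv : (SimpleGraph.fromEdgeSet (insert s(u, v) A)).Reachable u v := by
    by_cases h : u = v
    · rw [h]
    · exact SimpleGraph.Adj.reachable (by simp [h])
  constructor
  · rintro ⟨p⟩
    induction p with
    | nil => exact Or.inl (SimpleGraph.Reachable.refl _)
    | @cons a' b' c' hab p ih =>
      rw [SimpleGraph.fromEdgeSet_adj, Set.mem_insert_iff] at hab
      obtain ⟨h | h, hne⟩ := hab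
      · rw [Sym2.eq_iff] at h
        rcases h with ⟨rfl, rfl⟩ | ⟨rfl, rfl⟩
        · rcases ih with h1 | ⟨_, h2⟩ | ⟨_, h2⟩
          · exact Or.inr (Or.inl ⟨SimpleGraph.Reachable.refl _, h1⟩)
          · exact Or.inr (Or.inl ⟨SimpleGraph.Reachable.refl _, h2⟩)
          · exact Or.inl h2
        · rcases ih with h1 | ⟨_, h2⟩ | ⟨_, h2⟩
          · exact Or.inr (Or.inr ⟨SimpleGraph.Reachable.refl _, h1⟩)
          · exact Or.inl h2
          · exact Or.inr (Or.inr ⟨SimpleGraph.Reachable.refl _, h2⟩)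
      · have hr : (SimpleGraph.fromEdgeSet A).Reachable a' b' :=
          SimpleGraph.Adj.reachable (by simp [h, hne])
        rcases ih with h1 | ⟨h1, h2⟩ | ⟨h1, h2⟩
        · exact Or.inl (hr.trans h1)
        · exact Or.inr (Or.inl ⟨hr.trans h1, h2⟩)
        · exact Or.inr (Or.inr ⟨hr.trans h1, h2⟩)
  · rintro (h | ⟨h1, h2⟩ | ⟨h1, h2⟩)
    · exact h.mono hle
    · exact (h1.mono hle).trans (huv.trans (h2.mono hle))
    · exact (h1.mono hle).trans (huv.symm.trans (h2.mono hle))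

theorem isAcyclic_insert {A : Set (Sym2 V)} {u v : V} (huv : u ≠ v) (h : s(u, v) ∉ A) :
    (SimpleGraph.fromEdgeSet (insert s(u, v) A)).IsAcyclic ↔
      (SimpleGraph.fromEdgeSet A).IsAcyclic ∧ ¬ (SimpleGraph.fromEdgeSet A).Reachable u v := by
  have : SimpleGraph.fromEdgeSet (insert s(u, v) A) =
      SimpleGraph.fromEdgeSet A ⊔ SimpleGraph.edge u v := by
    ext a b; simp [SimpleGraph.edge_adj]; tauto
  rw [this, SimpleGraph.isAcyclic_sup_fromEdgeSet_iff]
  simp [huv, h]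

/-- An edge between the two trees of a forest merges them, and an edge of a tree separates its ends
when removed. Closing a cycle and passing between trees and split forests both rest on this. -/
theorem spans_insert_iff {A : Set (Sym2 V)} {W : Set V} {u v : V} (huv : u ≠ v)
    (h : s(u, v) ∉ A) (hu : u ∈ W) :
    Spans (insert s(u, v) A) W ↔ Splits A W u v := by
  unfold Spans Splits
  rw [isAcyclic_insert huv h]
  simp only [reachable_insert]
  constructor
  · rintro ⟨⟨h1, h2⟩, h3⟩
    refine ⟨h1, h2, fun w hw => ?_⟩
    rcases h3 w hw u hu with h | ⟨h, _⟩ | ⟨h, _⟩ <;> tauto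
  · rintro ⟨h1, h2, h3⟩
    refine ⟨⟨h1, h2⟩, fun a ha b hb => ?_⟩
    rcases h3 a ha with h | h <;> rcases h3 b hb with h' | h'
    · exact Or.inl (h.trans h'.symm)
    · exact Or.inr (Or.inl ⟨h, h'.symm⟩)
    · exact Or.inr (Or.inr ⟨h, h'.symm⟩)
    · exact Or.inl (h.trans h'.symm)

theorem reachable_isolated {A : Set (Sym2 V)} {w a : V} (hw : ∀ e ∈ A, w ∉ e) :
    (SimpleGraph.fromEdgeSet A).Reachable w a ↔ w = a := by
  constructor
  · rintro ⟨p⟩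
    cases p with
    | nil => rfl
    | cons h _ =>
      rw [SimpleGraph.fromEdgeSet_adj] at h
      exact absurd (Sym2.mem_mk_left _ _) (hw _ h.1)
  · rintro rfl; exact SimpleGraph.Reachable.refl _

theorem reachable_isolated' {A : Set (Sym2 V)} {w a : V} (hw : ∀ e ∈ A, w ∉ e) :
    (SimpleGraph.fromEdgeSet A).Reachable a w ↔ w = a := by
  rw [← reachable_isolated hw]; exact SimpleGraph.reachable_comm

theorem spans_pendant {A : Set (Sym2 V)} {W : Set V} {v w : V} (hw : ∀ e ∈ A, w ∉ e)
    (hv : v ∈ W) (hwW : w ∉ W) : Spans (insert s(v, w) A) (insert w W) ↔ Spans A W := by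
  have hvw : v ≠ w := by rintro rfl; exact hwW hv
  have hmem : s(v, w) ∉ A := fun h => hw _ h (Sym2.mem_mk_right _ _)
  rw [spans_insert_iff hvw hmem (Set.mem_insert_of_mem _ hv)]
  unfold Spans Splits
  constructor
  · rintro ⟨h1, h2, h3⟩
    have key : ∀ a ∈ W, (SimpleGraph.fromEdgeSet A).Reachable a v := fun a ha => by
      rcases h3 a (Set.mem_insert_of_mem _ ha) with h | h
      · exact h
      · rw [reachable_isolated' hw] at h; exact absurd (h ▸ ha) hwW
    exact ⟨h1, fun a ha b hb => (key a ha).trans (key b hb).symm⟩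
  · rintro ⟨h1, h2⟩
    refine ⟨h1, fun h => hvw ((reachable_isolated' hw).1 h).symm, fun a ha => ?_⟩
    rcases ha with rfl | ha
    · exact Or.inr (SimpleGraph.Reachable.refl _)
    · exact Or.inl (h2 a ha v hv)

/-- The new vertex hangs on `v` and so takes over the role of `v` as the end to be separated from
`u`. -/
theorem splits_pendant {A : Set (Sym2 V)} {W : Set V} {u v w : V} (hw : ∀ e ∈ A, w ∉ e)
    (hu : u ∈ W) (hv : v ∈ W) (hwW : w ∉ W) :
    Splits (insert s(v, w) A) (insert w W) u w ↔ Splits A W u v := by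
  have hvw : v ≠ w := by rintro rfl; exact hwW hv
  have huw : u ≠ w := by rintro rfl; exact hwW hu
  have hmem : s(v, w) ∉ A := fun h => hw _ h (Sym2.mem_mk_right _ _)
  unfold Splits
  rw [isAcyclic_insert hvw hmem]
  simp only [reachable_insert, reachable_isolated' hw, reachable_isolated hw]
  have hr : (SimpleGraph.fromEdgeSet A).Reachable v v := SimpleGraph.Reachable.refl _
  constructor
  · rintro ⟨⟨h1, h2⟩, h3, h4⟩
    refine ⟨h1, by tauto, fun a ha => ?_⟩
    have hwa : w ≠ a := by rintro rfl; exact hwW ha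
    rcases h4 a (Set.mem_insert_of_mem _ ha) with h | h <;> tauto
  · rintro ⟨h1, h2, h3⟩
    refine ⟨⟨h1, hvw.symm⟩, by tauto, fun a ha => ?_⟩
    rcases ha with rfl | ha
    · simp
    · rcases h3 a ha with h | h <;> tauto

theorem not_spans_isolated {A : Set (Sym2 V)} {W : Set V} {u w : V} (hw : ∀ e ∈ A, w ∉ e)
    (hu : u ∈ W) (hwW : w ∈ W) (huw : u ≠ w) : ¬ Spans A W := fun h =>
  huw ((reachable_isolated' hw).1 (h.2 u hu w hwW)).symm

/-- Joining `u` and `w` by an edge turns the split forest into a tree in which `w` is pendant. -/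
theorem splits_isolated {A : Set (Sym2 V)} {W : Set V} {u w : V} (hw : ∀ e ∈ A, w ∉ e)
    (hu : u ∈ W) (hwW : w ∉ W) : Splits A (insert w W) u w ↔ Spans A W := by
  have huw : u ≠ w := by rintro rfl; exact hwW hu
  rw [← spans_insert_iff huw (fun h => hw _ h (Sym2.mem_mk_right _ _))
    (Set.mem_insert_of_mem _ hu), spans_pendant hw hu hwW]

/-! ### Fusing a cycle -/

/-- The edges of a cycle at the positions in `S` below `m`. -/
def pathEdges (f : ℕ → Sym2 V) (S : Finset ℕ) (m : ℕ) : Set (Sym2 V) :=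
  {e | ∃ t ∈ S, 1 ≤ t ∧ t < m ∧ e = f t}

theorem pathEdges_one (f : ℕ → Sym2 V) (S : Finset ℕ) : pathEdges f S 1 = ∅ := by
  ext e; simp only [pathEdges, Set.mem_ofPred_eq, Set.mem_empty_iff_false, iff_false]
  rintro ⟨t, _, h1, h2, _⟩; omega

theorem pathEdges_succ_of_mem {f : ℕ → Sym2 V} {S : Finset ℕ} {m : ℕ} (hm : 1 ≤ m) (h : m ∈ S) :
    pathEdges f S (m + 1) = insert (f m) (pathEdges f S m) := by
  ext e
  simp only [pathEdges, Set.mem_ofPred_eq, Set.mem_insert_iff]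
  constructor
  · rintro ⟨t, h1, h2, h3, rfl⟩
    rcases Nat.lt_succ_iff_lt_or_eq.1 h3 with h4 | rfl
    · exact Or.inr ⟨t, h1, h2, h4, rfl⟩
    · exact Or.inl rfl
  · rintro (rfl | ⟨t, h1, h2, h3, rfl⟩)
    · exact ⟨m, h, hm, by omega, rfl⟩
    · exact ⟨t, h1, h2, by omega, rfl⟩

theorem pathEdges_succ_of_notMem {f : ℕ → Sym2 V} {S : Finset ℕ} {m : ℕ} (h : m ∉ S) :
    pathEdges f S (m + 1) = pathEdges f S m := by
  ext e
  simp only [pathEdges, Set.mem_ofPred_eq]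
  constructor
  · rintro ⟨t, h1, h2, h3, rfl⟩
    exact ⟨t, h1, h2, lt_of_le_of_ne (by omega) (by rintro rfl; exact h h1), rfl⟩
  · rintro ⟨t, h1, h2, h3, rfl⟩
    exact ⟨t, h1, h2, by omega, rfl⟩

/-- The number of positions from `1` to `m - 1` that are missing in `S`. -/
def missing (S : Finset ℕ) (m : ℕ) : ℕ := ((Finset.Ico 1 m).filter (· ∉ S)).card

theorem missing_succ {S : Finset ℕ} {m : ℕ} (hm : 1 ≤ m) :
    missing S (m + 1) = missing S m + if m ∈ S then 0 else 1 := by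
  unfold missing
  rw [← Finset.insert_Ico_right_eq_Ico_add_one hm, Finset.filter_insert]
  by_cases h : m ∈ S
  · simp [h]
  · rw [if_pos h, if_neg h, Finset.card_insert_of_notMem (by simp)]

/-- The vertices of the old graph and the vertices `x 2, …, x m` of the path. -/
def growVerts (W : Set V) (x : ℕ → V) (m : ℕ) : Set V := W ∪ {v | ∃ t, 2 ≤ t ∧ t ≤ m ∧ x t = v}

theorem growVerts_succ (W : Set V) (x : ℕ → V) {m : ℕ} (hm : 1 ≤ m) :
    growVerts W x (m + 1) = insert (x (m + 1)) (growVerts W x m) := by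
  ext v
  simp only [growVerts, Set.mem_union, Set.mem_ofPred_eq, Set.mem_insert_iff]
  constructor
  · rintro (h | ⟨t, h1, h2, rfl⟩)
    · tauto
    · rcases Nat.le_succ_iff.1 h2 with h3 | rfl
      · exact Or.inr (Or.inr ⟨t, h1, h3, rfl⟩)
      · exact Or.inl rfl
  · rintro (rfl | h | ⟨t, h1, h2, rfl⟩)
    · exact Or.inr ⟨m + 1, by omega, le_rfl, rfl⟩
    · exact Or.inl h
    · exact Or.inr ⟨t, h1, by omega, rfl⟩

/-- A cycle `x 0, …, x (k-1)` of which exactly the vertices `x 0` and `x 1` belong to `W`. -/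
structure Attached (k : ℕ) (x : ℕ → V) (W : Set V) : Prop where
  three_le : 3 ≤ k
  inj : Set.InjOn x (Set.Iio k)
  mem_zero : x 0 ∈ W
  mem_one : x 1 ∈ W
  fresh : ∀ t, 2 ≤ t → t < k → x t ∉ W

namespace Attached

variable {k : ℕ} {x : ℕ → V} {W : Set V}

theorem ne (h : Attached k x W) {s t : ℕ} (hs : s < k) (ht : t < k) (hst : s ≠ t) : x s ≠ x t :=
  fun he => hst (h.inj hs ht he)

theorem notMem_growVerts (h : Attached k x W) {m : ℕ} (hm : 1 ≤ m) (hmk : m + 1 < k) :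
    x (m + 1) ∉ growVerts W x m := by
  rintro (h1 | ⟨t, h1, h2, h3⟩)
  · exact h.fresh _ (by omega) hmk h1
  · exact h.ne (by omega) hmk (by omega) h3

theorem mem_growVerts (h : Attached k x W) {m : ℕ} (hm : 1 ≤ m) : x m ∈ growVerts W x m := by
  rcases Nat.lt_or_ge 1 m with h1 | h1
  · exact Or.inr ⟨m, h1, le_rfl, rfl⟩
  · obtain rfl : m = 1 := by omega
    exact Or.inl h.mem_one

/-- If the edge to `x (m + 1)` is present, both properties persist with `x (m + 1)` in place of `x
m`. If it is absent, `x (m + 1)` is isolated: spanning fails, and splitting means that everything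
before is spanned. The second equivalence at `m + 1` thus uses the first one at `m`, so the two are
proved together. -/
theorem spans_splits_path (h : Attached k x W) {A : Set (Sym2 V)} {f : ℕ → Sym2 V}
    (hA : ∀ e ∈ A, ∀ v ∈ e, v ∈ W) (hf : ∀ t, t + 1 < k → f t = s(x t, x (t + 1)))
    (S : Finset ℕ) (m : ℕ) (hm : 1 ≤ m) (hmk : m < k) :
    (Spans (A ∪ pathEdges f S m) (growVerts W x m) ↔ missing S m = 0 ∧ Spans A W) ∧
    (Splits (A ∪ pathEdges f S m) (growVerts W x m) (x 0) (x m) ↔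
      (missing S m = 0 ∧ Splits A W (x 0) (x 1)) ∨ (missing S m = 1 ∧ Spans A W)) := by
  induction m, hm using Nat.le_induction with
  | base =>
    have hW : growVerts W x 1 = W := by
      ext v; simp only [growVerts, Set.mem_union, Set.mem_ofPred_eq, or_iff_left_iff_imp]
      rintro ⟨t, h1, h2, _⟩; omega
    rw [pathEdges_one, hW]
    simp [missing]
  | succ m hm ih =>
    obtain ⟨ih1, ih2⟩ := ih (by omega)
    have hiso : ∀ e ∈ A ∪ pathEdges f S m, x (m + 1) ∉ e := by
      rintro e (he | ⟨t, _, h2, h3, rfl⟩) hx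
      · exact h.fresh _ (by omega) hmk (hA e he _ hx)
      · rw [hf t (by omega), Sym2.mem_iff] at hx
        rcases hx with hx | hx
        · exact h.ne hmk (by omega) (by omega) hx
        · exact h.ne hmk (by omega) (by omega) hx
    have hu : x 0 ∈ growVerts W x m := Or.inl h.mem_zero
    have hv := h.mem_growVerts hm
    have hw := h.notMem_growVerts hm hmk
    rw [missing_succ hm, growVerts_succ W x hm]
    by_cases hS : m ∈ S
    · rw [pathEdges_succ_of_mem hm hS, Set.union_insert, hf m hmk, spans_pendant hiso hv hw,
        splits_pendant hiso hu hv hw, ih1, ih2]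
      simp [hS]
    · rw [pathEdges_succ_of_notMem hS, splits_isolated hiso hu hw, ih1]
      have := not_spans_isolated hiso (Set.mem_insert_of_mem (x (m + 1)) hu)
        (Set.mem_insert _ _) (by rintro h'; exact hw (h' ▸ hu))
      simp [hS, this]

/-- The edge at position `k - 1` returns to `x 0`. If it is present, the path before it must have
left two trees that separate its ends; if it is absent, the path must already span. -/
theorem spans_cycle (h : Attached k x W) {A : Set (Sym2 V)}
    (hA : ∀ e ∈ A, ∀ v ∈ e, v ∈ W) (S : Finset ℕ) :
    Spans (A ∪ pathEdges (fun t => s(x t, x ((t + 1) % k))) S k) (growVerts W x (k - 1)) ↔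
      (missing S k = 0 ∧ Splits A W (x 0) (x 1)) ∨ (missing S k = 1 ∧ Spans A W) := by
  obtain ⟨m, rfl⟩ : ∃ m, k = m + 1 := ⟨k - 1, by have := h.three_le; omega⟩
  have h3 := h.three_le
  obtain ⟨h1, h2⟩ := h.spans_splits_path (f := fun t => s(x t, x ((t + 1) % (m + 1)))) hA
    (fun t ht => by rw [Nat.mod_eq_of_lt ht]) S m (by omega) (by omega)
  have hm : 1 ≤ m := by omega
  rw [missing_succ hm]
  by_cases hS : m ∈ S
  · rw [pathEdges_succ_of_mem hm hS, Set.union_insert]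
    have hne : x m ≠ x 0 := h.ne (by omega) (by omega) (by omega)
    simp only [Nat.mod_self, Nat.add_sub_cancel]
    rw [spans_insert_iff hne ?_ (h.mem_growVerts hm), splits_comm, h2]
    · simp [hS]
    -- The closing edge is not yet present: an old edge cannot contain the new vertex `x m`, and no
    -- earlier path edge joins `x m` to `x 0`.
    · rintro (he | ⟨t, _, ht1, ht2, he⟩)
      · exact h.fresh m (by omega) (by omega) (hA _ he _ (Sym2.mem_mk_left _ _))
      · dsimp only at he
        rw [Nat.mod_eq_of_lt (by omega), Sym2.eq_iff] at he
        rcases he with ⟨he, _⟩ | ⟨_, he⟩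
        · exact h.ne (by omega) (by omega) (by omega) he
        · exact h.ne (by omega) (by omega) (by omega) he
  · rw [pathEdges_succ_of_notMem hS]
    simp only [Nat.add_sub_cancel]
    rw [h1]
    simp [hS]

end Attached

end Forests

end AQMST

namespace AQMST

/-! ### Every ladder has a labelling -/

section Presentation

variable {V : Type*}

/-- The conditions on a labelling, for the ladder with vertex set `W` and edge set `E`. -/
structure Presents (k n : ℕ) (W : Set V) (E : Set (Sym2 V)) (x : ℕ → ℕ → V) (pos : ℕ → ℕ) :
    Prop where
  inj : ∀ i, i < n → Set.InjOn (x i) (Set.Iio k)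
  pos_lt : ∀ i, i < n → pos i < k
  pos_free : 4 ≤ k → ∀ i, i < n → 2 ≤ pos i ∧ pos i + 2 ≤ k
  glue : ∀ i, i + 1 < n →
    s(x (i + 1) 0, x (i + 1) 1) = s(x i (pos i), x i ((pos i + 1) % k))
  fresh : ∀ i, i + 1 < n → ∀ t, 2 ≤ t → t < k →
    ∀ j, j ≤ i → ∀ u, u < k → x (i + 1) t ≠ x j u
  verts_eq : ∀ v, v ∈ W ↔ ∃ i, i < n ∧ ∃ t, t < k ∧ x i t = v
  edges_eq : ∀ e, e ∈ E ↔ ∃ i, i < n ∧ e ∈ cycleEdges k (x i)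

/-- Every position of a cyclic list can be moved to position `2` by a rotation. -/
theorem exists_rotation {k : ℕ} (hk : 4 ≤ k) {x : ℕ → V} (inj : Set.InjOn x (Set.Iio k)) {e : Sym2 V}
    (he : e ∈ cycleEdges k x) :
    ∃ y : ℕ → V, Set.InjOn y (Set.Iio k) ∧ y '' Set.Iio k = x '' Set.Iio k ∧
      cycleEdges k y = cycleEdges k x ∧ s(y 2, y 3) = e := by
  obtain ⟨t, ht, rfl⟩ := he
  have hmod : ∀ a, a % k < k := fun a => Nat.mod_lt _ (by omega)
  -- `u + k - t + 2` undoes the shift by `t + k - 2`; the summand `k` keeps the subtractions from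
  -- being truncated.
  have hsurj : ∀ u, u < k → ((u + k - t + 2) % k + (t + k - 2)) % k = u := fun u hu => by
    rw [Nat.mod_add_mod, show u + k - t + 2 + (t + k - 2) = u + k + k by omega]
    simp [Nat.mod_eq_of_lt hu]
  -- The shift is by `t - 2` modulo `k`, so that position `2` receives the edge at `t`.
  refine ⟨fun a => x ((a + (t + k - 2)) % k), ?_, ?_, ?_, ?_⟩
  · intro a ha b hb hab
    have h := inj (hmod _) (hmod _) hab
    have h' : a ≡ b [MOD k] := Nat.ModEq.add_right_cancel' _ h
    rwa [Nat.ModEq, Nat.mod_eq_of_lt ha, Nat.mod_eq_of_lt hb] at h'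
  · ext v
    simp only [Set.mem_image, Set.mem_Iio]
    constructor
    · rintro ⟨a, _, rfl⟩; exact ⟨_, hmod _, rfl⟩
    · rintro ⟨u, hu, rfl⟩; exact ⟨_, hmod _, by rw [hsurj u hu]⟩
  · ext e
    simp only [cycleEdges, Set.mem_ofPred_eq]
    have hstep : ∀ a, ((a + 1) % k + (t + k - 2)) % k = ((a + (t + k - 2)) % k + 1) % k :=
      fun a => by rw [Nat.mod_add_mod, Nat.mod_add_mod]; congr 1; omega
    constructor
    · rintro ⟨a, _, rfl⟩
      exact ⟨_, hmod (a + (t + k - 2)), by rw [hstep]⟩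
    · rintro ⟨u, hu, rfl⟩
      exact ⟨_, hmod (u + k - t + 2), by rw [hstep ((u + k - t + 2) % k), hsurj u hu]⟩
  · dsimp only
    rw [show 2 + (t + k - 2) = t + k by omega, show 3 + (t + k - 2) = t + 1 + k by omega]
    simp [Nat.mod_eq_of_lt ht]

theorem presents_cycle {k : ℕ} {x : ℕ → V} (inj : Set.InjOn x (Set.Iio k)) {p : ℕ} (hp : p < k)
    (hp' : 4 ≤ k → 2 ≤ p ∧ p + 2 ≤ k) :
    Presents k 1 (x '' Set.Iio k) (cycleEdges k x) (fun _ => x) (fun _ => p) where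
  inj := fun _ _ => inj
  pos_lt := fun _ _ => hp
  pos_free := fun h _ _ => hp' h
  glue := fun i hi => by omega
  fresh := fun i hi => by omega
  verts_eq := fun v => by
    constructor
    · rintro ⟨t, ht, rfl⟩; exact ⟨0, by omega, t, ht, rfl⟩
    · rintro ⟨_, _, t, ht, rfl⟩; exact ⟨t, ht, rfl⟩
  edges_eq := fun e => ⟨fun h => ⟨0, by omega, h⟩, fun ⟨_, _, h⟩ => h⟩

/-- The hypothesis `glue` ranges over all `i` with `i + 1 = n` instead of naming `n - 1`, so `n = 0`
needs no separate case. -/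
theorem Presents.fuse {k n : ℕ} {W : Set V} {E : Set (Sym2 V)} {x : ℕ → ℕ → V} {pos : ℕ → ℕ}
    (h : Presents k n W E x pos) {y : ℕ → V} (inj : Set.InjOn y (Set.Iio k))
    (glue : ∀ i, i + 1 = n → s(y 0, y 1) = s(x i (pos i), x i ((pos i + 1) % k)))
    (fresh : ∀ t, 2 ≤ t → t < k → y t ∉ W) {p : ℕ} (hp : p < k)
    (hp' : 4 ≤ k → 2 ≤ p ∧ p + 2 ≤ k) :
    Presents k (n + 1) (W ∪ y '' Set.Iio k) (E ∪ cycleEdges k y)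
      (fun i => if i < n then x i else y) (fun i => if i < n then pos i else p) where
  inj := fun i _ => by
    by_cases hi : i < n
    · simpa [hi] using h.inj i hi
    · simpa [hi] using inj
  pos_lt := fun i _ => by
    by_cases hi : i < n
    · simpa [hi] using h.pos_lt i hi
    · simpa [hi] using hp
  pos_free := fun hk i _ => by
    by_cases hi : i < n
    · simpa [hi] using h.pos_free hk i hi
    · simpa [hi] using hp' hk
  glue := fun i hi => by
    have hi' : i < n := by omega
    by_cases hi2 : i + 1 < n
    · simpa [hi', hi2] using h.glue i hi2
    · simpa [hi', hi2] using glue i (by omega)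
  fresh := fun i hi t ht htk j hj u hu => by
    have hj' : j < n := by omega
    by_cases hi2 : i + 1 < n
    · simpa [hj', hi2] using h.fresh i hi2 t ht htk j hj u hu
    · simp only [hj', hi2, if_true, if_false]
      intro he
      exact fresh t ht htk ((h.verts_eq _).2 ⟨j, hj', u, hu, he.symm⟩)
  verts_eq := fun v => by
    rw [Set.mem_union, h.verts_eq]
    constructor
    · rintro (⟨i, hi, t, ht, rfl⟩ | ⟨t, ht, rfl⟩)
      · exact ⟨i, by omega, t, ht, by simp [hi]⟩
      · exact ⟨n, by omega, t, ht, by simp⟩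
    · rintro ⟨i, _, t, ht, rfl⟩
      by_cases hi : i < n
      · exact Or.inl ⟨i, hi, t, ht, by simp [hi]⟩
      · exact Or.inr ⟨t, ht, by simp [hi]⟩
  edges_eq := fun e => by
    rw [Set.mem_union, h.edges_eq]
    constructor
    · rintro (⟨i, hi, he⟩ | he)
      · exact ⟨i, by omega, by simpa [hi] using he⟩
      · exact ⟨n, by omega, by simpa using he⟩
    · rintro ⟨i, _, he⟩
      by_cases hi : i < n
      · exact Or.inl ⟨i, hi, by simpa [hi] using he⟩
      · exact Or.inr (by simpa [hi] using he)

theorem LadderBuild.one_le {k n : ℕ} {W : Set V} {E F : Set (Sym2 V)}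
    (h : LadderBuild k n W E F) : 1 ≤ n := by
  cases h <;> omega

/-- A fused triangle brings only one new vertex, so no edge has two new ends and nothing can be
fused afterwards. -/
theorem LadderBuild.le_two {n : ℕ} {W : Set V} {E F : Set (Sym2 V)}
    (h : LadderBuild 3 n W E F) : n ≤ 2 := by
  cases h with
  | cycle => omega
  | fuse m W' E' F' x prev inj free fresh =>
    cases prev with
    | cycle => omega
    | fuse =>
      obtain ⟨t, h1, h2, _⟩ := free
      omega

/-- The marked position of the last cycle is known only when the next cycle arrives. The induction
therefore provides, for every free edge, a presentation that marks this edge. A rotation is needed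
only in the first cycle, where the free edge may lie anywhere; in later cycles the new ends already
keep it away from position `0`. -/
theorem LadderBuild.exists_presents {k n : ℕ} {W : Set V} {E F : Set (Sym2 V)} (hk : 3 ≤ k)
    (h : LadderBuild k n W E F) :
    (∃ x pos, Presents k n W E x pos) ∧ ∀ e ∈ F, ∃ x pos, Presents k n W E x pos ∧
      ∀ i, i + 1 = n → e = s(x i (pos i), x i ((pos i + 1) % k)) := by
  induction h with
  | cycle x inj =>
    refine ⟨⟨_, _, presents_cycle inj (p := 2) (by omega) (by omega)⟩, fun e he => ?_⟩
    by_cases hk4 : 4 ≤ k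
    · obtain ⟨y, hy, hW, hE, he'⟩ := exists_rotation hk4 inj he
      rw [← hW, ← hE]
      refine ⟨_, _, presents_cycle hy (p := 2) (by omega) (by omega), fun i _ => ?_⟩
      rw [← he', Nat.mod_eq_of_lt (by omega)]
    · obtain ⟨t, ht, rfl⟩ := he
      exact ⟨_, _, presents_cycle inj (p := t) ht (by omega), fun i _ => rfl⟩
  | fuse n W E F y prev inj free fresh ih =>
    obtain ⟨x, pos, hP, hglue⟩ := ih.2 _ free
    refine ⟨⟨_, _, hP.fuse inj hglue fresh (p := 2) (by omega) (by omega)⟩, ?_⟩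
    rintro e ⟨t, h1, h2, rfl⟩
    refine ⟨_, _, hP.fuse inj hglue fresh (p := t) (by omega) (by omega), fun i hi => ?_⟩
    obtain rfl : i = n := by omega
    simp [Nat.mod_eq_of_lt h2]

theorem IsLadder.nonempty_labelling {k n : ℕ} {G : SimpleGraph V} (h : IsLadder k n G) :
    Nonempty (Labelling G k n) := by
  obtain ⟨hk, F, hF⟩ := h
  obtain ⟨⟨x, pos, hP⟩, _⟩ := hF.exists_presents hk
  exact ⟨⟨x, pos, hP.inj, hP.pos_lt, hP.pos_free, hP.glue, hP.fresh,
    fun v => (hP.verts_eq v).1 (Set.mem_univ _), hP.edges_eq⟩⟩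

end Presentation

end AQMST

namespace AQMST

/-! ### Running times -/

/-- The program `p` takes `O(f)` steps on all inputs with `k ≥ 1` and `n ≥ 1`. -/
def Runs (f : Input → ℕ) (p : Cmd) : Prop :=
  ∃ a, ∀ I : Input, 1 ≤ I.k → 1 ≤ I.n → ∀ s, (p.exec I s).2 ≤ a * f I

namespace Runs

variable {f : Input → ℕ} {p p' : Cmd}

theorem of_le (a : ℕ) (h : ∀ I s, (p.exec I s).2 ≤ a) : Runs (fun _ => 1) p :=
  ⟨a, fun I _ _ s => by simpa using h I s⟩

theorem skip : Runs (fun _ => 1) .skip := of_le 1 fun _ _ => le_rfl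

theorem nat (r : NReg) (e : NExp) : Runs (fun _ => 1) (.nat r e) := of_le (e.size + 1) fun _ _ => le_rfl

theorem real (r : RReg) (e : RExp) : Runs (fun _ => 1) (.real r e) :=
  of_le (e.size + 1) fun _ _ => le_rfl

theorem list (r : LReg) (e : LExp) : Runs (fun _ => 1) (.list r e) :=
  of_le (e.size + 1) fun _ _ => le_rfl

theorem seq (h : Runs f p) (h' : Runs f p') : Runs f (.seq p p') := by
  obtain ⟨a, ha⟩ := h
  obtain ⟨b, hb⟩ := h'
  refine ⟨a + b, fun I hk hn s => ?_⟩
  rw [add_mul]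
  exact add_le_add (ha I hk hn s) (hb I hk hn _)

theorem linear (h : Runs (fun _ => 1) p) : Runs Input.k p := by
  obtain ⟨a, ha⟩ := h
  exact ⟨a, fun I hk hn s => (ha I hk hn s).trans (Nat.mul_le_mul_left _ hk)⟩

theorem bilinear (h : Runs Input.k p) : Runs (fun I => I.k * I.n) p := by
  obtain ⟨a, ha⟩ := h
  exact ⟨a, fun I hk hn s => (ha I hk hn s).trans
    (Nat.mul_le_mul_left _ (Nat.le_mul_of_pos_right _ hn))⟩

theorem ite (hf : ∀ I : Input, 1 ≤ I.k → 1 ≤ I.n → 1 ≤ f I) (b : BExp) (h : Runs f p)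
    (h' : Runs f p') : Runs f (.ite b p p') := by
  obtain ⟨a₁, h₁⟩ := h
  obtain ⟨a₂, h₂⟩ := h'
  refine ⟨a₁ + a₂ + (b.size + 1), fun I hk hn s => ?_⟩
  have h3 := h₁ I hk hn s
  have h4 := h₂ I hk hn s
  have h5 : (b.size + 1) * 1 ≤ (b.size + 1) * f I := Nat.mul_le_mul_left _ (hf I hk hn)
  rw [Cmd.exec, add_mul, add_mul]
  split_ifs <;> dsimp only <;> omega

theorem cond (hf : ∀ I : Input, 1 ≤ I.k → 1 ≤ I.n → 1 ≤ f I) (b : BExp) (h : Runs f p)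
    (hs : Runs f .skip) : Runs f (cond b p) := ite hf b h hs

/-- The unit charged for each round and the evaluation of the bounds are absorbed because `f` and
`g` are at least `1`. The number of rounds is bounded by the upper limit alone. -/
theorem loop {g : Input → ℕ} (hf : ∀ I : Input, 1 ≤ I.k → 1 ≤ I.n → 1 ≤ f I)
    (hg : ∀ I : Input, 1 ≤ I.k → 1 ≤ I.n → 1 ≤ g I) (r : NReg) (lo hi : NExp)
    (hhi : ∀ I s, hi.eval I s ≤ g I) (h : Runs f p) :
    Runs (fun I => f I * g I) (.loop r lo hi p) := by
  obtain ⟨a, ha⟩ := h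
  refine ⟨lo.size + hi.size + 1 + (a + 1), fun I hk hn s => ?_⟩
  have key : ∀ (l : List ℕ) (o : State × ℕ),
      (l.foldl (fun o v => ((p.exec I (o.1.setNat r v)).1,
        o.2 + (p.exec I (o.1.setNat r v)).2 + 1)) o).2 ≤ o.2 + l.length * ((a + 1) * f I) := by
    intro l
    induction l with
    | nil => intro o; simp
    | cons v l ih =>
      intro o
      rw [List.foldl_cons]
      refine (ih _).trans ?_
      have h1 := ha I hk hn (o.1.setNat r v)
      have h2 := hf I hk hn
      rw [List.length_cons]
      dsimp only
      nlinarith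
  rw [Cmd.exec]
  refine (key _ _).trans ?_
  rw [List.length_range']
  have h1 := hf I hk hn
  have h2 := hg I hk hn
  have h3 : hi.eval I s - lo.eval I s ≤ g I := (Nat.sub_le _ _).trans (hhi I s)
  have h4 : (hi.eval I s - lo.eval I s) * ((a + 1) * f I) ≤ g I * ((a + 1) * f I) :=
    Nat.mul_le_mul_right _ h3
  have h5 : (lo.size + hi.size + 1) * 1 ≤ (lo.size + hi.size + 1) * (f I * g I) :=
    Nat.mul_le_mul_left _ (Nat.mul_pos h1 h2)
  dsimp only
  calc _ ≤ (lo.size + hi.size + 1) * (f I * g I) + g I * ((a + 1) * f I) := by omega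
    _ = _ := by ring

theorem loop_k (r : NReg) (lo : NExp) (h : Runs (fun _ => 1) p) :
    Runs Input.k (.loop r lo .k p) := by
  simpa using loop (g := Input.k) (fun _ _ _ => le_rfl) (fun _ h _ => h) r lo .k
    (fun _ _ => le_rfl) h

theorem seqs {l : List Cmd} (hs : Runs f .skip) (h : ∀ p ∈ l, Runs f p) : Runs f (seqs l) := by
  induction l with
  | nil => exact hs
  | cons p l ih =>
    exact seq (h p (by simp)) (ih fun p' hp' => h p' (List.mem_cons_of_mem _ hp'))

end Runs

theorem one_le_one_of_input : ∀ I : Input, 1 ≤ I.k → 1 ≤ I.n → 1 ≤ (fun _ : Input => 1) I :=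
  fun _ _ _ => le_rfl

theorem runs_decr (r : RReg) (e : RExp) : Runs (fun _ => 1) (decr r e) := Runs.real _ _

theorem runs_incr (r : RReg) (e : RExp) : Runs (fun _ => 1) (incr r e) := Runs.real _ _

theorem runs_cond (b : BExp) {p : Cmd} (h : Runs (fun _ => 1) p) : Runs (fun _ => 1) (cond b p) :=
  Runs.cond one_le_one_of_input b h Runs.skip

theorem runs_nil : Runs (fun _ => 1) (seqs []) := Runs.skip

theorem runs_cons {p : Cmd} {l : List Cmd} (h : Runs (fun _ => 1) p)
    (h' : Runs (fun _ => 1) (seqs l)) : Runs (fun _ => 1) (seqs (p :: l)) := h.seq h'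

theorem runs_setDel (a b : NExp) : Runs (fun _ => 1) (setDel a b) := by
  unfold setDel
  repeat' first
    | with_reducible exact runs_nil | with_reducible apply runs_cons | with_reducible apply runs_decr | with_reducible apply runs_cond
    | with_reducible apply Runs.nat | with_reducible apply Runs.real

theorem runs_candidate (j : Entry) : Runs (fun _ => 1) (candidate j) := by
  unfold candidate
  repeat' first
    | with_reducible exact runs_nil | with_reducible apply runs_cons | with_reducible apply runs_incr | with_reducible apply runs_cond
    | with_reducible apply Runs.real

theorem runs_take (j : Entry) : Runs (fun _ => 1) (take j) := by
  unfold take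
  repeat' first
    | with_reducible exact runs_nil | with_reducible apply runs_cons | with_reducible apply Runs.nat | with_reducible apply Runs.real | with_reducible apply Runs.list

theorem runs_start (j : Entry) : Runs (fun _ => 1) (start j) :=
  runs_cons (runs_candidate j) (runs_cons (runs_take j) runs_nil)

theorem runs_consider (j : Entry) : Runs (fun _ => 1) (consider j) :=
  runs_cons (runs_candidate j) (runs_cons (runs_cond _ (runs_take j)) runs_nil)

theorem linear_nil : Runs Input.k (seqs []) := Runs.skip.linear

theorem linear_cons {p : Cmd} {l : List Cmd} (h : Runs Input.k p)
    (h' : Runs Input.k (seqs l)) : Runs Input.k (seqs (p :: l)) := h.seq h'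

theorem runs_commit (j : Entry) : Runs Input.k (commit j) :=
  linear_cons (Runs.loop_k _ _ (runs_cond _ (Runs.list _ _)))
    (linear_cons (Runs.list _ _).linear (linear_cons (Runs.real _ _).linear linear_nil))

theorem runs_fromTrees (j : Entry) (a b : NExp) : Runs Input.k (fromTrees j a b) := by
  unfold fromTrees
  repeat' first
    | with_reducible exact linear_nil | with_reducible apply linear_cons | with_reducible exact (runs_setDel _ _).linear
    | with_reducible exact (runs_start _).linear | with_reducible exact (runs_consider _).linear | with_reducible apply runs_commit

theorem runs_fromForests (j : Entry) (a : NExp) : Runs Input.k (fromForests j a) := by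
  unfold fromForests
  repeat' first
    | with_reducible exact linear_nil | with_reducible apply linear_cons | with_reducible exact (runs_setDel _ _).linear
    | with_reducible exact (runs_start _).linear | with_reducible exact (runs_consider _).linear | with_reducible apply runs_commit
    | with_reducible apply Runs.loop_k | with_reducible apply runs_cond | with_reducible exact runs_nil | with_reducible apply runs_cons
    | with_reducible apply runs_setDel | with_reducible apply runs_consider

theorem runs_pathCost : Runs Input.k pathCost :=
  linear_cons (Runs.real _ _).linear
    (linear_cons (Runs.loop_k _ _ (runs_incr _ _)) linear_nil)

theorem runs_update : Runs Input.k update := by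
  unfold update
  repeat' first
    | with_reducible exact linear_nil | with_reducible apply linear_cons | with_reducible exact runs_pathCost | with_reducible apply runs_fromTrees
    | with_reducible apply runs_fromForests | with_reducible exact (Runs.nat _ _).linear
  refine (Runs.seqs Runs.skip fun p hp => ?_).linear
  obtain ⟨j, _, rfl⟩ := List.mem_map.1 hp
  exact runs_cons (Runs.real _ _) (runs_cons (Runs.list _ _) runs_nil)

theorem runs_init : Runs Input.k init := by
  refine linear_cons (Runs.nat _ _).linear (linear_cons ?_ (linear_cons ?_
    (linear_cons runs_update linear_nil)))
  all_goals
    refine (Runs.seqs Runs.skip fun p hp => ?_).linear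
    obtain ⟨j, _, rfl⟩ := List.mem_map.1 hp
    repeat' first | with_reducible exact runs_nil | with_reducible apply runs_cons | with_reducible apply Runs.real | with_reducible apply Runs.list

theorem runs_round : Runs Input.k round := by
  refine linear_cons ?_ (linear_cons runs_update linear_nil)
  refine (Runs.seqs Runs.skip fun p hp => ?_).linear
  obtain ⟨j, _, rfl⟩ := List.mem_map.1 hp
  exact runs_cons (Runs.real _ _) (runs_cons (Runs.real _ _) runs_nil)

theorem runs_finish : Runs (fun _ => 1) finish := by
  refine runs_cons (Runs.real _ _) (runs_cons (Runs.list _ _) (runs_cons ?_ runs_nil))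
  refine Runs.seqs Runs.skip fun p hp => ?_
  obtain ⟨j, _, rfl⟩ := List.mem_map.1 hp
  exact runs_cond _ (runs_cons (Runs.real _ _) (runs_cons (Runs.list _ _) runs_nil))

theorem runs_takeList (es : List EExp) : Runs (fun _ => 1) (takeList es) := by
  refine runs_cons (Runs.real _ _) (runs_cons (Runs.list _ _) (runs_cons ?_ runs_nil))
  refine Runs.seqs Runs.skip fun p hp => ?_
  obtain ⟨j, _, rfl⟩ := List.mem_map.1 hp
  exact Runs.list _ _

theorem runs_startList (es : List EExp) : Runs (fun _ => 1) (startList es) :=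
  runs_cons (Runs.real _ _) (runs_cons (runs_takeList es) runs_nil)

theorem runs_considerList (es : List EExp) : Runs (fun _ => 1) (considerList es) :=
  runs_cons (Runs.real _ _) (runs_cons (runs_cond _ (runs_takeList es)) runs_nil)

theorem runs_small : Runs (fun _ => 1) small := by
  refine Runs.ite one_le_one_of_input _ ?_ ?_
  · repeat' first
      | with_reducible exact runs_nil | with_reducible apply runs_cons | with_reducible apply runs_startList | with_reducible apply runs_considerList
  · repeat' first
      | with_reducible exact runs_nil | with_reducible apply runs_cons | with_reducible apply runs_startList | with_reducible apply runs_considerList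
    obtain ⟨a, ha⟩ := Runs.loop (g := fun _ => 3) one_le_one_of_input (fun _ _ _ => by norm_num)
      .t (.num 0) (.num 3) (fun _ _ => le_rfl)
      (runs_cond (.not (.eq (.reg .t) (.pos (.num 0))))
        (runs_considerList [⟨.num 0, .reg .t⟩, fixed 1 1, fixed 1 2]))
    exact ⟨a * (1 * 3), fun I hk hn s => by simpa using ha I hk hn s⟩

/-- The main loop has at most `n` rounds, each linear in `k`; the triangle case and the final
selection take constant time. -/
theorem runs_ladderAlgorithm : Runs (fun I => I.k * I.n) ladderAlgorithm := by
  refine Runs.ite (fun I hk hn => Nat.mul_pos hk hn) _ runs_small.linear.bilinear ?_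
  refine Runs.seq (Runs.seq runs_init.bilinear ?_) runs_finish.linear.bilinear
  exact Runs.loop (fun _ h _ => h) (fun _ _ h => h) _ _ _ (fun _ _ => le_rfl) runs_round

end AQMST

namespace AQMST

/-! ### Semantics of programs -/

section Semantics

variable {I : Input} {s s₀ : State}

/-- The invariant `P v` describes the state before the round with counter `v`, at a moment when the
counter register does not yet hold `v`. -/
theorem exec_loop {r : NReg} {lo hi : NExp} {p : Cmd} (P : ℕ → State → Prop) {a b : ℕ}
    (ha : lo.eval I s = a) (hb : hi.eval I s = b) (hab : a ≤ b) (start : P a s)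
    (step : ∀ v s, a ≤ v → v < b → P v s → P (v + 1) (p.exec I (s.setNat r v)).1) :
    P b ((Cmd.loop r lo hi p).exec I s).1 := by
  subst ha hb
  have key : ∀ (m v : ℕ) (o : State × ℕ), lo.eval I s ≤ v → v + m = hi.eval I s → P v o.1 →
      P (hi.eval I s) ((List.range' v m).foldl
        (fun o v => ((p.exec I (o.1.setNat r v)).1, o.2 + (p.exec I (o.1.setNat r v)).2 + 1)) o).1 := by
    intro m
    induction m with
    | zero => intro v o _ hv h; simpa [← hv] using h
    | succ m ih =>
      intro v o hlo hv h
      rw [List.range'_succ, List.foldl_cons]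
      exact ih (v + 1) _ (by omega) (by omega) (step v o.1 hlo (by omega) h)
  rw [Cmd.exec]
  exact key _ _ _ le_rfl (by omega) start

theorem exec_cond (b : BExp) (p : Cmd) [Decidable (b.holds I s)] :
    ((cond b p).exec I s).1 = if b.holds I s then (p.exec I s).1 else s := by
  rw [cond, Cmd.exec]
  split_ifs <;> rfl

theorem exec_seqs_nil : ((seqs []).exec I s).1 = s := rfl

theorem exec_seqs_cons (p : Cmd) (l : List Cmd) :
    ((seqs (p :: l)).exec I s).1 = ((seqs l).exec I (p.exec I s).1).1 := rfl

theorem exec_nat (r : NReg) (e : NExp) : ((Cmd.nat r e).exec I s).1 = s.setNat r (e.eval I s) := rfl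

theorem exec_real (r : RReg) (e : RExp) :
    ((Cmd.real r e).exec I s).1 = s.setReal r (e.eval I s) := rfl

theorem exec_list (r : LReg) (e : LExp) :
    ((Cmd.list r e).exec I s).1 = s.setList r (e.eval I s) := rfl

theorem setReal_self (r : RReg) : s.setReal r (s.real r) = s := by
  simp [State.setReal]

theorem exec_decr (r : RReg) (e : RExp) :
    ((decr r e).exec I s).1 = s.setReal r (s.real r - e.eval I s) := rfl

/-- A conditional decrement is one assignment whose amount may be zero, so a chain of conditionals
evaluates to a closed formula without branching on states. -/
theorem exec_cond_decr (b : BExp) (r : RReg) (e : RExp) [Decidable (b.holds I s)] :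
    ((cond b (decr r e)).exec I s).1 =
      s.setReal r (s.real r - if b.holds I s then e.eval I s else 0) := by
  rw [exec_cond]
  split_ifs
  · rfl
  · rw [sub_zero, setReal_self]

theorem exec_cond_incr (b : BExp) (r : RReg) (e : RExp) [Decidable (b.holds I s)] :
    ((cond b (incr r e)).exec I s).1 =
      s.setReal r (s.real r + if b.holds I s then e.eval I s else 0) := by
  rw [exec_cond]
  split_ifs
  · rfl
  · rw [add_zero, setReal_self]

theorem exec_cond_cond (b b' : BExp) (p : Cmd) [Decidable (b.holds I s ∧ b'.holds I s)] :
    ((cond b (cond b' p)).exec I s).1 =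
      if b.holds I s ∧ b'.holds I s then (p.exec I s).1 else s := by
  classical
  rw [exec_cond, exec_cond]
  split_ifs <;> first | rfl | tauto

theorem exec_cond_cond_decr (b b' : BExp) (r : RReg) (e : RExp)
    [Decidable (b.holds I s ∧ b'.holds I s)] :
    ((cond b (cond b' (decr r e))).exec I s).1 =
      s.setReal r (s.real r - if b.holds I s ∧ b'.holds I s then e.eval I s else 0) := by
  rw [exec_cond_cond]
  split_ifs
  · rfl
  · rw [sub_zero, setReal_self]

@[simp] theorem nat_setNat (r r' : NReg) (v : ℕ) :
    (s.setNat r v).nat r' = if r' = r then v else s.nat r' := by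
  simp [State.setNat, Function.update_apply]

@[simp] theorem real_setNat (r : NReg) (v : ℕ) : (s.setNat r v).real = s.real := rfl

@[simp] theorem list_setNat (r : NReg) (v : ℕ) : (s.setNat r v).list = s.list := rfl

@[simp] theorem nat_setReal (r : RReg) (v : ℝ) : (s.setReal r v).nat = s.nat := rfl

@[simp] theorem real_setReal (r r' : RReg) (v : ℝ) :
    (s.setReal r v).real r' = if r' = r then v else s.real r' := by
  simp [State.setReal, Function.update_apply]

@[simp] theorem list_setReal (r : RReg) (v : ℝ) : (s.setReal r v).list = s.list := rfl

@[simp] theorem nat_setList (r : LReg) (v : List (ℕ × ℕ)) : (s.setList r v).nat = s.nat := rfl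

@[simp] theorem real_setList (r : LReg) (v : List (ℕ × ℕ)) : (s.setList r v).real = s.real := rfl

@[simp] theorem list_setList (r r' : LReg) (v : List (ℕ × ℕ)) :
    (s.setList r v).list r' = if r' = r then v else s.list r' := by
  simp [State.setList, Function.update_apply]

/-! #### Registers that stay unchanged -/

/-- The program does not change the current cycle, its shared position, the cost of its path, and
the old objects with their costs and interaction costs. -/
def Cmd.inert : Cmd → Bool
  | .skip => true
  | .nat .cyc _ | .nat .pos _ => false
  | .nat _ _ => true
  | .real (.z _) _ | .real (.x _) _ | .real (.y _) _ | .real .path _ => false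
  | .real _ _ => true
  | .list (.tree _) _ => false
  | .list _ _ => true
  | .seq p p' => p.inert && p'.inert
  | .ite _ p p' => p.inert && p'.inert
  | .loop .cyc _ _ _ | .loop .pos _ _ _ => false
  | .loop _ _ _ p => p.inert

/-- The states agree in the registers that an inert program does not change. -/
structure Agrees (s₀ s : State) : Prop where
  cyc : s.nat .cyc = s₀.nat .cyc
  pos : s.nat .pos = s₀.nat .pos
  path : s.real .path = s₀.real .path
  z : ∀ j, s.real (.z j) = s₀.real (.z j)
  x : ∀ j, s.real (.x j) = s₀.real (.x j)
  y : ∀ j, s.real (.y j) = s₀.real (.y j)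
  tree : ∀ j, s.list (.tree j) = s₀.list (.tree j)

theorem Agrees.refl (s : State) : Agrees s s :=
  ⟨rfl, rfl, rfl, fun _ => rfl, fun _ => rfl, fun _ => rfl, fun _ => rfl⟩

theorem Agrees.trans {s₁ s₂ s₃ : State} (h : Agrees s₁ s₂) (h' : Agrees s₂ s₃) : Agrees s₁ s₃ :=
  ⟨h'.cyc.trans h.cyc, h'.pos.trans h.pos, h'.path.trans h.path, fun j => (h'.z j).trans (h.z j),
    fun j => (h'.x j).trans (h.x j), fun j => (h'.y j).trans (h.y j),
    fun j => (h'.tree j).trans (h.tree j)⟩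

theorem agrees_setNat {r : NReg} (h : r ≠ .cyc) (h' : r ≠ .pos) (v : ℕ) : Agrees s (s.setNat r v) := by
  constructor <;> simp [h.symm, h'.symm]

theorem exec_loop_invariant {r : NReg} {lo hi : NExp} {p : Cmd} (P : State → Prop) (start : P s)
    (step : ∀ v s, P s → P (p.exec I (s.setNat r v)).1) :
    P ((Cmd.loop r lo hi p).exec I s).1 := by
  have key : ∀ (l : List ℕ) (o : State × ℕ), P o.1 → P (l.foldl
        (fun o v => ((p.exec I (o.1.setNat r v)).1, o.2 + (p.exec I (o.1.setNat r v)).2 + 1)) o).1 := by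
    intro l
    induction l with
    | nil => intro o h; exact h
    | cons v l ih => intro o h; exact ih _ (step v o.1 h)
  rw [Cmd.exec]
  exact key _ _ start

/-- A frame rule: inertness is a syntactic check, so for concrete programs the hypothesis holds by
`rfl`. -/
theorem agrees_exec {p : Cmd} (hp : p.inert = true) (s : State) : Agrees s (p.exec I s).1 := by
  induction p generalizing s with
  | skip => exact Agrees.refl s
  | nat r e =>
    cases r <;> first
      | (simp [Cmd.inert] at hp; done)
      | exact agrees_setNat (by simp) (by simp) _
  | real r e =>
    cases r <;> first
      | (simp [Cmd.inert] at hp; done)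
      | (rw [exec_real]; constructor <;> simp)
  | list r e =>
    cases r <;> first
      | (simp [Cmd.inert] at hp; done)
      | (rw [exec_list]; constructor <;> simp)
  | seq p p' ih ih' =>
    rw [Cmd.inert, Bool.and_eq_true] at hp
    exact (ih hp.1 s).trans (ih' hp.2 _)
  | ite b p p' ih ih' =>
    rw [Cmd.inert, Bool.and_eq_true] at hp
    rw [Cmd.exec]
    split_ifs
    · exact ih hp.1 s
    · exact ih' hp.2 s
  | loop r lo hi p ih =>
    refine exec_loop_invariant (fun s' => Agrees s s') (Agrees.refl s) fun v s' h => h.trans ?_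
    cases r <;> first
      | exact absurd hp Bool.false_ne_true
      | exact (agrees_setNat (by simp) (by simp) v).trans (ih hp _)

/-- The program does not change the new object `j` and its cost. -/
def Cmd.spares (j : Entry) : Cmd → Bool
  | .real (.newZ j') _ => decide (j' ≠ j)
  | .list (.newTree j') _ => decide (j' ≠ j)
  | .seq p p' => p.spares j && p'.spares j
  | .ite _ p p' => p.spares j && p'.spares j
  | .loop _ _ _ p => p.spares j
  | _ => true

/-- The second frame rule protects the result of one minimization while the later ones run. -/
theorem spares_exec {j : Entry} {p : Cmd} (hp : p.spares j = true) (s : State) :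
    (p.exec I s).1.real (.newZ j) = s.real (.newZ j) ∧
      (p.exec I s).1.list (.newTree j) = s.list (.newTree j) := by
  induction p generalizing s with
  | skip => exact ⟨rfl, rfl⟩
  | nat r e => exact ⟨rfl, rfl⟩
  | real r e =>
    rw [exec_real]
    cases r <;> simp_all [Cmd.spares, Ne.symm]
  | list r e =>
    rw [exec_list]
    cases r <;> simp_all [Cmd.spares, Ne.symm]
  | seq p p' ih ih' =>
    rw [Cmd.spares, Bool.and_eq_true] at hp
    obtain ⟨h1, h2⟩ := ih hp.1 s
    obtain ⟨h3, h4⟩ := ih' hp.2 (p.exec I s).1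
    exact ⟨h3.trans h1, h4.trans h2⟩
  | ite b p p' ih ih' =>
    rw [Cmd.spares, Bool.and_eq_true] at hp
    rw [Cmd.exec]
    split_ifs
    · exact ih hp.1 s
    · exact ih' hp.2 s
  | loop r lo hi p ih =>
    refine exec_loop_invariant (fun s' => s'.real (.newZ j) = s.real (.newZ j) ∧
      s'.list (.newTree j) = s.list (.newTree j)) ⟨rfl, rfl⟩ fun v s' h => ?_
    obtain ⟨h1, h2⟩ := ih (by simpa [Cmd.spares] using hp) (s'.setNat r v)
    exact ⟨h1.trans h.1, h2.trans h.2⟩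

/-! #### The minimization over candidates -/

/-- The interaction cost of the edges at positions `t` and `u` of cycle `i`. -/
def pairVal (I : Input) (i t u : ℕ) : ℝ := I.q (i, t) (i, u) + I.q (i, u) (i, t)

/-- The value that `pathCost` computes. -/
def pathVal (I : Input) (i : ℕ) : ℝ :=
  I.c (i, 1) + ∑ t ∈ Finset.Ico 2 I.k, (I.c (i, t) + pairVal I i (t - 1) t)

/-- The value that `setDel` computes from the cost `w` of the path. -/
def restVal (I : Input) (i : ℕ) (w : ℝ) (d₁ d₂ : ℕ) : ℝ :=
  let rest := if 0 < d₁ then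
      w - I.c (i, d₁) - (if 1 < d₁ then pairVal I i (d₁ - 1) d₁ else 0) -
        (if d₁ + 1 < I.k then pairVal I i d₁ (d₁ + 1) else 0)
    else w
  if 0 < d₂ then
    rest - I.c (i, d₂) - (if 1 < d₂ ∧ ¬ d₂ - 1 = d₁ then pairVal I i (d₂ - 1) d₂ else 0) -
      (if d₂ + 1 < I.k ∧ ¬ d₂ + 1 = d₁ then pairVal I i d₂ (d₂ + 1) else 0)
  else rest

/-- The value of the candidate `(j, d₁, d₂)`: the old object `j` and the current cycle `i` without
the edges at positions `0`, `d₁`, `d₂`. The old objects are given by their costs `z` and their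
interaction costs `x`, `y`, and `w` is the cost of the path. -/
def candVal (I : Input) (i : ℕ) (w : ℝ) (z x y : Entry → ℝ) (a : Entry × ℕ × ℕ) : ℝ :=
  restVal I i w a.2.1 a.2.2 + z a.1 + (if ¬ (a.2.1 = 1 ∨ a.2.2 = 1) then x a.1 else 0) +
    (if ¬ (a.2.1 = I.k - 1 ∨ a.2.2 = I.k - 1) then y a.1 else 0)

/-- The value of a candidate in a given state. -/
def stateVal (I : Input) (s : State) : Entry × ℕ × ℕ → ℝ :=
  candVal I (s.nat .cyc) (s.real .path) (fun j => s.real (.z j)) (fun j => s.real (.x j))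
    (fun j => s.real (.y j))

/-- The names of the edges that are added to an old object, in front of the list `l`. -/
def pathList (k i d₁ d₂ : ℕ) (l : List (ℕ × ℕ)) : List (ℕ × ℕ) :=
  (((List.range' 1 (k - 1)).filter fun t => decide (¬ (t = d₁ ∨ t = d₂))).map
    fun t => (i, t)).reverse ++ l

/-- The state holds the best candidate in `S` with respect to the old objects in `s₀`. -/
def Best (I : Input) (s₀ : State) (S : Set (Entry × ℕ × ℕ)) (s : State) : Prop :=
  ∃ a ∈ S, s.real .best = stateVal I s₀ a ∧ s.nat .bestDel₁ = a.2.1 ∧ s.nat .bestDel₂ = a.2.2 ∧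
    s.list .src = s₀.list (.tree a.1) ∧ ∀ b ∈ S, s.real .best ≤ stateVal I s₀ b

/-- The new object `j` is the best candidate in `S` with respect to the old objects in `s₀`. -/
def Stored (I : Input) (s₀ : State) (S : Set (Entry × ℕ × ℕ)) (j : Entry) (s : State) : Prop :=
  ∃ a ∈ S, s.real (.newZ j) = stateVal I s₀ a ∧
    s.list (.newTree j) = pathList I.k (s₀.nat .cyc) a.2.1 a.2.2 (s₀.list (.tree a.1)) ∧
    ∀ b ∈ S, s.real (.newZ j) ≤ stateVal I s₀ b

/-- The candidates with deleted edges at positions `d₁` and `d₂` are about to be evaluated. -/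
structure Ready (I : Input) (s₀ : State) (d₁ d₂ : ℕ) (s : State) : Prop where
  agrees : Agrees s₀ s
  del₁ : s.nat .del₁ = d₁
  del₂ : s.nat .del₂ = d₂
  rest : s.real .rest = restVal I (s₀.nat .cyc) (s₀.real .path) d₁ d₂

/-- `b` is evaluated after `del₁` has been written, hence the modified state in `hb`. -/
theorem exec_setDel_values {a b : NExp} {d₁ d₂ : ℕ} (ha : a.eval I s = d₁)
    (hb : b.eval I (s.setNat .del₁ d₁) = d₂) :
    ((setDel a b).exec I s).1 = ((s.setNat .del₁ d₁).setNat .del₂ d₂).setReal .rest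
      (restVal I (s.nat .cyc) (s.real .path) d₁ d₂) := by
  classical
  have hrest : ∀ (s : State) (v w : ℝ), (s.setReal .rest v).setReal .rest w = s.setReal .rest w := by
    intro s v w; simp [State.setReal]
  rw [setDel]
  simp only [exec_seqs_cons, exec_seqs_nil, exec_nat, exec_real, ha, hb]
  rw [exec_cond (.lt (.num 0) (.reg .del₁))]
  by_cases h1 : 0 < d₁ <;> by_cases h2 : 0 < d₂
  all_goals
    simp only [NExp.eval, BExp.holds, nat_setReal, nat_setNat, reduceCtorEq, if_false, if_true, h1]
    try simp only [exec_seqs_cons, exec_seqs_nil, exec_cond_decr, exec_decr]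
    rw [exec_cond (.lt (.num 0) (.reg .del₂))]
    simp only [NExp.eval, BExp.holds, nat_setReal, nat_setNat, reduceCtorEq, if_false, if_true, h2]
    try simp only [exec_seqs_cons, exec_seqs_nil, exec_cond_cond_decr, exec_decr]
    simp only [NExp.eval, EExp.eval, here, BExp.holds, pairCost, RExp.eval, nat_setReal, nat_setNat,
      reduceCtorEq, if_false, if_true, hrest, real_setReal, real_setNat, restVal, pairVal, h1, h2]

theorem ready_setDel {a b : NExp} {d₁ d₂ : ℕ} (h : Agrees s₀ s) (ha : a.eval I s = d₁)
    (hb : b.eval I (s.setNat .del₁ d₁) = d₂) : Ready I s₀ d₁ d₂ ((setDel a b).exec I s).1 := by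
  refine ⟨h.trans (agrees_exec rfl s), ?_, ?_, ?_⟩ <;>
    rw [exec_setDel_values ha hb] <;> simp [h.cyc, h.path]

theorem Best.setDel {a b : NExp} {d₁ d₂ : ℕ} {S : Set (Entry × ℕ × ℕ)} (h : Best I s₀ S s)
    (ha : a.eval I s = d₁) (hb : b.eval I (s.setNat .del₁ d₁) = d₂) :
    Best I s₀ S ((AQMST.setDel a b).exec I s).1 := by
  rw [exec_setDel_values ha hb]
  simpa [Best] using h

theorem exec_candidate {d₁ d₂ : ℕ} (h : Ready I s₀ d₁ d₂ s) (j : Entry) :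
    ((candidate j).exec I s).1 = s.setReal .cand (stateVal I s₀ (j, d₁, d₂)) := by
  classical
  have hcand : ∀ (s : State) (v w : ℝ), (s.setReal .cand v).setReal .cand w = s.setReal .cand w := by
    intro s v w; simp [State.setReal]
  rw [candidate]
  simp only [exec_seqs_cons, exec_seqs_nil, exec_real, exec_cond_incr]
  simp only [NExp.eval, BExp.holds, RExp.eval, nat_setReal, reduceCtorEq, if_false, if_true,
    hcand, real_setReal, h.del₁, h.del₂, h.rest, h.agrees.z, h.agrees.x, h.agrees.y, stateVal,
    candVal]

theorem Ready.setCand {d₁ d₂ : ℕ} (h : Ready I s₀ d₁ d₂ s) (v : ℝ) :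
    Ready I s₀ d₁ d₂ (s.setReal .cand v) :=
  ⟨h.agrees.trans (by constructor <;> simp), by simp [h.del₁], by simp [h.del₂], by simp [h.rest]⟩

theorem Ready.take {d₁ d₂ : ℕ} (h : Ready I s₀ d₁ d₂ s) (j : Entry) :
    Ready I s₀ d₁ d₂ ((take j).exec I s).1 := by
  refine ⟨h.agrees.trans (agrees_exec rfl s), ?_, ?_, ?_⟩ <;>
    simp [AQMST.take, exec_seqs_cons, exec_seqs_nil, exec_nat, exec_real, exec_list, h.del₁, h.del₂,
      h.rest]

theorem start_spec {d₁ d₂ : ℕ} (h : Ready I s₀ d₁ d₂ s) (j : Entry) :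
    Ready I s₀ d₁ d₂ ((start j).exec I s).1 ∧
      Best I s₀ {(j, d₁, d₂)} ((start j).exec I s).1 := by
  rw [start, exec_seqs_cons, exec_seqs_cons, exec_seqs_nil, exec_candidate h]
  refine ⟨(h.setCand _).take j, (j, d₁, d₂), rfl, ?_⟩
  simp [take, exec_seqs_cons, exec_seqs_nil, exec_nat, exec_real, exec_list, RExp.eval, NExp.eval,
    LExp.eval, h.del₁, h.del₂, h.agrees.tree]

theorem consider_spec {d₁ d₂ : ℕ} {S : Set (Entry × ℕ × ℕ)} (h : Ready I s₀ d₁ d₂ s)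
    (hB : Best I s₀ S s) (j : Entry) :
    Ready I s₀ d₁ d₂ ((consider j).exec I s).1 ∧
      Best I s₀ (insert (j, d₁, d₂) S) ((consider j).exec I s).1 := by
  classical
  rw [consider, exec_seqs_cons, exec_seqs_cons, exec_seqs_nil, exec_candidate h, exec_cond]
  have h' := h.setCand (stateVal I s₀ (j, d₁, d₂))
  obtain ⟨a, ha, h1, h2, h3, h4, h5⟩ := hB
  split_ifs with hlt
  · refine ⟨h'.take j, (j, d₁, d₂), Set.mem_insert _ _, ?_⟩
    simp only [BExp.holds, RExp.eval, real_setReal, if_true, reduceCtorEq, if_false] at hlt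
    simp only [take, exec_seqs_cons, exec_seqs_nil, exec_nat, exec_real, exec_list, RExp.eval,
      NExp.eval, LExp.eval, h.del₁, h.del₂, h.agrees.tree, real_setReal, real_setNat, real_setList,
      nat_setReal, nat_setNat, nat_setList, list_setReal, list_setNat, list_setList, if_true,
      if_false, reduceCtorEq, true_and]
    rintro a' (rfl | ha')
    · exact le_rfl
    · exact hlt.le.trans (h5 a' ha')
  · refine ⟨h', a, Set.mem_insert_of_mem _ ha, ?_⟩
    simp only [BExp.holds, RExp.eval, real_setReal, if_true, reduceCtorEq, if_false, not_lt] at hlt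
    simp only [real_setReal, nat_setReal, list_setReal, reduceCtorEq, if_false]
    refine ⟨h1, h2, h3, h4, ?_⟩
    rintro a' (rfl | ha')
    · exact hlt
    · exact h5 a' ha'

/-- The kept positions are consed onto the old list in increasing order, hence the reversal in
`pathList`. The loop invariant is `pathList` with the counter in place of `k`. -/
theorem commit_spec {S : Set (Entry × ℕ × ℕ)} (hk : 1 ≤ I.k) (h : Agrees s₀ s)
    (hB : Best I s₀ S s) (j : Entry) : Stored I s₀ S j ((commit j).exec I s).1 := by
  classical
  obtain ⟨a, ha, h1, h2, h3, h4, h5⟩ := hB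
  rw [commit, exec_seqs_cons, exec_seqs_cons, exec_seqs_cons, exec_seqs_nil, exec_list, exec_real]
  have key := exec_loop (I := I) (s := s) (r := .t) (lo := .num 1) (hi := .k)
    (p := cond (.not (.or (.eq (.reg .t) (.reg .bestDel₁)) (.eq (.reg .t) (.reg .bestDel₂))))
        (.list .src (.cons (here (.reg .t)) .src)))
    (fun v s' => Agrees s₀ s' ∧ s'.real .best = s.real .best ∧ s'.nat .bestDel₁ = a.2.1 ∧
      s'.nat .bestDel₂ = a.2.2 ∧
      s'.list .src = pathList v (s₀.nat .cyc) a.2.1 a.2.2 (s₀.list (.tree a.1)))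
    (a := 1) (b := I.k) rfl rfl hk
    ⟨h, rfl, h2, h3, by simp [pathList, h4]⟩ ?_
  · obtain ⟨_, k1, _, _, k2⟩ := key
    refine ⟨a, ha, ?_, ?_, ?_⟩
    · simp [RExp.eval, k1, h1]
    · simpa [LExp.eval] using k2
    · simpa [RExp.eval, k1] using h5
  · rintro v s' hv _ ⟨g1, g2, g3, g4, g5⟩
    have hlist : pathList (v + 1) (s₀.nat .cyc) a.2.1 a.2.2 (s₀.list (.tree a.1)) =
        if ¬ (v = a.2.1 ∨ v = a.2.2) then (s₀.nat .cyc, v) :: s'.list .src else s'.list .src := by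
      obtain ⟨w, rfl⟩ : ∃ w, v = w + 1 := ⟨v - 1, by omega⟩
      rw [g5, pathList, pathList, Nat.add_sub_cancel, Nat.add_sub_cancel, List.range'_concat,
        List.filter_append, List.map_append, List.reverse_append, List.append_assoc]
      have : 1 + 1 * w = w + 1 := by omega
      rw [this]
      by_cases hc : w + 1 = a.2.1 ∨ w + 1 = a.2.2
      · rw [if_neg (not_not.2 hc), List.filter_cons_of_neg (by simpa [or_iff_not_imp_left] using hc)]; simp
      · rw [if_pos hc, List.filter_cons_of_pos (by simpa using hc)]; simp
    rw [hlist, exec_cond, exec_list]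
    simp only [BExp.holds, NExp.eval, LExp.eval, EExp.eval, here, nat_setNat, if_true, reduceCtorEq,
      if_false, g3, g4, g1.cyc, list_setNat]
    split_ifs with hc
    · refine ⟨g1.trans ?_, ?_, ?_, ?_, ?_⟩
      · constructor <;> simp
      all_goals simp [g2, g3, g4]
    · refine ⟨g1.trans ?_, ?_, ?_, ?_, ?_⟩
      · constructor <;> simp
      all_goals simp [g2, g3, g4]

/-- The candidates built on the old trees. -/
def treeCands (d₁ d₂ : ℕ) : Set (Entry × ℕ × ℕ) := {a | a.1 ∈ trees ∧ a.2 = (d₁, d₂)}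

/-- The candidates built on the old forests without an edge deleted at position `d`, and those built
on the old trees with a further edge deleted that is not near position `p`. -/
def forestCands (k p d : ℕ) : Set (Entry × ℕ × ℕ) :=
  {a | a.1 ∈ forests ∧ a.2 = (d, 0)} ∪
    {a | a.1 ∈ trees ∧ ∃ t, 1 ≤ t ∧ t < k ∧ (t + 1 < p ∨ p + 1 < t) ∧ a.2 = (d, t)}

theorem fromTrees_spec {a b : NExp} {d₁ d₂ : ℕ} (hk : 1 ≤ I.k) (h : Agrees s₀ s)
    (ha : ∀ s, Agrees s₀ s → a.eval I s = d₁) (hb : ∀ s, Agrees s₀ s → b.eval I s = d₂) (j : Entry) :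
    Stored I s₀ (treeCands d₁ d₂) j ((fromTrees j a b).exec I s).1 := by
  rw [fromTrees]
  simp only [exec_seqs_cons, exec_seqs_nil]
  have h0 := ready_setDel h (ha s h) (hb _ (h.trans (agrees_setNat (by simp) (by simp) _)))
  obtain ⟨h1, b1⟩ := start_spec h0 .T1
  obtain ⟨h2, b2⟩ := consider_spec h1 b1 .T2
  obtain ⟨h3, b3⟩ := consider_spec h2 b2 .T3
  obtain ⟨h4, b4⟩ := consider_spec h3 b3 .T4
  convert commit_spec hk h4.agrees b4 j using 1
  ext ⟨j', d⟩
  simp only [treeCands, trees, Set.mem_ofPred_eq, List.mem_cons, List.not_mem_nil, or_false,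
    Set.mem_insert_iff, Set.mem_singleton_iff, Prod.mk.injEq]
  tauto

/-- The loop invariant is the final statement with the counter `v` in place of `k`. At `v = 1` only
the forests have been considered; each round adds the four trees with a deletion at `v`, or nothing
if `v` is near the marked position. -/
theorem fromForests_spec {a : NExp} {d : ℕ} (hk : 1 ≤ I.k) (h : Agrees s₀ s)
    (ha : ∀ s, Agrees s₀ s → a.eval I s = d) (j : Entry) :
    Stored I s₀ (forestCands I.k (s₀.nat .pos) d) j ((fromForests j a).exec I s).1 := by
  classical
  rw [fromForests]
  simp only [exec_seqs_cons, exec_seqs_nil]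
  have h0 := ready_setDel (b := .num 0) (d₂ := 0) h (ha s h) rfl
  obtain ⟨h1, b1⟩ := start_spec h0 .F1
  obtain ⟨h2, b2⟩ := consider_spec h1 b1 .F2
  obtain ⟨h3, b3⟩ := consider_spec h2 b2 .F3
  refine (fun key => commit_spec hk (And.left key) (And.right key) j)
    (exec_loop (fun v s' => Agrees s₀ s' ∧ Best I s₀ (forestCands v (s₀.nat .pos) d) s')
      (a := 1) (b := I.k) rfl rfl hk ⟨h3.agrees, ?_⟩ ?_)
  · convert b3 using 1
    ext ⟨j', e⟩
    simp only [forestCands, forests, Set.mem_union, Set.mem_ofPred_eq, List.mem_cons,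
      List.not_mem_nil, or_false, Set.mem_insert_iff, Set.mem_singleton_iff, Prod.mk.injEq]
    constructor
    · rintro (h | ⟨_, t, h1, h2, _⟩)
      · tauto
      · omega
    · tauto
  · rintro v s' hv _ ⟨g, b⟩
    have gv : Agrees s₀ (s'.setNat .t v) := g.trans (agrees_setNat (by simp) (by simp) v)
    have bv : Best I s₀ (forestCands v (s₀.nat .pos) d) (s'.setNat .t v) := by simpa [Best] using b
    rw [exec_cond]
    simp only [BExp.holds, NExp.eval, nat_setNat, if_true, reduceCtorEq, if_false, g.pos]
    split_ifs with hc
    · simp only [exec_seqs_cons, exec_seqs_nil]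
      have hb : (NExp.reg .t).eval I ((s'.setNat .t v).setNat .del₁ d) = v := by simp [NExp.eval]
      obtain ⟨h1, b1⟩ := consider_spec (ready_setDel gv (ha _ gv) hb) (bv.setDel (ha _ gv) hb) .T1
      obtain ⟨h2, b2⟩ := consider_spec h1 b1 .T2
      obtain ⟨h3, b3⟩ := consider_spec h2 b2 .T3
      obtain ⟨h4, b4⟩ := consider_spec h3 b3 .T4
      refine ⟨h4.agrees, ?_⟩
      convert b4 using 1
      ext ⟨j', e⟩
      simp only [forestCands, trees, Set.mem_union, Set.mem_ofPred_eq, List.mem_cons,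
        List.not_mem_nil, or_false, Set.mem_insert_iff, Prod.mk.injEq]
      constructor
      · rintro (h | ⟨h, t, h1, h2, h3, rfl⟩)
        · tauto
        · rcases Nat.lt_succ_iff_lt_or_eq.1 h2 with h4 | rfl
          · exact Or.inr (Or.inr (Or.inr (Or.inr (Or.inr ⟨h, t, h1, h4, h3, rfl⟩))))
          · tauto
      · have hself : ∃ t, 1 ≤ t ∧ t < v + 1 ∧ (t + 1 < s₀.nat .pos ∨ s₀.nat .pos + 1 < t) ∧
            (d, v) = (d, t) := ⟨v, hv, by omega, hc, rfl⟩
        rintro (⟨rfl, rfl⟩ | ⟨rfl, rfl⟩ | ⟨rfl, rfl⟩ | ⟨rfl, rfl⟩ | h | ⟨h, t, h1, h2, h3, rfl⟩)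
        · exact Or.inr ⟨by simp, hself⟩
        · exact Or.inr ⟨by simp, hself⟩
        · exact Or.inr ⟨by simp, hself⟩
        · exact Or.inr ⟨by simp, hself⟩
        · exact Or.inl h
        · exact Or.inr ⟨h, t, h1, by omega, h3, rfl⟩
    · refine ⟨gv, ?_⟩
      convert bv using 1
      ext ⟨j', e⟩
      simp only [forestCands, Set.mem_union, Set.mem_ofPred_eq]
      refine or_congr_right (and_congr_right fun _ => exists_congr fun t => ?_)
      constructor
      · rintro ⟨h1, h2, h3, rfl⟩
        rcases Nat.lt_succ_iff_lt_or_eq.1 h2 with h4 | rfl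
        · exact ⟨h1, h4, h3, rfl⟩
        · exact absurd h3 hc
      · rintro ⟨h1, h2, h3, rfl⟩
        exact ⟨h1, by omega, h3, rfl⟩

end Semantics

end AQMST

namespace AQMST

/-! ### The sweep over the cycles -/

section Sweep

variable {I : Input} {s s₀ : State}

/-- The candidates for the new object `j`, for a cycle of length `k` whose shared edge is at
position `p`. -/
def cands (k p : ℕ) : Entry → Set (Entry × ℕ × ℕ)
  | .T1 => treeCands (p + 1) 0
  | .T2 => treeCands (p - 1) 0
  | .T3 => treeCands p 0
  | .T4 => forestCands k p 0
  | .F1 => treeCands p (p + 1)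
  | .F2 => treeCands p (p - 1)
  | .F3 => forestCands k p p

/-- The objects in `s` are the best candidates for the cycle `i`, built on the old objects `l` with
costs `z` and interaction costs `x`, `y`. -/
def Updated (I : Input) (i : ℕ) (z x y : Entry → ℝ) (l : Entry → List (ℕ × ℕ)) (s : State) : Prop :=
  ∀ j, ∃ a ∈ cands I.k (I.pos i) j, s.real (.z j) = candVal I i (pathVal I i) z x y a ∧
    s.list (.tree j) = pathList I.k i a.2.1 a.2.2 (l a.1) ∧
    ∀ a' ∈ cands I.k (I.pos i) j, s.real (.z j) ≤ candVal I i (pathVal I i) z x y a'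

/-- This program is not inert, because it writes `path`. Its frame statement therefore compares with
the initial state after some change of `t` and `path`. -/
theorem exec_pathCost (hk : 2 ≤ I.k) (s : State) :
    (pathCost.exec I s).1.real .path = pathVal I (s.nat .cyc) ∧
      ∃ t w, Agrees ((s.setNat .t t).setReal .path w) (pathCost.exec I s).1 := by
  rw [pathCost, exec_seqs_cons, exec_seqs_cons, exec_seqs_nil, exec_real]
  refine exec_loop (I := I) (a := 2) (b := I.k) (fun v s' => s'.real .path = I.c (s.nat .cyc, 1) +
      ∑ t ∈ Finset.Ico 2 v, (I.c (s.nat .cyc, t) + pairVal I (s.nat .cyc) (t - 1) t) ∧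
      ∃ t w, Agrees ((s.setNat .t t).setReal .path w) s') rfl rfl hk ⟨?_, ?_⟩ ?_
  · simp [RExp.eval, EExp.eval, here, NExp.eval]
  · exact ⟨s.nat .t, I.c (s.nat .cyc, 1), by constructor <;> simp [RExp.eval, EExp.eval, here, NExp.eval]⟩
  · rintro v s' hv _ ⟨h1, t, w, h2⟩
    have hc : s'.nat .cyc = s.nat .cyc := by simpa using h2.cyc
    refine ⟨?_, v, _, ⟨?_, ?_, rfl, ?_, ?_, ?_, ?_⟩⟩
    · rw [Finset.sum_Ico_succ_top hv, ← add_assoc, ← h1]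
      simp [incr, exec_real, RExp.eval, EExp.eval, here, NExp.eval, pairCost, pairVal, hc]
    · simpa [incr, exec_real] using h2.cyc
    · simpa [incr, exec_real] using h2.pos
    · simpa [incr, exec_real] using h2.z
    · simpa [incr, exec_real] using h2.x
    · simpa [incr, exec_real] using h2.y
    · simpa [incr, exec_real] using h2.tree

theorem Stored.spares {S : Set (Entry × ℕ × ℕ)} {j : Entry} (h : Stored I s₀ S j s) {p : Cmd}
    (hp : p.spares j = true) : Stored I s₀ S j (p.exec I s).1 := by
  unfold Stored
  rw [(spares_exec hp s).1, (spares_exec hp s).2]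
  exact h

/-- The part of `update` that finds the new objects. -/
def findNew : Cmd :=
  seqs [fromTrees .T1 (.add (.reg .pos) (.num 1)) (.num 0),
    fromTrees .T2 (.sub (.reg .pos) (.num 1)) (.num 0),
    fromTrees .T3 (.reg .pos) (.num 0),
    fromForests .T4 (.num 0),
    fromTrees .F1 (.reg .pos) (.add (.reg .pos) (.num 1)),
    fromTrees .F2 (.reg .pos) (.sub (.reg .pos) (.num 1)),
    fromForests .F3 (.reg .pos)]

/-- All seven minimizations refer to the same old objects: each starts in a state that agrees with
`s`, and its result is spared by those that follow. -/
theorem findNew_spec (hk : 1 ≤ I.k) (s : State) (j : Entry) :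
    Stored I s (cands I.k (s.nat .pos) j) j (findNew.exec I s).1 := by
  have hpos : ∀ s', Agrees s s' → (NExp.reg .pos).eval I s' = s.nat .pos := fun s' h => h.pos
  have hadd : ∀ s', Agrees s s' → (NExp.add (.reg .pos) (.num 1)).eval I s' = s.nat .pos + 1 :=
    fun s' h => by rw [NExp.eval, hpos s' h]; rfl
  have hsub : ∀ s', Agrees s s' → (NExp.sub (.reg .pos) (.num 1)).eval I s' = s.nat .pos - 1 :=
    fun s' h => by rw [NExp.eval, hpos s' h]; rfl
  have hzero : ∀ s', Agrees s s' → (NExp.num 0).eval I s' = 0 := fun _ _ => rfl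
  rw [findNew]
  simp only [exec_seqs_cons, exec_seqs_nil]
  have a1 := Agrees.refl s
  have t1 := fromTrees_spec hk a1 hadd hzero .T1
  have a2 := a1.trans (agrees_exec (I := I)
    (p := fromTrees .T1 (.add (.reg .pos) (.num 1)) (.num 0)) rfl _)
  have t2 := fromTrees_spec hk a2 hsub hzero .T2
  have a3 := a2.trans (agrees_exec (I := I)
    (p := fromTrees .T2 (.sub (.reg .pos) (.num 1)) (.num 0)) rfl _)
  have t3 := fromTrees_spec hk a3 hpos hzero .T3
  have a4 := a3.trans (agrees_exec (I := I) (p := fromTrees .T3 (.reg .pos) (.num 0)) rfl _)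
  have t4 := fromForests_spec hk a4 hzero .T4
  have a5 := a4.trans (agrees_exec (I := I) (p := fromForests .T4 (.num 0)) rfl _)
  have f1 := fromTrees_spec hk a5 hpos hadd .F1
  have a6 := a5.trans (agrees_exec (I := I)
    (p := fromTrees .F1 (.reg .pos) (.add (.reg .pos) (.num 1))) rfl _)
  have f2 := fromTrees_spec hk a6 hpos hsub .F2
  have a7 := a6.trans (agrees_exec (I := I)
    (p := fromTrees .F2 (.reg .pos) (.sub (.reg .pos) (.num 1))) rfl _)
  have f3 := fromForests_spec hk a7 hpos .F3
  cases j
  · exact (((((t1.spares rfl).spares rfl).spares rfl).spares rfl).spares rfl).spares rfl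
  · exact ((((t2.spares rfl).spares rfl).spares rfl).spares rfl).spares rfl
  · exact (((t3.spares rfl).spares rfl).spares rfl).spares rfl
  · exact ((t4.spares rfl).spares rfl).spares rfl
  · exact (f1.spares rfl).spares rfl
  · exact f2.spares rfl
  · exact f3

/-- The part of `update` that replaces the old objects by the new ones. -/
def replaceOld : Cmd :=
  seqs ((trees ++ forests).map fun j =>
    seqs [.real (.z j) (.reg (.newZ j)), .list (.tree j) (.reg (.newTree j))])

theorem replaceOld_spec (s : State) :
    (replaceOld.exec I s).1.nat = s.nat ∧ ∀ j,
      (replaceOld.exec I s).1.real (.z j) = s.real (.newZ j) ∧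
      (replaceOld.exec I s).1.list (.tree j) = s.list (.newTree j) := by
  simp only [replaceOld, trees, forests, List.cons_append, List.nil_append, List.map_cons,
    List.map_nil, exec_seqs_cons, exec_seqs_nil, exec_real, exec_list]
  refine ⟨by simp only [nat_setReal, nat_setList], fun j => ?_⟩
  cases j <;> simp [RExp.eval, LExp.eval]

theorem exec_update (s : State) : (update.exec I s).1 =
    (replaceOld.exec I (findNew.exec I
      (pathCost.exec I (s.setNat .pos (I.pos (s.nat .cyc)))).1).1).1 := by
  rw [update, findNew, replaceOld]
  simp only [exec_seqs_cons, exec_seqs_nil, exec_nat, NExp.eval]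

/-- The old data enter as arbitrary functions, so the same statement serves the first cycle, with
its fictitious old objects, and all later ones. -/
theorem update_spec (hk : 2 ≤ I.k) {i : ℕ} {z x y : Entry → ℝ} {l : Entry → List (ℕ × ℕ)}
    (hi : s.nat .cyc = i) (hz' : ∀ j, s.real (.z j) = z j) (hx' : ∀ j, s.real (.x j) = x j)
    (hy' : ∀ j, s.real (.y j) = y j) (hl' : ∀ j, s.list (.tree j) = l j) :
    Updated I i z x y l (update.exec I s).1 := by
  obtain rfl : (fun j => s.real (.z j)) = z := funext hz'
  obtain rfl : (fun j => s.real (.x j)) = x := funext hx'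
  obtain rfl : (fun j => s.real (.y j)) = y := funext hy'
  obtain rfl : (fun j => s.list (.tree j)) = l := funext hl'
  subst hi
  rw [exec_update]
  obtain ⟨h1, t, w, h2⟩ := exec_pathCost hk (s.setNat .pos (I.pos (s.nat .cyc)))
  set s₁ := (pathCost.exec I (s.setNat .pos (I.pos (s.nat .cyc)))).1
  have hcyc : s₁.nat .cyc = s.nat .cyc := by simpa using h2.cyc
  have hpos : s₁.nat .pos = I.pos (s.nat .cyc) := by simpa using h2.pos
  have hz : ∀ j, s₁.real (.z j) = s.real (.z j) := by simpa using h2.z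
  have hx : ∀ j, s₁.real (.x j) = s.real (.x j) := by simpa using h2.x
  have hy : ∀ j, s₁.real (.y j) = s.real (.y j) := by simpa using h2.y
  have htree : ∀ j, s₁.list (.tree j) = s.list (.tree j) := by simpa using h2.tree
  intro j
  obtain ⟨a, ha, g1, g2, g3⟩ := findNew_spec (I := I) (by omega) s₁ j
  obtain ⟨e1, e2⟩ := (replaceOld_spec (I := I) (findNew.exec I s₁).1).2 j
  rw [e1, e2]
  have hval : stateVal I s₁ = candVal I (s.nat .cyc) (pathVal I (s.nat .cyc))
      (fun j => s.real (.z j)) (fun j => s.real (.x j)) (fun j => s.real (.y j)) := by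
    unfold stateVal
    simp only [hz, hx, hy, hcyc, h1, nat_setNat, reduceCtorEq, if_false]
  rw [hpos] at ha g3
  rw [hval] at g1 g3
  rw [hcyc, htree] at g2
  exact ⟨a, ha, g1, g2, g3⟩

/-- The old object `j`, for the first cycle, is the edge at position `0` or empty. -/
def baseList (j : Entry) : List (ℕ × ℕ) := if j ∈ trees then [(0, 0)] else []

/-- The interaction cost of `baseList j` and the edge at position `t` of the first cycle. -/
def basePair (I : Input) (t : ℕ) (j : Entry) : ℝ := if j ∈ trees then pairVal I 0 t 0 else 0

/-- The cost of `baseList j`. -/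
def baseCost (I : Input) (j : Entry) : ℝ := if j ∈ trees then I.c (0, 0) else 0

/-- The part of `init` before `update`. -/
def initSetup : Cmd :=
  seqs [.nat .cyc (.num 0),
    seqs (trees.map fun j =>
      seqs [.real (.z j) (.c (here (.num 0))), .list .src .nil,
        .list (.tree j) (.cons (here (.num 0)) .src),
        .real (.x j) (pairCost (here (.num 1)) (here (.num 0))),
        .real (.y j) (pairCost (here (.sub .k (.num 1))) (here (.num 0)))]),
    seqs (forests.map fun j =>
      seqs [.real (.z j) .zero, .list (.tree j) .nil, .real (.x j) .zero, .real (.y j) .zero])]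

theorem initSetup_spec (s : State) : (initSetup.exec I s).1.nat .cyc = 0 ∧
    ∀ j, (initSetup.exec I s).1.real (.z j) = baseCost I j ∧
      (initSetup.exec I s).1.real (.x j) = basePair I 1 j ∧
      (initSetup.exec I s).1.real (.y j) = basePair I (I.k - 1) j ∧
      (initSetup.exec I s).1.list (.tree j) = baseList j := by
  simp only [initSetup, trees, forests, List.map_cons, List.map_nil, exec_seqs_cons, exec_seqs_nil,
    exec_nat, exec_real, exec_list, pairCost, here, RExp.eval, EExp.eval, NExp.eval, LExp.eval,
    nat_setReal, nat_setList, nat_setNat, if_true, list_setList]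
  refine ⟨trivial, fun j => ?_⟩
  cases j <;> simp [baseCost, basePair, baseList, pairVal, trees]

theorem init_spec (hk : 2 ≤ I.k) (s : State) :
    Updated I 0 (baseCost I) (basePair I 1) (basePair I (I.k - 1)) baseList (init.exec I s).1 := by
  have h : (init.exec I s).1 = (update.exec I (initSetup.exec I s).1).1 := by
    rw [init, initSetup]
    simp only [exec_seqs_cons, exec_seqs_nil]
  obtain ⟨h1, h2⟩ := initSetup_spec (I := I) s
  rw [h]
  exact update_spec hk h1 (fun j => (h2 j).1) (fun j => (h2 j).2.1) (fun j => (h2 j).2.2.1)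
    fun j => (h2 j).2.2.2

/-- The edges near position `p` of cycle `i` that belong to the object `j`. -/
def nearEdges (i p : ℕ) : Entry → List (ℕ × ℕ)
  | .T1 => [(i, p), (i, p - 1)]
  | .T2 => [(i, p), (i, p + 1)]
  | .T3 => [(i, p - 1), (i, p + 1)]
  | .T4 => [(i, p), (i, p - 1), (i, p + 1)]
  | .F1 => [(i, p - 1)]
  | .F2 => [(i, p + 1)]
  | .F3 => [(i, p - 1), (i, p + 1)]

/-- The interaction cost of the old object `j` and the edge at position `t` of cycle `i + 1`. -/
def nearPair (I : Input) (i t : ℕ) (j : Entry) : ℝ :=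
  ((nearEdges i (I.pos i) j).map fun e => I.q (i + 1, t) e + I.q e (i + 1, t)).sum

/-- The part of `round` before `update`. -/
def roundSetup : Cmd :=
  seqs ((trees ++ forests).map fun j =>
    seqs [.real (.x j) (sumExp ((contents j).map (pairCost (here (.num 1))))),
      .real (.y j) (sumExp ((contents j).map (pairCost (here (.sub .k (.num 1))))))])

theorem sumExp_eval (s : State) {i : ℕ} (hi : s.nat .cyc = i + 1) (p : NExp) (j : Entry) :
    (sumExp ((contents j).map (pairCost (here p)))).eval I s = nearPair I i (p.eval I s) j := by
  cases j <;> simp [nearPair, nearEdges, RExp.eval, EExp.eval, NExp.eval, here, pairCost, sumExp,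
    contents, prevA, prevB, prevB', prevCyc, hi]

theorem roundSetup_spec (s : State) {i : ℕ} (hi : s.nat .cyc = i + 1) :
    (roundSetup.exec I s).1.nat .cyc = i + 1 ∧
    ∀ j, (roundSetup.exec I s).1.real (.z j) = s.real (.z j) ∧
      (roundSetup.exec I s).1.real (.x j) = nearPair I i 1 j ∧
      (roundSetup.exec I s).1.real (.y j) = nearPair I i (I.k - 1) j ∧
      (roundSetup.exec I s).1.list (.tree j) = s.list (.tree j) := by
  simp only [roundSetup, trees, forests, List.cons_append, List.nil_append, List.map_cons,
    List.map_nil, exec_seqs_cons, exec_seqs_nil, exec_real]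
  simp only [sumExp_eval (i := i), nat_setReal, hi, NExp.eval]
  refine ⟨trivial, fun j => ?_⟩
  cases j <;> simp

theorem round_spec (hk : 2 ≤ I.k) (s : State) (i : ℕ) (hi : s.nat .cyc = i + 1) :
    Updated I (i + 1) (fun j => s.real (.z j)) (nearPair I i 1) (nearPair I i (I.k - 1))
      (fun j => s.list (.tree j)) (round.exec I s).1 := by
  have h : (round.exec I s).1 = (update.exec I (roundSetup.exec I s).1).1 := by
    rw [round, roundSetup]
    simp only [exec_seqs_cons, exec_seqs_nil]
  obtain ⟨h1, h2⟩ := roundSetup_spec (I := I) s hi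
  rw [h]
  exact update_spec hk h1 (fun j => (h2 j).1) (fun j => (h2 j).2.1) (fun j => (h2 j).2.2.1)
    fun j => (h2 j).2.2.2

/-- This separates the program from the mathematics: a property preserved by every `Updated` step
holds after the sweep, and the premises no longer mention programs. -/
theorem sweep_spec (hk : 2 ≤ I.k) {e : NExp} {m : ℕ} (hm : 1 ≤ m) (he : ∀ s, e.eval I s = m)
    (P : ℕ → State → Prop)
    (first : ∀ s, Updated I 0 (baseCost I) (basePair I 1) (basePair I (I.k - 1)) baseList s → P 1 s)
    (next : ∀ i s s', i + 1 < m → P (i + 1) s →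
      Updated I (i + 1) (fun j => s.real (.z j)) (nearPair I i 1) (nearPair I i (I.k - 1))
        (fun j => s.list (.tree j)) s' → P (i + 2) s') (s : State) :
    P m ((sweep e).exec I s).1 := by
  refine exec_loop P (a := 1) (b := m) rfl (he _) hm (first _ (init_spec hk s)) ?_
  intro v s' hv hvm h
  obtain ⟨i, rfl⟩ : ∃ i, v = i + 1 := ⟨v - 1, by omega⟩
  exact next i s' _ hvm h (round_spec hk (s'.setNat .cyc (i + 1)) i (by simp))

theorem finish_spec (s : State) : ∃ j ∈ trees,
    (finish.exec I s).1.list .out = s.list (.tree j) ∧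
    (finish.exec I s).1.real .best = s.real (.z j) ∧
    ∀ j' ∈ trees, (finish.exec I s).1.real .best ≤ s.real (.z j') := by
  classical
  -- Here `l` lists the trees still to be compared, `S` contains those already compared, and `j` is
  -- the cheapest of these.
  have step : ∀ (l : List Entry) (j : Entry) (S : Set Entry), j ∈ S → ∀ s' : State,
      (∀ j, s'.real (.z j) = s.real (.z j)) → (∀ j, s'.list (.tree j) = s.list (.tree j)) →
      s'.list .out = s.list (.tree j) → s'.real .best = s.real (.z j) →
      (∀ j' ∈ S, s.real (.z j) ≤ s.real (.z j')) → ∃ j'' ∈ S ∪ {j' | j' ∈ l},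
        ((seqs (l.map fun j => cond (.rlt (.reg (.z j)) (.reg .best))
          (seqs [.real .best (.reg (.z j)), .list .out (.reg (.tree j))]))).exec I s').1.list .out =
            s.list (.tree j'') ∧
        ((seqs (l.map fun j => cond (.rlt (.reg (.z j)) (.reg .best))
          (seqs [.real .best (.reg (.z j)), .list .out (.reg (.tree j))]))).exec I s').1.real .best =
            s.real (.z j'') ∧ ∀ j' ∈ S ∪ {j' | j' ∈ l}, s.real (.z j'') ≤ s.real (.z j') := by
    intro l
    induction l with
    | nil =>
      intro j S hj s' h1 h2 h3 h4 h5
      exact ⟨j, Or.inl hj, h3, h4, fun j' hj' => h5 j' (by simpa using hj')⟩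
    | cons i l ih =>
      intro j S hj s' h1 h2 h3 h4 h5
      have hset : S ∪ {j' | j' ∈ i :: l} = insert i S ∪ {j' | j' ∈ l} := by
        ext j'; simp only [Set.mem_union, Set.mem_ofPred_eq, List.mem_cons, Set.mem_insert_iff]; tauto
      rw [hset, List.map_cons, exec_seqs_cons, exec_cond]
      split_ifs with hlt
      · simp only [BExp.holds, RExp.eval, h1, h4] at hlt
        refine ih i _ (Set.mem_insert _ _) _ ?_ ?_ ?_ ?_ ?_
        · simpa [exec_seqs_cons, exec_seqs_nil, exec_real, exec_list] using h1
        · simpa [exec_seqs_cons, exec_seqs_nil, exec_real, exec_list] using h2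
        · simp [exec_seqs_cons, exec_seqs_nil, exec_real, exec_list, LExp.eval, h2]
        · simp [exec_seqs_cons, exec_seqs_nil, exec_real, exec_list, RExp.eval, h1]
        · rintro j' (rfl | hj')
          · exact le_rfl
          · exact hlt.le.trans (h5 j' hj')
      · simp only [BExp.holds, RExp.eval, h1, h4, not_lt] at hlt
        refine ih j _ (Set.mem_insert_of_mem _ hj) _ h1 h2 h3 h4 ?_
        rintro j' (rfl | hj')
        · exact hlt
        · exact h5 j' hj'
  rw [finish, exec_seqs_cons, exec_seqs_cons, exec_seqs_cons, exec_seqs_nil, exec_real, exec_list]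
  obtain ⟨j, hj, h1, h2, h3⟩ := step [.T2, .T3, .T4] .T1 {.T1} rfl
    ((s.setReal .best (s.real (.z .T1))).setList .out (s.list (.tree .T1)))
    (by simp) (by simp) (by simp) (by simp) (by simp)
  have hset : ∀ j, j ∈ ({.T1} : Set Entry) ∪ {j' | j' ∈ [Entry.T2, .T3, .T4]} ↔ j ∈ trees := by
    intro j; simp [trees]
  exact ⟨j, (hset j).1 hj, h1, h2, fun j' hj' => h2.le.trans (h3 j' ((hset j').2 hj'))⟩

end Sweep

end AQMST

namespace AQMST

/-! ### The structure of ladders -/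

namespace Labelling

section Structure

variable {V : Type*} {G : SimpleGraph V} {k n : ℕ} (L : Labelling G k n)

/-- The edges of the graph that cycle `m` is fused to: those of the first `m` cycles and the edge at
position `0` (which is one of them if `m ≥ 1`). -/
def oldEdges (m : ℕ) : Set (Sym2 V) := L.edges m ∪ {L.edge m 0}

/-- The vertices of the graph that cycle `m` is fused to. -/
def oldVerts (m : ℕ) : Set V := L.verts m ∪ {L.x m 0, L.x m 1}

variable {L} {m : ℕ}

theorem edge_eq (L : Labelling G k n) {i t : ℕ} (ht : t + 1 < k) :
    L.edge i t = s(L.x i t, L.x i (t + 1)) := by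
  rw [edge, Nat.mod_eq_of_lt ht]

theorem edge_last (L : Labelling G k n) {i t : ℕ} (ht : t + 1 = k) :
    L.edge i t = s(L.x i t, L.x i 0) := by
  rw [edge, ht, Nat.mod_self]

theorem x_ne (L : Labelling G k n) (hm : m < n) {s t : ℕ} (hs : s < k) (ht : t < k) (hst : s ≠ t) :
    L.x m s ≠ L.x m t := fun h => hst (L.inj m hm hs ht h)

theorem x_notMem_verts (L : Labelling G k n) (hm : m < n) {t : ℕ} (h2 : 2 ≤ t) (ht : t < k) :
    L.x m t ∉ L.verts m := by
  rintro ⟨i, hi, u, hu, h⟩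
  obtain ⟨m, rfl⟩ : ∃ m', m = m' + 1 := ⟨m - 1, by omega⟩
  exact L.fresh m hm t h2 ht i (by omega) u hu h.symm

theorem attached (L : Labelling G k n) (hk : 3 ≤ k) (hm : m < n) :
    Attached k (L.x m) (L.oldVerts m) where
  three_le := hk
  inj := L.inj m hm
  mem_zero := Or.inr (Or.inl rfl)
  mem_one := Or.inr (Or.inr rfl)
  fresh := fun t h2 ht => by
    rintro (h | h | h)
    · exact L.x_notMem_verts hm h2 ht h
    · exact L.x_ne hm ht (by omega) (by omega) h
    · exact L.x_ne hm ht (by omega) (by omega) h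

theorem mem_oldVerts_of_mem_oldEdges (hk : 3 ≤ k) {e : Sym2 V} (he : e ∈ L.oldEdges m) {v : V}
    (hv : v ∈ e) : v ∈ L.oldVerts m := by
  rcases he with ⟨i, hi, t, ht, rfl⟩ | rfl
  · rw [edge, Sym2.mem_iff] at hv
    rcases hv with rfl | rfl
    · exact Or.inl ⟨i, hi, t, ht, rfl⟩
    · exact Or.inl ⟨i, hi, _, Nat.mod_lt _ (by omega), rfl⟩
  · rw [L.edge_eq (by omega), Sym2.mem_iff] at hv
    exact Or.inr hv

theorem mem_edges_succ {e : Sym2 V} (hk : 3 ≤ k) :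
    e ∈ L.edges (m + 1) ↔ e ∈ L.oldEdges m ∨ ∃ t, 1 ≤ t ∧ t < k ∧ L.edge m t = e := by
  constructor
  · rintro ⟨i, hi, t, ht, rfl⟩
    rcases Nat.lt_succ_iff_lt_or_eq.1 hi with h | rfl
    · exact Or.inl (Or.inl ⟨i, h, t, ht, rfl⟩)
    · rcases Nat.eq_zero_or_pos t with rfl | h
      · exact Or.inl (Or.inr rfl)
      · exact Or.inr ⟨t, h, ht, rfl⟩
  · rintro ((⟨i, hi, t, ht, rfl⟩ | rfl) | ⟨t, _, ht, rfl⟩)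
    · exact ⟨i, by omega, t, ht, rfl⟩
    · exact ⟨m, by omega, 0, by omega, rfl⟩
    · exact ⟨m, by omega, t, ht, rfl⟩

theorem growVerts_oldVerts (L : Labelling G k n) (hk : 3 ≤ k) (m : ℕ) :
    growVerts (L.oldVerts m) (L.x m) (k - 1) = L.verts (m + 1) := by
  ext v
  constructor
  · rintro ((⟨i, hi, t, ht, rfl⟩ | rfl | rfl) | ⟨t, _, ht, rfl⟩)
    · exact ⟨i, by omega, t, ht, rfl⟩
    · exact ⟨m, by omega, 0, by omega, rfl⟩
    · exact ⟨m, by omega, 1, by omega, rfl⟩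
    · exact ⟨m, by omega, t, by omega, rfl⟩
  · rintro ⟨i, hi, t, ht, rfl⟩
    rcases Nat.lt_succ_iff_lt_or_eq.1 hi with h | rfl
    · exact Or.inl (Or.inl ⟨i, h, t, ht, rfl⟩)
    · rcases Nat.lt_or_ge t 2 with h | h
      · refine Or.inl (Or.inr ?_)
        interval_cases t
        · exact Or.inl rfl
        · exact Or.inr rfl
      · exact Or.inr ⟨t, h, by omega, rfl⟩

theorem edge_inj (L : Labelling G k n) (hk : 3 ≤ k) (hm : m < n) {s t : ℕ} (hs : s < k) (ht : t < k)
    (h : L.edge m s = L.edge m t) : s = t := by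
  have hmod : ∀ a, a < k → (a + 1) % k = if a + 1 = k then 0 else a + 1 := fun a ha => by
    split_ifs with h
    · rw [h, Nat.mod_self]
    · exact Nat.mod_eq_of_lt (by omega)
  have hlt : ∀ a, (a + 1) % k < k := fun a => Nat.mod_lt _ (by omega)
  rw [edge, edge, Sym2.eq_iff] at h
  rcases h with ⟨h, _⟩ | ⟨h1, h2⟩
  · exact L.inj m hm hs ht h
  -- With opposite orientations each position would be the successor of the other modulo `k`, which
  -- is impossible for `k ≥ 3`.
  · have h3 := L.inj m hm hs (hlt t) h1
    have h4 := L.inj m hm (hlt s) ht h2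
    rw [hmod t ht] at h3
    rw [hmod s hs] at h4
    split_ifs at h3 h4 <;> omega

/-- Every path edge has a new end: the vertex at position `2` if `t = 1`, and the one at position
`t` otherwise. -/
theorem edge_notMem_oldEdges (L : Labelling G k n) (hk : 3 ≤ k) (hm : m < n) {t : ℕ} (h1 : 1 ≤ t)
    (ht : t < k) : L.edge m t ∉ L.oldEdges m := fun h => by
  rcases Nat.lt_or_ge t 2 with h2 | h2
  · obtain rfl : t = 1 := by omega
    refine (L.attached hk hm).fresh 2 le_rfl (by omega) (mem_oldVerts_of_mem_oldEdges hk h ?_)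
    rw [L.edge_eq (by omega)]
    exact Sym2.mem_mk_right _ _
  · exact (L.attached hk hm).fresh t h2 ht
      (mem_oldVerts_of_mem_oldEdges hk h (Sym2.mem_mk_left _ _))

theorem edge_zero_eq (L : Labelling G k n) (hk : 3 ≤ k) (hm : m + 1 < n) :
    L.edge (m + 1) 0 = L.edge m (L.pos m) := by
  rw [L.edge_eq (by omega), edge]
  exact L.glue m hm

theorem oldEdges_succ (L : Labelling G k n) (hk : 3 ≤ k) (hm : m + 1 < n) :
    L.oldEdges (m + 1) = L.edges (m + 1) := by
  refine Set.union_eq_self_of_subset_right (Set.singleton_subset_iff.2 ?_)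
  rw [L.edge_zero_eq hk hm]
  exact ⟨m, by omega, _, L.pos_lt m (by omega), rfl⟩

theorem oldVerts_succ (L : Labelling G k n) (hk : 3 ≤ k) (hm : m + 1 < n) :
    L.oldVerts (m + 1) = L.verts (m + 1) := by
  refine Set.union_eq_self_of_subset_right ?_
  have h := L.glue m hm
  have h1 : L.x m (L.pos m) ∈ L.verts (m + 1) := ⟨m, by omega, _, L.pos_lt m (by omega), rfl⟩
  have h2 : L.x m ((L.pos m + 1) % k) ∈ L.verts (m + 1) :=
    ⟨m, by omega, _, Nat.mod_lt _ (by omega), rfl⟩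
  rw [Sym2.eq_iff] at h
  rcases h with ⟨h3, h4⟩ | ⟨h3, h4⟩
  · rintro v (rfl | rfl)
    · rw [h3]; exact h1
    · rw [h4]; exact h2
  · rintro v (rfl | rfl)
    · rw [h3]; exact h2
    · rw [h4]; exact h1

theorem spanningTree_iff (m : ℕ) (T : Finset (Sym2 V)) : L.SpanningTree m T ↔
    (T : Set (Sym2 V)) ⊆ L.edges m ∧ Spans (T : Set (Sym2 V)) (L.verts m) := Iff.rfl

/-- `A` is a spanning tree of the graph that cycle `m` is fused to. -/
def OldTree (L : Labelling G k n) (m : ℕ) (A : Finset (Sym2 V)) : Prop :=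
  (A : Set (Sym2 V)) ⊆ L.oldEdges m ∧ Spans (A : Set (Sym2 V)) (L.oldVerts m)

/-- `A` is a spanning forest of the graph that cycle `m` is fused to, and consists of two trees that
separate the end points of the edge at position `0`. -/
def OldForest (L : Labelling G k n) (m : ℕ) (A : Finset (Sym2 V)) : Prop :=
  (A : Set (Sym2 V)) ⊆ L.oldEdges m ∧ Splits (A : Set (Sym2 V)) (L.oldVerts m) (L.x m 0) (L.x m 1)

variable [DecidableEq V]

/-- The edge set `A` together with the edges of cycle `m` at the positions in `S`. -/
def combine (L : Labelling G k n) (m : ℕ) (A : Finset (Sym2 V)) (S : Finset ℕ) : Finset (Sym2 V) :=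
  A ∪ S.image (L.edge m)

theorem edge_mem_combine (hk : 3 ≤ k) (hm : m < n) {A : Finset (Sym2 V)}
    (hA : (A : Set (Sym2 V)) ⊆ L.oldEdges m) {S : Finset ℕ} (hS : S ⊆ Finset.Ico 1 k) {t : ℕ}
    (h1 : 1 ≤ t) (ht : t < k) : L.edge m t ∈ L.combine m A S ↔ t ∈ S := by
  rw [combine, Finset.mem_union, Finset.mem_image]
  constructor
  · rintro (h | ⟨u, hu, he⟩)
    · exact absurd (hA h) (L.edge_notMem_oldEdges hk hm h1 ht)
    · rwa [← L.edge_inj hk hm (Finset.mem_Ico.1 (hS hu)).2 ht he]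
  · exact fun h => Or.inr ⟨t, h, rfl⟩

theorem combine_subset (hk : 3 ≤ k) {A : Finset (Sym2 V)}
    (hA : (A : Set (Sym2 V)) ⊆ L.oldEdges m) {S : Finset ℕ} (hS : S ⊆ Finset.Ico 1 k) :
    (L.combine m A S : Set (Sym2 V)) ⊆ L.edges (m + 1) := by
  intro e he
  rw [mem_edges_succ hk]
  rw [Finset.mem_coe, combine, Finset.mem_union, Finset.mem_image] at he
  rcases he with h | ⟨t, ht, rfl⟩
  · exact Or.inl (hA h)
  · exact Or.inr ⟨t, (Finset.mem_Ico.1 (hS ht)).1, (Finset.mem_Ico.1 (hS ht)).2, rfl⟩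

theorem exists_combine (hk : 3 ≤ k) {T : Finset (Sym2 V)}
    (hT : (T : Set (Sym2 V)) ⊆ L.edges (m + 1)) : ∃ (A : Finset (Sym2 V)) (S : Finset ℕ),
      (A : Set (Sym2 V)) ⊆ L.oldEdges m ∧ S ⊆ Finset.Ico 1 k ∧ T = L.combine m A S := by
  classical
  refine ⟨T.filter (· ∈ L.oldEdges m), (Finset.Ico 1 k).filter (L.edge m · ∈ T), ?_,
    Finset.filter_subset _ _, ?_⟩
  · intro e he
    exact (Finset.mem_filter.1 he).2
  · ext e
    rw [combine, Finset.mem_union, Finset.mem_image, Finset.mem_filter]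
    constructor
    · intro he
      rcases (mem_edges_succ hk).1 (hT he) with h | ⟨t, h1, h2, rfl⟩
      · exact Or.inl ⟨he, h⟩
      · exact Or.inr ⟨t, Finset.mem_filter.2 ⟨Finset.mem_Ico.2 ⟨h1, h2⟩, he⟩, rfl⟩
    · rintro (h | ⟨t, ht, rfl⟩)
      · exact h.1
      · exact (Finset.mem_filter.1 ht).2

theorem coe_combine (A : Finset (Sym2 V)) {S : Finset ℕ} (hS : S ⊆ Finset.Ico 1 k) :
    (L.combine m A S : Set (Sym2 V)) =
      (A : Set (Sym2 V)) ∪ pathEdges (fun t => s(L.x m t, L.x m ((t + 1) % k))) S k := by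
  ext e
  rw [Finset.mem_coe, combine, Finset.mem_union, Finset.mem_image]
  refine or_congr Iff.rfl ⟨?_, ?_⟩
  · rintro ⟨t, ht, rfl⟩
    exact ⟨t, ht, (Finset.mem_Ico.1 (hS ht)).1, (Finset.mem_Ico.1 (hS ht)).2, rfl⟩
  · rintro ⟨t, ht, _, _, rfl⟩
    exact ⟨t, ht, rfl⟩

/-- This is `Attached.spans_cycle` read inside the ladder. Every statement about which combinations
are trees or forests descends from it. -/
theorem spanningTree_combine_iff (hk : 3 ≤ k) (hm : m < n) {A : Finset (Sym2 V)}
    (hA : (A : Set (Sym2 V)) ⊆ L.oldEdges m) {S : Finset ℕ} (hS : S ⊆ Finset.Ico 1 k) :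
    L.SpanningTree (m + 1) (L.combine m A S) ↔
      (missing S k = 0 ∧ L.OldForest m A) ∨ (missing S k = 1 ∧ L.OldTree m A) := by
  rw [spanningTree_iff, and_iff_right (combine_subset hk hA hS), ← L.growVerts_oldVerts hk,
    coe_combine A hS, (L.attached hk hm).spans_cycle
      (fun e he v hv => mem_oldVerts_of_mem_oldEdges hk (hA he) hv) S,
    OldForest, OldTree, and_iff_right hA, and_iff_right hA]

/-- The marked edge joins the two trees of a split forest. Forests therefore need no analysis of
their own, only that of trees containing the marked edge. -/
theorem splitForest_iff (hm : m < n) (hpos : L.pos m + 1 < k) (T : Finset (Sym2 V)) :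
    L.SplitForest (m + 1) T ↔ L.edge m (L.pos m) ∉ T ∧
      L.SpanningTree (m + 1) (insert (L.edge m (L.pos m)) T) := by
  have hne : L.x m (L.pos m) ≠ L.x m (L.pos m + 1) := L.x_ne hm (by omega) hpos (by omega)
  have hmem : L.edge m (L.pos m) ∈ L.edges (m + 1) := ⟨m, by omega, _, by omega, rfl⟩
  have hv : L.x m (L.pos m) ∈ L.verts (m + 1) := ⟨m, by omega, _, by omega, rfl⟩
  have hedge := L.edge_eq (i := m) hpos
  have hsplit : L.SplitForest (m + 1) T ↔ (T : Set (Sym2 V)) ⊆ L.edges (m + 1) ∧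
      Splits (T : Set (Sym2 V)) (L.verts (m + 1)) (L.x m (L.pos m)) (L.x m (L.pos m + 1)) := Iff.rfl
  have hnot : L.SplitForest (m + 1) T → L.edge m (L.pos m) ∉ T := fun h hT => by
    refine (hsplit.1 h).2.2.1 (SimpleGraph.Adj.reachable ?_)
    rw [SimpleGraph.fromEdgeSet_adj]
    exact ⟨by rw [← hedge]; exact hT, hne⟩
  rw [spanningTree_iff, Finset.coe_insert, Set.insert_subset_iff]
  constructor
  · intro h
    have hT := hnot h
    refine ⟨hT, ⟨hmem, h.1⟩, ?_⟩
    rw [hedge] at hT ⊢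
    exact (spans_insert_iff hne hT hv).2 (hsplit.1 h).2
  · rintro ⟨hT, ⟨_, h1⟩, h2⟩
    rw [hedge] at hT h2
    exact hsplit.2 ⟨h1, (spans_insert_iff hne hT hv).1 h2⟩

theorem combine_insert (A : Finset (Sym2 V)) (S : Finset ℕ) (t : ℕ) :
    L.combine m A (insert t S) = insert (L.edge m t) (L.combine m A S) := by
  rw [combine, combine, Finset.image_insert, Finset.union_insert]

theorem splitForest_combine_iff (hk : 3 ≤ k) (hm : m < n) (h1 : 1 ≤ L.pos m)
    (hpos : L.pos m + 1 < k) {A : Finset (Sym2 V)}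
    (hA : (A : Set (Sym2 V)) ⊆ L.oldEdges m) {S : Finset ℕ} (hS : S ⊆ Finset.Ico 1 k) :
    L.SplitForest (m + 1) (L.combine m A S) ↔ L.pos m ∉ S ∧
      ((missing (insert (L.pos m) S) k = 0 ∧ L.OldForest m A) ∨
        (missing (insert (L.pos m) S) k = 1 ∧ L.OldTree m A)) := by
  rw [splitForest_iff hm hpos, edge_mem_combine hk hm hA hS h1 (by omega), ← combine_insert,
    spanningTree_combine_iff hk hm hA
      (Finset.insert_subset (Finset.mem_Ico.2 ⟨h1, by omega⟩) hS)]

end Structure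

end Labelling

/-! ### Sets of positions -/

/-- The positions `1, …, k - 1` without `d₁` and `d₂`. -/
def keep (k d₁ d₂ : ℕ) : Finset ℕ := (Finset.Ico 1 k).filter fun t => ¬ (t = d₁ ∨ t = d₂)

theorem mem_keep {k d₁ d₂ t : ℕ} :
    t ∈ keep k d₁ d₂ ↔ (1 ≤ t ∧ t < k) ∧ ¬ (t = d₁ ∨ t = d₂) := by
  rw [keep, Finset.mem_filter, Finset.mem_Ico]

theorem keep_subset (k d₁ d₂ : ℕ) : keep k d₁ d₂ ⊆ Finset.Ico 1 k := Finset.filter_subset _ _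

theorem keep_comm (k d₁ d₂ : ℕ) : keep k d₁ d₂ = keep k d₂ d₁ := by
  ext t; rw [mem_keep, mem_keep, or_comm]

theorem keep_zero (k : ℕ) : keep k 0 0 = Finset.Ico 1 k := by
  ext t; rw [mem_keep, Finset.mem_Ico]; omega

theorem insert_keep {k d₁ d₂ : ℕ} (h : 1 ≤ d₁) (hk : d₁ < k) (hd : d₁ ≠ d₂) :
    insert d₁ (keep k d₁ d₂) = keep k 0 d₂ := by
  ext t; rw [Finset.mem_insert, mem_keep, mem_keep]; omega

/-- Position `0` lies outside `1, …, k - 1`, so as an argument of `keep` it deletes nothing. This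
lets `keep` describe no deletion, one, or two. -/
theorem missing_eq_zero_iff {S : Finset ℕ} {k : ℕ} (hS : S ⊆ Finset.Ico 1 k) :
    missing S k = 0 ↔ S = keep k 0 0 := by
  rw [missing, Finset.card_eq_zero, Finset.filter_eq_empty_iff, keep_zero]
  constructor
  · intro h
    exact Finset.Subset.antisymm hS fun t ht => not_not.1 (h ht)
  · rintro rfl t ht
    exact not_not.2 ht

theorem missing_eq_one_iff {S : Finset ℕ} {k : ℕ} (hS : S ⊆ Finset.Ico 1 k) :
    missing S k = 1 ↔ ∃ d, 1 ≤ d ∧ d < k ∧ S = keep k 0 d := by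
  rw [missing, Finset.card_eq_one]
  constructor
  · rintro ⟨d, hd⟩
    have h : ∀ t, t ∈ (Finset.Ico 1 k).filter (· ∉ S) ↔ t = d := fun t => by
      rw [hd, Finset.mem_singleton]
    have h1 := (h d).2 rfl
    rw [Finset.mem_filter, Finset.mem_Ico] at h1
    refine ⟨d, h1.1.1, h1.1.2, ?_⟩
    ext t
    have h2 := h t
    rw [Finset.mem_filter] at h2
    rw [mem_keep, ← Finset.mem_Ico]
    constructor
    · intro ht
      refine ⟨hS ht, ?_⟩
      have := Finset.mem_Ico.1 (hS ht)
      have h3 : t ≠ d := fun h => (h2.2 h).2 ht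
      omega
    · rintro ⟨ht, hne⟩
      by_contra hn
      exact hne (Or.inr (h2.1 ⟨ht, hn⟩))
  · rintro ⟨d, h1, h2, rfl⟩
    refine ⟨d, ?_⟩
    ext t
    rw [Finset.mem_filter, Finset.mem_Ico, mem_keep, Finset.mem_singleton]
    omega

end AQMST

/-! ### The recursion: admissible objects are exactly the candidates -/

namespace AQMST

theorem eq_keep_of_insert_eq {S : Finset ℕ} {k p d : ℕ} (hp : p ∉ S) (h : insert p S = keep k 0 d) :
    p ≠ d ∧ S = keep k p d := by
  have hmem : ∀ t, t = p ∨ t ∈ S ↔ (1 ≤ t ∧ t < k) ∧ ¬ (t = 0 ∨ t = d) := fun t => by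
    rw [← mem_keep, ← h, Finset.mem_insert]
  have h0 := (hmem p).1 (Or.inl rfl)
  refine ⟨by omega, ?_⟩
  ext t
  rw [mem_keep]
  have h1 := hmem t
  constructor
  · intro ht
    have h2 := h1.1 (Or.inr ht)
    have h3 : t ≠ p := fun h => hp (h ▸ ht)
    omega
  · intro ht
    rcases h1.2 (by omega) with h3 | h3
    · omega
    · exact h3

namespace Labelling

section Candidates

variable {V : Type*} {G : SimpleGraph V} {k n : ℕ} {L : Labelling G k n} {m : ℕ}

/-- `A` is an old tree or an old forest, according to the name `j`. -/
def OldKind (L : Labelling G k n) (m : ℕ) (j : Entry) (A : Finset (Sym2 V)) : Prop :=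
  if j ∈ trees then L.OldTree m A else L.OldForest m A

theorem OldKind.subset {j : Entry} {A : Finset (Sym2 V)} (h : L.OldKind m j A) :
    (A : Set (Sym2 V)) ⊆ L.oldEdges m := by
  unfold OldKind at h
  split_ifs at h
  · exact h.1
  · exact h.1

theorem exists_treeCands_iff {A : Finset (Sym2 V)} {S : Finset ℕ} {d₁ d₂ : ℕ} :
    (∃ a ∈ treeCands d₁ d₂, L.OldKind m a.1 A ∧ S = keep k a.2.1 a.2.2) ↔
      L.OldTree m A ∧ S = keep k d₁ d₂ := by
  constructor
  · rintro ⟨⟨j, d⟩, ⟨hj, rfl⟩, h, hS⟩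
    simp only [OldKind, hj, if_true] at h
    exact ⟨h, hS⟩
  · rintro ⟨h, hS⟩
    -- Any tree name would do: `OldKind` sees only whether a name stands for a tree or a forest.
    exact ⟨(.T1, d₁, d₂), ⟨by simp [trees], rfl⟩, by simpa [OldKind, trees] using h, hS⟩

theorem exists_forestCands_iff {A : Finset (Sym2 V)} {S : Finset ℕ} {p d : ℕ} :
    (∃ a ∈ forestCands k p d, L.OldKind m a.1 A ∧ S = keep k a.2.1 a.2.2) ↔
      (L.OldForest m A ∧ S = keep k d 0) ∨ ∃ t, (1 ≤ t ∧ t < k ∧ (t + 1 < p ∨ p + 1 < t)) ∧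
        L.OldTree m A ∧ S = keep k d t := by
  have hdisj : ∀ j, j ∈ forests → j ∉ trees := by intro j; cases j <;> simp [forests, trees]
  constructor
  · rintro ⟨⟨j, d⟩, ⟨hj, rfl⟩ | ⟨hj, t, h1, h2, h3, rfl⟩, h, hS⟩
    · simp only [OldKind, hdisj j hj, if_false] at h
      exact Or.inl ⟨h, hS⟩
    · simp only [OldKind, hj, if_true] at h
      exact Or.inr ⟨t, ⟨h1, h2, h3⟩, h, hS⟩
  · rintro (⟨h, hS⟩ | ⟨t, ⟨h1, h2, h3⟩, h, hS⟩)
    · exact ⟨(.F1, d, 0), Or.inl ⟨by simp [forests], rfl⟩, by simpa [OldKind, trees] using h, hS⟩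
    · exact ⟨(.T1, d, t), Or.inr ⟨by simp [trees], t, h1, h2, h3, rfl⟩,
        by simpa [OldKind, trees] using h, hS⟩

theorem subset_edges_of_admissible {j : Entry} {A : Finset (Sym2 V)} (h : L.Admissible (m + 1) j A) :
    (A : Set (Sym2 V)) ⊆ L.edges (m + 1) := by
  cases j <;> exact h.1.1

theorem oldTree_succ_iff (hk : 3 ≤ k) (hm : m + 1 < n) {A : Finset (Sym2 V)} :
    L.OldTree (m + 1) A ↔ L.SpanningTree (m + 1) A := by
  rw [OldTree, spanningTree_iff, L.oldEdges_succ hk hm, L.oldVerts_succ hk hm]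

theorem oldForest_succ_iff (hk : 3 ≤ k) (hm : m + 1 < n) {A : Finset (Sym2 V)} :
    L.OldForest (m + 1) A ↔ (A : Set (Sym2 V)) ⊆ L.edges (m + 1) ∧
      Splits (A : Set (Sym2 V)) (L.verts (m + 1)) (L.x m (L.pos m)) (L.x m ((L.pos m + 1) % k)) := by
  rw [OldForest, L.oldEdges_succ hk hm, L.oldVerts_succ hk hm]
  have h := L.glue m hm
  rw [Sym2.eq_iff] at h
  rcases h with ⟨h1, h2⟩ | ⟨h1, h2⟩
  · rw [h1, h2]
  · rw [h1, h2, splits_comm]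

variable [DecidableEq V]

theorem tree_positions {A : Finset (Sym2 V)} {S : Finset ℕ} (hk : 3 ≤ k) (hm : m < n)
    (hA : (A : Set (Sym2 V)) ⊆ L.oldEdges m) (hS : S ⊆ Finset.Ico 1 k) :
    L.SpanningTree (m + 1) (L.combine m A S) ↔ (L.OldForest m A ∧ S = keep k 0 0) ∨
      ∃ t, (1 ≤ t ∧ t < k) ∧ L.OldTree m A ∧ S = keep k 0 t := by
  rw [spanningTree_combine_iff hk hm hA hS, missing_eq_zero_iff hS, missing_eq_one_iff hS]
  constructor
  · rintro (⟨h1, h2⟩ | ⟨⟨t, h1, h2, h3⟩, h4⟩)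
    · exact Or.inl ⟨h2, h1⟩
    · exact Or.inr ⟨t, ⟨h1, h2⟩, h4, h3⟩
  · rintro (⟨h1, h2⟩ | ⟨t, ⟨h1, h2⟩, h4, h3⟩)
    · exact Or.inl ⟨h2, h1⟩
    · exact Or.inr ⟨⟨t, h1, h2, h3⟩, h4⟩

theorem forest_positions {A : Finset (Sym2 V)} {S : Finset ℕ} (hk : 3 ≤ k) (hm : m < n)
    (h1 : 1 ≤ L.pos m) (hpos : L.pos m + 1 < k)
    (hA : (A : Set (Sym2 V)) ⊆ L.oldEdges m) (hS : S ⊆ Finset.Ico 1 k) :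
    L.SplitForest (m + 1) (L.combine m A S) ↔ (L.OldForest m A ∧ S = keep k (L.pos m) 0) ∨
      ∃ t, (1 ≤ t ∧ t < k ∧ t ≠ L.pos m) ∧ L.OldTree m A ∧ S = keep k (L.pos m) t := by
  have hS' : insert (L.pos m) S ⊆ Finset.Ico 1 k :=
    Finset.insert_subset (Finset.mem_Ico.2 ⟨h1, by omega⟩) hS
  rw [splitForest_combine_iff hk hm h1 hpos hA hS, missing_eq_zero_iff hS', missing_eq_one_iff hS']
  constructor
  · rintro ⟨hp, ⟨g1, g2⟩ | ⟨⟨t, g1, g2, g3⟩, g4⟩⟩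
    · exact Or.inl ⟨g2, (eq_keep_of_insert_eq hp g1).2⟩
    · exact Or.inr ⟨t, ⟨g1, g2, (eq_keep_of_insert_eq hp g3).1.symm⟩, g4,
        (eq_keep_of_insert_eq hp g3).2⟩
  · rintro (⟨g2, rfl⟩ | ⟨t, ⟨g1, g2, g3⟩, g4, rfl⟩)
    · exact ⟨by rw [mem_keep]; omega, Or.inl ⟨insert_keep h1 (by omega) (by omega), g2⟩⟩
    · exact ⟨by rw [mem_keep]; omega,
        Or.inr ⟨⟨t, g1, g2, insert_keep h1 (by omega) g3.symm⟩, g4⟩⟩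

/-- With `p` the marked position, `2 ≤ p ≤ k - 2` puts `p - 1`, `p`, `p + 1` among the path
positions, so the conditions on the three near edges become conditions on `S`. A tree misses at most
one position, and a forest misses `p` and at most one more. A missing near edge other than the
marked edge of a forest therefore determines the deletion completely; only `T4` and `F3` leave it
open, which is where old forests and the free deletion come in. -/
theorem admissible_combine_iff (hk : 4 ≤ k) (hm : m < n) {A : Finset (Sym2 V)} {S : Finset ℕ}
    (hA : (A : Set (Sym2 V)) ⊆ L.oldEdges m) (hS : S ⊆ Finset.Ico 1 k) (j : Entry) :
    L.Admissible (m + 1) j (L.combine m A S) ↔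
      ∃ a ∈ cands k (L.pos m) j, L.OldKind m a.1 A ∧ S = keep k a.2.1 a.2.2 := by
  obtain ⟨hp1, hp2⟩ := L.pos_free hk m hm
  have ha := edge_mem_combine (t := L.pos m) (by omega) hm hA hS (by omega) (by omega)
  have hb := edge_mem_combine (t := L.pos m - 1) (by omega) hm hA hS (by omega) (by omega)
  have hb' := edge_mem_combine (t := L.pos m + 1) (by omega) hm hA hS (by omega) (by omega)
  have hT := tree_positions (by omega) hm hA hS
  have hF := forest_positions (by omega) hm (by omega) (by omega) hA hS
  cases j <;> simp only [Admissible, Nat.add_sub_cancel, ha, hb, hb', hT, hF, cands,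
    exists_treeCands_iff, exists_forestCands_iff]
  case T1 =>
    constructor
    · rintro ⟨⟨_, rfl⟩ | ⟨t, ht, h, rfl⟩, h1, h2, h3⟩ <;> rw [mem_keep] at h1 h2 h3
      · omega
      · obtain rfl : t = L.pos m + 1 := by omega
        exact ⟨h, keep_comm _ _ _⟩
    · rintro ⟨h, rfl⟩
      refine ⟨Or.inr ⟨L.pos m + 1, by omega, h, keep_comm _ _ _⟩, ?_⟩
      rw [mem_keep, mem_keep, mem_keep]; omega
  case T2 =>
    constructor
    · rintro ⟨⟨_, rfl⟩ | ⟨t, ht, h, rfl⟩, h1, h2, h3⟩ <;> rw [mem_keep] at h1 h2 h3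
      · omega
      · obtain rfl : t = L.pos m - 1 := by omega
        exact ⟨h, keep_comm _ _ _⟩
    · rintro ⟨h, rfl⟩
      refine ⟨Or.inr ⟨L.pos m - 1, by omega, h, keep_comm _ _ _⟩, ?_⟩
      rw [mem_keep, mem_keep, mem_keep]; omega
  case T3 =>
    constructor
    · rintro ⟨⟨_, rfl⟩ | ⟨t, ht, h, rfl⟩, h1, h2, h3⟩ <;> rw [mem_keep] at h1 h2 h3
      · omega
      · obtain rfl : t = L.pos m := by omega
        exact ⟨h, keep_comm _ _ _⟩
    · rintro ⟨h, rfl⟩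
      refine ⟨Or.inr ⟨L.pos m, by omega, h, keep_comm _ _ _⟩, ?_⟩
      rw [mem_keep, mem_keep, mem_keep]; omega
  case T4 =>
    constructor
    · rintro ⟨⟨h, rfl⟩ | ⟨t, ht, h, rfl⟩, h1, h2, h3⟩ <;> rw [mem_keep] at h1 h2 h3
      · exact Or.inl ⟨h, rfl⟩
      · exact Or.inr ⟨t, by omega, h, rfl⟩
    · rintro (⟨h, rfl⟩ | ⟨t, ht, h, rfl⟩)
      · refine ⟨Or.inl ⟨h, rfl⟩, ?_⟩
        rw [mem_keep, mem_keep, mem_keep]; omega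
      · refine ⟨Or.inr ⟨t, by omega, h, rfl⟩, ?_⟩
        rw [mem_keep, mem_keep, mem_keep]; omega
  case F1 =>
    constructor
    · rintro ⟨⟨_, rfl⟩ | ⟨t, ht, h, rfl⟩, h1, h2, h3⟩ <;> rw [mem_keep] at h1 h2 h3
      · omega
      · obtain rfl : t = L.pos m + 1 := by omega
        exact ⟨h, rfl⟩
    · rintro ⟨h, rfl⟩
      refine ⟨Or.inr ⟨L.pos m + 1, by omega, h, rfl⟩, ?_⟩
      rw [mem_keep, mem_keep, mem_keep]; omega
  case F2 =>
    constructor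
    · rintro ⟨⟨_, rfl⟩ | ⟨t, ht, h, rfl⟩, h1, h2, h3⟩ <;> rw [mem_keep] at h1 h2 h3
      · omega
      · obtain rfl : t = L.pos m - 1 := by omega
        exact ⟨h, rfl⟩
    · rintro ⟨h, rfl⟩
      refine ⟨Or.inr ⟨L.pos m - 1, by omega, h, rfl⟩, ?_⟩
      rw [mem_keep, mem_keep, mem_keep]; omega
  case F3 =>
    constructor
    · rintro ⟨⟨h, rfl⟩ | ⟨t, ht, h, rfl⟩, h1, h2, h3⟩ <;> rw [mem_keep] at h1 h2 h3
      · exact Or.inl ⟨h, rfl⟩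
      · exact Or.inr ⟨t, by omega, h, rfl⟩
    · rintro (⟨h, rfl⟩ | ⟨t, ht, h, rfl⟩)
      · refine ⟨Or.inl ⟨h, rfl⟩, ?_⟩
        rw [mem_keep, mem_keep, mem_keep]; omega
      · refine ⟨Or.inr ⟨t, by omega, h, rfl⟩, ?_⟩
        rw [mem_keep, mem_keep, mem_keep]; omega

/-- The constraint on the old object `j` before cycle `m` is fused: for `m = 0` the only old tree is
the edge at position `0`, and the only old forest is empty. -/
def OldAdmissible (L : Labelling G k n) : ℕ → Entry → Finset (Sym2 V) → Prop
  | 0, j, A => A = if j ∈ trees then {L.edge 0 0} else ∅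
  | m + 1, j, A => L.Admissible (m + 1) j A

/-- Before the first cycle the graph is a single edge, and the empty set leaves its two ends apart.
-/
theorem oldTree_zero_iff (hk : 3 ≤ k) (hn : 0 < n) {A : Finset (Sym2 V)} :
    L.OldTree 0 A ↔ A = {L.edge 0 0} := by
  have hE : L.oldEdges 0 = {L.edge 0 0} := by
    ext e; simp only [oldEdges, edges, Set.mem_union, Set.mem_ofPred_eq]
    constructor
    · rintro (⟨i, hi, _⟩ | h)
      · omega
      · exact h
    · exact Or.inr
  have hW : L.oldVerts 0 = {L.x 0 0, L.x 0 1} := by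
    ext e; simp only [oldVerts, verts, Set.mem_union, Set.mem_ofPred_eq]
    constructor
    · rintro (⟨i, hi, _⟩ | h)
      · omega
      · exact h
    · exact Or.inr
  have hne : L.x 0 0 ≠ L.x 0 1 := L.x_ne hn (by omega) (by omega) (by omega)
  rw [OldTree, hE, hW, ← Finset.coe_singleton, Finset.coe_subset, Finset.subset_singleton_iff]
  constructor
  · rintro ⟨rfl | h, h2⟩
    · exact absurd h2 (not_spans_isolated (w := L.x 0 0) (u := L.x 0 1) (by simp) (by simp)
        (by simp) hne.symm)
    · exact h
  · rintro rfl
    refine ⟨Or.inr rfl, ?_⟩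
    rw [Finset.coe_singleton, ← insert_empty_eq, L.edge_eq (by omega),
      spans_insert_iff hne (by simp) (by simp)]
    refine ⟨by simp, ?_, ?_⟩
    · rw [reachable_isolated (by simp)]; exact hne
    · rintro w (rfl | rfl)
      · exact Or.inl (SimpleGraph.Reachable.refl _)
      · exact Or.inr (SimpleGraph.Reachable.refl _)

theorem oldForest_zero_iff (hk : 3 ≤ k) (hn : 0 < n) {A : Finset (Sym2 V)} :
    L.OldForest 0 A ↔ A = ∅ := by
  have hne : L.x 0 0 ≠ L.x 0 1 := L.x_ne hn (by omega) (by omega) (by omega)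
  have hins : L.edge 0 0 ∉ A → (L.OldForest 0 A ↔ L.OldTree 0 (insert (L.edge 0 0) A)) := fun hA => by
    rw [OldForest, OldTree, Finset.coe_insert, Set.insert_subset_iff,
      and_iff_right (show L.edge 0 0 ∈ L.oldEdges 0 from Or.inr rfl)]
    rw [L.edge_eq (by omega)] at hA ⊢
    rw [spans_insert_iff hne hA (Or.inr (Or.inl rfl))]
  constructor
  · intro h
    have hA : L.edge 0 0 ∉ A := fun hA => by
      refine h.2.2.1 (SimpleGraph.Adj.reachable ?_)
      rw [SimpleGraph.fromEdgeSet_adj]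
      exact ⟨by rw [L.edge_eq (by omega)] at hA; exact hA, hne⟩
    have h2 := (oldTree_zero_iff hk hn).1 ((hins hA).1 h)
    rw [Finset.eq_empty_iff_forall_notMem]
    intro e he
    have h3 : e ∈ ({L.edge 0 0} : Finset _) := h2 ▸ Finset.mem_insert_of_mem he
    rw [Finset.mem_singleton] at h3
    exact hA (h3 ▸ he)
  · rintro rfl
    rw [hins (by simp), oldTree_zero_iff hk hn]
    rfl

/-- At most one path edge is missing, so at least two of the three near edges are present, and the
four names cover these patterns. -/
theorem exists_tree_admissible (hk : 4 ≤ k) (hm : m < n) {T : Finset (Sym2 V)} :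
    L.SpanningTree (m + 1) T ↔ ∃ j ∈ trees, L.Admissible (m + 1) j T := by
  constructor
  · intro h
    obtain ⟨hp1, hp2⟩ := L.pos_free hk m hm
    obtain ⟨A, S, hA, hS, rfl⟩ := exists_combine (by omega) h.1
    have ha := edge_mem_combine (t := L.pos m) (by omega) hm hA hS (by omega) (by omega)
    have hb := edge_mem_combine (t := L.pos m - 1) (by omega) hm hA hS (by omega) (by omega)
    have hb' := edge_mem_combine (t := L.pos m + 1) (by omega) hm hA hS (by omega) (by omega)
    suffices hs : (L.pos m ∈ S ∧ L.pos m - 1 ∈ S ∧ L.pos m + 1 ∉ S) ∨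
        (L.pos m ∈ S ∧ L.pos m - 1 ∉ S ∧ L.pos m + 1 ∈ S) ∨
        (L.pos m ∉ S ∧ L.pos m - 1 ∈ S ∧ L.pos m + 1 ∈ S) ∨
        (L.pos m ∈ S ∧ L.pos m - 1 ∈ S ∧ L.pos m + 1 ∈ S) by
      rw [← ha, ← hb, ← hb'] at hs
      rcases hs with hs | hs | hs | hs
      · exact ⟨.T1, by simp [trees], h, hs⟩
      · exact ⟨.T2, by simp [trees], h, hs⟩
      · exact ⟨.T3, by simp [trees], h, hs⟩
      · exact ⟨.T4, by simp [trees], h, hs⟩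
    rcases (tree_positions (by omega) hm hA hS).1 h with ⟨_, rfl⟩ | ⟨t, ht, _, rfl⟩ <;>
      rw [mem_keep, mem_keep, mem_keep] <;> omega
  · rintro ⟨j, hj, h⟩
    cases j <;> first | exact h.1 | simp [trees] at hj

/-- Besides the marked edge at most one path edge is missing, so at least one neighbour of the
marked edge is present. -/
theorem exists_forest_admissible (hk : 4 ≤ k) (hm : m < n) {T : Finset (Sym2 V)} :
    L.SplitForest (m + 1) T ↔ ∃ j ∈ forests, L.Admissible (m + 1) j T := by
  constructor
  · intro h
    obtain ⟨hp1, hp2⟩ := L.pos_free hk m hm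
    obtain ⟨A, S, hA, hS, rfl⟩ := exists_combine (by omega) h.1
    have ha := edge_mem_combine (t := L.pos m) (by omega) hm hA hS (by omega) (by omega)
    have hb := edge_mem_combine (t := L.pos m - 1) (by omega) hm hA hS (by omega) (by omega)
    have hb' := edge_mem_combine (t := L.pos m + 1) (by omega) hm hA hS (by omega) (by omega)
    suffices hs : (L.pos m ∉ S ∧ L.pos m - 1 ∈ S ∧ L.pos m + 1 ∉ S) ∨
        (L.pos m ∉ S ∧ L.pos m - 1 ∉ S ∧ L.pos m + 1 ∈ S) ∨
        (L.pos m ∉ S ∧ L.pos m - 1 ∈ S ∧ L.pos m + 1 ∈ S) by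
      rw [← ha, ← hb, ← hb'] at hs
      rcases hs with hs | hs | hs
      · exact ⟨.F1, by simp [forests], h, hs⟩
      · exact ⟨.F2, by simp [forests], h, hs⟩
      · exact ⟨.F3, by simp [forests], h, hs⟩
    rcases (forest_positions (by omega) hm (by omega) (by omega) hA hS).1 h with
      ⟨_, rfl⟩ | ⟨t, ht, _, rfl⟩ <;> rw [mem_keep, mem_keep, mem_keep] <;> omega
  · rintro ⟨j, hj, h⟩
    cases j <;> first | exact h.1 | simp [forests] at hj

theorem oldTree_iff (hk : 4 ≤ k) (hm : m < n) {A : Finset (Sym2 V)} :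
    L.OldTree m A ↔ ∃ j ∈ trees, L.OldAdmissible m j A := by
  cases m with
  | zero =>
    rw [oldTree_zero_iff (by omega) hm]
    constructor
    · exact fun h => ⟨.T1, by simp [trees], by simpa [OldAdmissible, trees] using h⟩
    · rintro ⟨j, hj, h⟩; simpa [OldAdmissible, hj] using h
  | succ m =>
    rw [oldTree_succ_iff (by omega) hm, exists_tree_admissible hk (by omega)]
    rfl

theorem oldForest_iff (hk : 4 ≤ k) (hm : m < n) {A : Finset (Sym2 V)} :
    L.OldForest m A ↔ ∃ j ∈ forests, L.OldAdmissible m j A := by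
  have hdisj : ∀ j, j ∈ forests → j ∉ trees := by intro j; cases j <;> simp [forests, trees]
  cases m with
  | zero =>
    rw [oldForest_zero_iff (by omega) hm]
    constructor
    · exact fun h => ⟨.F1, by simp [forests], by simpa [OldAdmissible, trees] using h⟩
    · rintro ⟨j, hj, h⟩; simpa [OldAdmissible, hdisj j hj] using h
  | succ m =>
    obtain ⟨hp1, hp2⟩ := L.pos_free hk m (by omega)
    rw [oldForest_succ_iff (by omega) hm, Nat.mod_eq_of_lt (by omega)]
    exact exists_forest_admissible hk (by omega)

theorem OldAdmissible.oldKind (hk : 4 ≤ k) (hm : m < n) {j : Entry} {A : Finset (Sym2 V)}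
    (h : L.OldAdmissible m j A) : L.OldKind m j A := by
  have hsplit : j ∈ trees ∨ j ∈ forests := by cases j <;> simp [forests, trees]
  unfold OldKind
  split_ifs with hj
  · exact (oldTree_iff hk hm).2 ⟨j, hj, h⟩
  · exact (oldForest_iff hk hm).2 ⟨j, hsplit.resolve_left hj, h⟩

theorem cands_of_same_kind {k p d₁ d₂ : ℕ} {i j j' : Entry} (h : (j, d₁, d₂) ∈ cands k p i)
    (hj : j ∈ trees ↔ j' ∈ trees) : (j', d₁, d₂) ∈ cands k p i := by
  have hf : ∀ j : Entry, j ∈ forests ↔ j ∉ trees := by intro j; cases j <;> simp [forests, trees]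
  cases i <;> simpa only [cands, treeCands, forestCands, Set.mem_union, Set.mem_ofPred_eq, hf, hj]
    using h

/-- Every old tree or forest has one of the names of its kind, and the candidate sets treat all
names of a kind alike. So the description by kinds refines to one by names, to which stored optima
apply. -/
theorem admissible_iff (hk : 4 ≤ k) (hm : m < n) (j : Entry) (T : Finset (Sym2 V)) :
    L.Admissible (m + 1) j T ↔ ∃ a ∈ cands k (L.pos m) j, ∃ A, L.OldAdmissible m a.1 A ∧
      T = L.combine m A (keep k a.2.1 a.2.2) := by
  constructor
  · intro h
    obtain ⟨A, S, hA, hS, rfl⟩ := exists_combine (by omega) (subset_edges_of_admissible h)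
    obtain ⟨⟨j', d₁, d₂⟩, ha, hK, rfl⟩ := (admissible_combine_iff hk hm hA hS j).1 h
    obtain ⟨j'', hj, hadm⟩ : ∃ j'', (j' ∈ trees ↔ j'' ∈ trees) ∧ L.OldAdmissible m j'' A := by
      have hf : ∀ j : Entry, j ∈ forests → j ∉ trees := by intro j; cases j <;> simp [forests, trees]
      unfold OldKind at hK
      split_ifs at hK with hj
      · obtain ⟨j'', h1, h2⟩ := (oldTree_iff hk hm).1 hK
        exact ⟨j'', iff_of_true hj h1, h2⟩
      · obtain ⟨j'', h1, h2⟩ := (oldForest_iff hk hm).1 hK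
        exact ⟨j'', iff_of_false hj (hf j'' h1), h2⟩
    exact ⟨(j'', d₁, d₂), cands_of_same_kind ha hj, A, hadm, rfl⟩
  · rintro ⟨a, ha, A, hadm, rfl⟩
    have hK := hadm.oldKind hk hm
    exact (admissible_combine_iff hk hm hK.subset (keep_subset _ _ _) j).2 ⟨a, ha, hK, rfl⟩

end Candidates

end Labelling

end AQMST

namespace AQMST

/-! ### Costs -/

section Costs

variable {V : Type*} [DecidableEq V] (c : Sym2 V → ℝ) (q : Sym2 V → Sym2 V → ℝ)

theorem cost_empty : cost c q ∅ = 0 := by simp [cost]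

theorem cost_insert {A : Finset (Sym2 V)} {e : Sym2 V} (he : e ∉ A) :
    cost c q (insert e A) = cost c q A + c e + ∑ f ∈ A, (q e f + q f e) := by
  unfold cost
  rw [Finset.sum_insert he, Finset.sum_insert he, Finset.erase_insert he, Finset.sum_add_distrib]
  have h : ∀ f ∈ A, ∑ g ∈ (insert e A).erase f, q f g = q f e + ∑ g ∈ A.erase f, q f g := by
    intro f hf
    have hne : e ≠ f := fun h => he (h ▸ hf)
    rw [Finset.erase_insert_of_ne hne,
      Finset.sum_insert fun h => he (Finset.mem_of_mem_erase h)]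
  rw [Finset.sum_congr rfl h, Finset.sum_add_distrib]
  ring

theorem cost_union {A B : Finset (Sym2 V)} (h : Disjoint A B) :
    cost c q (A ∪ B) = cost c q A + cost c q B + ∑ f ∈ B, ∑ e ∈ A, (q f e + q e f) := by
  induction B using Finset.induction_on with
  | empty => simp [cost_empty]
  | insert f B hf ih =>
    rw [Finset.disjoint_insert_right] at h
    rw [Finset.union_insert, cost_insert c q (by simp [h.1, hf]), cost_insert c q hf,
      Finset.sum_insert hf, ih h.2, Finset.sum_union h.2]
    ring

end Costs

/-! ### Costs of combinations and correctness of the sweep -/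

namespace Labelling

section LadderCosts

variable {V : Type*} {G : SimpleGraph V} {k n : ℕ} {L : Labelling G k n} {m : ℕ}
  {c : Sym2 V → ℝ} {q : Sym2 V → Sym2 V → ℝ}

theorem mem_edgeSet_of_mem_edges {e : Sym2 V} (hm : m ≤ n) (he : e ∈ L.edges m) : e ∈ G.edgeSet := by
  obtain ⟨i, hi, t, ht, rfl⟩ := he
  exact (L.edges_eq _).2 ⟨i, by omega, t, ht, rfl⟩

theorem edge_mem_edgeSet (hm : m < n) {t : ℕ} (ht : t < k) : L.edge m t ∈ G.edgeSet :=
  (L.edges_eq _).2 ⟨m, hm, t, ht, rfl⟩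

theorem pair_eq_zero (hq : AdjacentOnly G q) {e f : Sym2 V} (he : e ∈ G.edgeSet) (hf : f ∈ G.edgeSet)
    (hef : e ≠ f) (h : ∀ v, v ∈ e → v ∉ f) : q e f + q f e = 0 := by
  rw [hq e he f hf hef fun ⟨v, h1, h2⟩ => h v h1 h2,
    hq f hf e he hef.symm fun ⟨v, h1, h2⟩ => h v h2 h1, add_zero]

/-- Without position `0` the cycle is a path, on which only consecutive edges meet. -/
theorem pair_path_eq_zero (hk : 4 ≤ k) (hm : m < n) (hq : AdjacentOnly G q) {t u : ℕ} (h1 : 1 ≤ t)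
    (htu : t + 1 < u) (hu : u < k) :
    q (L.edge m t) (L.edge m u) + q (L.edge m u) (L.edge m t) = 0 := by
  refine pair_eq_zero hq (edge_mem_edgeSet hm (by omega)) (edge_mem_edgeSet hm hu)
    (fun h => by have := L.edge_inj (by omega) hm (by omega) hu h; omega) fun v hv hv' => ?_
  rw [L.edge_eq (by omega), Sym2.mem_iff] at hv
  rcases Nat.lt_or_ge (u + 1) k with h | h
  · rw [L.edge_eq h, Sym2.mem_iff] at hv'
    rcases hv with rfl | rfl <;> rcases hv' with hv' | hv' <;>
      exact L.x_ne hm (by omega) (by omega) (by omega) hv'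
  · rw [L.edge_last (by omega), Sym2.mem_iff] at hv'
    rcases hv with rfl | rfl <;> rcases hv' with hv' | hv' <;>
      exact L.x_ne hm (by omega) (by omega) (by omega) hv'

/-- At positions `2, …, k - 2` both ends of the edge are new. -/
theorem pair_old_eq_zero (hk : 4 ≤ k) (hm : m < n) (hq : AdjacentOnly G q) {t : ℕ} (h2 : 2 ≤ t)
    (ht : t + 1 < k) {e : Sym2 V} (he : e ∈ L.oldEdges m) :
    q (L.edge m t) e + q e (L.edge m t) = 0 := by
  have hmem : e ∈ G.edgeSet := by
    rcases he with he | rfl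
    · exact mem_edgeSet_of_mem_edges hm.le he
    · exact edge_mem_edgeSet hm (by omega)
  refine pair_eq_zero hq (edge_mem_edgeSet hm (by omega)) hmem
    (fun h => L.edge_notMem_oldEdges (by omega) hm (by omega) (by omega) (h ▸ he)) fun v hv hv' => ?_
  have hold := mem_oldVerts_of_mem_oldEdges (by omega) he hv'
  rw [L.edge_eq ht, Sym2.mem_iff] at hv
  rcases hv with rfl | rfl
  · exact (L.attached (by omega) hm).fresh _ h2 (by omega) hold
  · exact (L.attached (by omega) hm).fresh _ (by omega) (by omega) hold

/-- The edges of the first `m + 1` cycles that meet the edge shared with the next cycle. -/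
theorem eq_near_of_mem (hk : 4 ≤ k) (hm : m < n) {e : Sym2 V} (he : e ∈ L.edges (m + 1))
    (h : L.x m (L.pos m) ∈ e ∨ L.x m (L.pos m + 1) ∈ e) :
    e = L.edge m (L.pos m) ∨ e = L.edge m (L.pos m - 1) ∨ e = L.edge m (L.pos m + 1) := by
  obtain ⟨hp1, hp2⟩ := L.pos_free hk m hm
  have hA := L.attached (by omega) hm
  rcases (mem_edges_succ (by omega)).1 he with he | ⟨t, h1, ht, rfl⟩
  · rcases h with h | h
    · exact absurd (mem_oldVerts_of_mem_oldEdges (by omega) he h)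
        (hA.fresh _ (by omega) (by omega))
    · exact absurd (mem_oldVerts_of_mem_oldEdges (by omega) he h)
        (hA.fresh _ (by omega) (by omega))
  · have key : t = L.pos m ∨ t = L.pos m - 1 ∨ t = L.pos m + 1 := by
      by_contra hne
      rcases Nat.lt_or_ge (t + 1) k with h3 | h3
      · rw [L.edge_eq h3, Sym2.mem_iff, Sym2.mem_iff] at h
        rcases h with (h | h) | (h | h) <;>
          exact L.x_ne hm (by omega) (by omega) (by omega) h
      · rw [L.edge_last (by omega), Sym2.mem_iff, Sym2.mem_iff] at h
        rcases h with (h | h) | (h | h) <;>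
          exact L.x_ne hm (by omega) (by omega) (by omega) h
    rcases key with rfl | rfl | rfl <;> tauto

theorem sum_base {t : ℕ} {A : Finset (Sym2 V)} {j : Entry}
    (hA : L.OldAdmissible 0 j A) :
    ∑ e ∈ A, (q (L.edge 0 t) e + q e (L.edge 0 t)) = basePair (L.input c q) t j := by
  rw [OldAdmissible] at hA
  rw [hA, basePair]
  split_ifs
  · simp [pairVal, Labelling.input]
  · simp

variable [DecidableEq V]

/-- This is why seven names suffice: the interaction of the new path with an old object depends on
the name of that object only. An old edge that meets the path contains an end of the shared edge,
hence is one of three edges of cycle `m`, and the name prescribes which of them are present. -/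
theorem sum_near (hk : 4 ≤ k) (hm : m + 1 < n) (hq : AdjacentOnly G q) {t : ℕ}
    (h1 : 1 ≤ t) (ht : t < k) {A : Finset (Sym2 V)} {j : Entry}
    (hA : L.Admissible (m + 1) j A) :
    ∑ e ∈ A, (q (L.edge (m + 1) t) e + q e (L.edge (m + 1) t)) = nearPair (L.input c q) m t j := by
  obtain ⟨hp1, hp2⟩ := L.pos_free hk m (by omega)
  have hsub := subset_edges_of_admissible hA
  set g : Sym2 V → ℝ := fun e => q (L.edge (m + 1) t) e + q e (L.edge (m + 1) t) with hg
  have hzero : ∀ e ∈ A, ¬ (e = L.edge m (L.pos m) ∨ e = L.edge m (L.pos m - 1) ∨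
      e = L.edge m (L.pos m + 1)) → g e = 0 := by
    intro e he hne
    have heE : e ∈ L.edges (m + 1) := hsub he
    have heO : e ∈ L.oldEdges (m + 1) := Or.inl heE
    refine pair_eq_zero hq (edge_mem_edgeSet hm ht) (mem_edgeSet_of_mem_edges hm.le heE)
      (fun h => L.edge_notMem_oldEdges (by omega) hm h1 ht (h ▸ heO)) fun v hv hv' => ?_
    have hold := mem_oldVerts_of_mem_oldEdges (by omega) heO hv'
    have hat := L.attached (by omega) hm
    -- The common vertex is old and lies on the new path, so it is an end of the shared edge.
    have hv01 : v = L.x (m + 1) 0 ∨ v = L.x (m + 1) 1 := by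
      rcases Nat.lt_or_ge (t + 1) k with h3 | h3
      · rw [L.edge_eq h3, Sym2.mem_iff] at hv
        rcases hv with rfl | rfl
        · rcases Nat.lt_or_ge 1 t with h4 | h4
          · exact absurd hold (hat.fresh _ h4 (by omega))
          · obtain rfl : t = 1 := by omega
            exact Or.inr rfl
        · exact absurd hold (hat.fresh _ (by omega) (by omega))
      · rw [L.edge_last (by omega), Sym2.mem_iff] at hv
        rcases hv with rfl | rfl
        · exact absurd hold (hat.fresh _ (by omega) (by omega))
        · exact Or.inl rfl
    have hglue := L.glue m hm
    rw [Nat.mod_eq_of_lt (by omega)] at hglue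
    have hvmem : v ∈ s(L.x m (L.pos m), L.x m (L.pos m + 1)) := by
      rw [← hglue, Sym2.mem_iff]; exact hv01
    rw [Sym2.mem_iff] at hvmem
    refine hne (eq_near_of_mem hk (by omega) heE ?_)
    rcases hvmem with rfl | rfl
    · exact Or.inl hv'
    · exact Or.inr hv'
  have hne : ∀ {s u : ℕ}, s < k → u < k → s ≠ u → L.edge m s ≠ L.edge m u := fun hs hu hsu h =>
    hsu (L.edge_inj (by omega) (by omega) hs hu h)
  have hab : L.edge m (L.pos m) ≠ L.edge m (L.pos m - 1) := hne (by omega) (by omega) (by omega)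
  have hab' : L.edge m (L.pos m) ≠ L.edge m (L.pos m + 1) := hne (by omega) (by omega) (by omega)
  have hbb' : L.edge m (L.pos m - 1) ≠ L.edge m (L.pos m + 1) := hne (by omega) (by omega) (by omega)
  -- The sum collapses to the three near edges, each counted only if it belongs to `A`.
  have hsum : ∑ e ∈ A, g e = (if L.edge m (L.pos m) ∈ A then g (L.edge m (L.pos m)) else 0) +
      ((if L.edge m (L.pos m - 1) ∈ A then g (L.edge m (L.pos m - 1)) else 0) +
        (if L.edge m (L.pos m + 1) ∈ A then g (L.edge m (L.pos m + 1)) else 0)) := by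
    have h3 : ∑ e ∈ ({L.edge m (L.pos m), L.edge m (L.pos m - 1), L.edge m (L.pos m + 1)} :
        Finset (Sym2 V)), (if e ∈ A then g e else 0) = ∑ e ∈ A, g e := by
      rw [← Finset.sum_filter, Finset.filter_mem_eq_inter]
      refine Finset.sum_subset Finset.inter_subset_right fun e he hne' => hzero e he fun h => hne' ?_
      rw [Finset.mem_inter]
      exact ⟨by simpa using h, he⟩
    rw [← h3, Finset.sum_insert (by simp [hab, hab']), Finset.sum_insert (by simp [hbb']),
      Finset.sum_singleton]
  rw [hsum]
  cases j <;> obtain ⟨_, ha, hb, hb'⟩ := hA <;> simp only [Nat.add_sub_cancel] at ha hb hb' <;>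
    simp [ha, hb, hb', nearPair, nearEdges, Labelling.input, hg]

theorem disjoint_path (hk : 3 ≤ k) (hm : m < n) {A : Finset (Sym2 V)}
    (hA : (A : Set (Sym2 V)) ⊆ L.oldEdges m) {S : Finset ℕ} (hS : S ⊆ Finset.Ico 1 k) :
    Disjoint A (S.image (L.edge m)) := by
  rw [Finset.disjoint_left]
  intro e he he'
  obtain ⟨t, ht, rfl⟩ := Finset.mem_image.1 he'
  have := Finset.mem_Ico.1 (hS ht)
  exact L.edge_notMem_oldEdges hk hm this.1 this.2 (hA he)

theorem sum_image_path (hk : 3 ≤ k) (hm : m < n) {S : Finset ℕ} (hS : S ⊆ Finset.Ico 1 k)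
    (g : Sym2 V → ℝ) : ∑ e ∈ S.image (L.edge m), g e = ∑ t ∈ S, g (L.edge m t) :=
  Finset.sum_image fun _ hs _ ht h =>
    L.edge_inj hk hm (Finset.mem_Ico.1 (hS hs)).2 (Finset.mem_Ico.1 (hS ht)).2 h

/-- Only the first and the last path edge touch the old graph, so all other mixed terms vanish. -/
theorem cost_combine (hk : 4 ≤ k) (hm : m < n) (hq : AdjacentOnly G q) {A : Finset (Sym2 V)}
    (hA : (A : Set (Sym2 V)) ⊆ L.oldEdges m) {S : Finset ℕ} (hS : S ⊆ Finset.Ico 1 k) :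
    cost c q (L.combine m A S) = cost c q A + cost c q (S.image (L.edge m)) +
      ((if 1 ∈ S then ∑ e ∈ A, (q (L.edge m 1) e + q e (L.edge m 1)) else 0) +
        (if k - 1 ∈ S then ∑ e ∈ A, (q (L.edge m (k - 1)) e + q e (L.edge m (k - 1))) else 0)) := by
  rw [combine, cost_union c q (disjoint_path (by omega) hm hA hS),
    sum_image_path (by omega) hm hS fun f => ∑ e ∈ A, (q f e + q e f)]
  congr 1
  set g : ℕ → ℝ := fun t => ∑ e ∈ A, (q (L.edge m t) e + q e (L.edge m t)) with hg
  have h3 : ∑ t ∈ ({1, k - 1} : Finset ℕ), (if t ∈ S then g t else 0) = ∑ t ∈ S, g t := by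
    rw [← Finset.sum_filter, Finset.filter_mem_eq_inter]
    refine Finset.sum_subset Finset.inter_subset_right fun t ht hne => ?_
    rw [Finset.mem_inter, Finset.mem_insert, Finset.mem_singleton] at hne
    have h1 := Finset.mem_Ico.1 (hS ht)
    have h2 : ¬ (t = 1 ∨ t = k - 1) := fun h => hne ⟨h, ht⟩
    exact Finset.sum_eq_zero fun e he =>
      pair_old_eq_zero hk hm hq (by omega) (by omega) (hA he)
  change ∑ t ∈ S, g t = _
  rw [← h3, Finset.sum_pair (by omega)]

/-- The cost of the edges of cycle `m` at the positions in `S`. -/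
def pathCostOf (L : Labelling G k n) (c : Sym2 V → ℝ) (q : Sym2 V → Sym2 V → ℝ) (m : ℕ)
    (S : Finset ℕ) : ℝ := cost c q (S.image (L.edge m))

/-- On the path the edge at `d` interacts only with its two neighbours. At the ends of the path one
of the tests fails by itself, since neither `0` nor `k` belongs to `S`. -/
theorem pathCostOf_insert (hk : 4 ≤ k) (hm : m < n) (hq : AdjacentOnly G q) {S : Finset ℕ}
    (hS : S ⊆ Finset.Ico 1 k) {d : ℕ} (h1 : 1 ≤ d) (hd : d < k) (hdS : d ∉ S) :
    L.pathCostOf c q m (insert d S) = L.pathCostOf c q m S + (L.input c q).c (m, d) +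
      (if d - 1 ∈ S then pairVal (L.input c q) m (d - 1) d else 0) +
      (if d + 1 ∈ S then pairVal (L.input c q) m d (d + 1) else 0) := by
  have hnot : L.edge m d ∉ S.image (L.edge m) := fun h => by
    obtain ⟨t, ht, he⟩ := Finset.mem_image.1 h
    exact hdS (L.edge_inj (by omega) hm (Finset.mem_Ico.1 (hS ht)).2 hd he ▸ ht)
  rw [pathCostOf, pathCostOf, Finset.image_insert, cost_insert c q hnot,
    sum_image_path (by omega) hm hS fun f => q (L.edge m d) f + q f (L.edge m d)]
  set g : ℕ → ℝ := fun t => q (L.edge m d) (L.edge m t) + q (L.edge m t) (L.edge m d) with hg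
  have h3 : ∑ t ∈ ({d - 1, d + 1} : Finset ℕ), (if t ∈ S then g t else 0) = ∑ t ∈ S, g t := by
    rw [← Finset.sum_filter, Finset.filter_mem_eq_inter]
    refine Finset.sum_subset Finset.inter_subset_right fun t ht hne => ?_
    rw [Finset.mem_inter, Finset.mem_insert, Finset.mem_singleton] at hne
    have h1 := Finset.mem_Ico.1 (hS ht)
    have h2 : ¬ (t = d - 1 ∨ t = d + 1) := fun h => hne ⟨h, ht⟩
    have h4 : t ≠ d := fun h => hdS (h ▸ ht)
    rcases Nat.lt_or_ge t d with h5 | h5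
    · rw [hg]; dsimp only
      rw [add_comm]
      exact pair_path_eq_zero hk hm hq h1.1 (by omega) hd
    · exact pair_path_eq_zero hk hm hq (by omega) (by omega) h1.2
  change _ + ∑ t ∈ S, g t = _
  rw [← h3, Finset.sum_pair (by omega), ← add_assoc]
  have e1 : g (d - 1) = pairVal (L.input c q) m (d - 1) d := by
    simp only [hg, pairVal, Labelling.input]; ring
  have e2 : g (d + 1) = pairVal (L.input c q) m d (d + 1) := by
    simp only [hg, pairVal, Labelling.input]
  rw [e1, e2]
  rfl

theorem pathVal_eq (hk : 4 ≤ k) (hm : m < n) (hq : AdjacentOnly G q) :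
    pathVal (L.input c q) m = L.pathCostOf c q m (Finset.Ico 1 k) := by
  -- Induction over initial segments of the path: a new last edge interacts only with its
  -- predecessor.
  have key : ∀ v, 2 ≤ v → v ≤ k → L.pathCostOf c q m (Finset.Ico 1 v) = (L.input c q).c (m, 1) +
      ∑ t ∈ Finset.Ico 2 v, ((L.input c q).c (m, t) + pairVal (L.input c q) m (t - 1) t) := by
    intro v hv
    induction v, hv using Nat.le_induction with
    | base =>
      intro _
      have h := pathCostOf_insert (L := L) (c := c) (S := ∅) hk hm hq (by simp) (d := 1) le_rfl
        (by omega) (by simp)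
      rw [show Finset.Ico 1 2 = insert 1 ∅ from rfl, h]
      simp [pathCostOf, cost_empty]
    | succ v hv ih =>
      intro hvk
      rw [← Finset.insert_Ico_right_eq_Ico_add_one (by omega),
        pathCostOf_insert hk hm hq (Finset.Ico_subset_Ico_right (by omega)) (by omega) (by omega)
          (by simp), Finset.sum_Ico_succ_top hv, ih (by omega),
        if_pos (by rw [Finset.mem_Ico]; omega), if_neg (by simp)]
      ring
  exact (key k (by omega) le_rfl).symm

theorem pathCostOf_delete (hk : 4 ≤ k) (hm : m < n) (hq : AdjacentOnly G q) {d d' : ℕ} (h1 : 0 < d)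
    (hd : d < k) (hne : d ≠ d') :
    L.pathCostOf c q m (keep k d d') = L.pathCostOf c q m (keep k 0 d') - (L.input c q).c (m, d) -
      (if 1 < d ∧ ¬ d - 1 = d' then pairVal (L.input c q) m (d - 1) d else 0) -
      (if d + 1 < k ∧ ¬ d + 1 = d' then pairVal (L.input c q) m d (d + 1) else 0) := by
  have h := pathCostOf_insert (L := L) (c := c) hk hm hq (keep_subset k d d') (d := d) h1 hd
    (by rw [mem_keep]; omega)
  rw [insert_keep h1 hd hne,
    if_congr (show d - 1 ∈ keep k d d' ↔ 1 < d ∧ ¬ d - 1 = d' by rw [mem_keep]; omega) rfl rfl,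
    if_congr (show d + 1 ∈ keep k d d' ↔ d + 1 < k ∧ ¬ d + 1 = d' by rw [mem_keep]; omega)
      rfl rfl] at h
  rw [h]
  ring

/-- The edges are deleted one after the other. When the two deleted edges are adjacent, the tests
against `d₁` in the second deletion prevent their interaction from being subtracted twice; `hd`
excludes deleting one edge twice. -/
theorem restVal_eq (hk : 4 ≤ k) (hm : m < n) (hq : AdjacentOnly G q) {d₁ d₂ : ℕ} (h₁ : d₁ < k)
    (h₂ : d₂ < k) (hd : d₂ = 0 ∨ d₁ ≠ d₂) :
    restVal (L.input c q) m (pathVal (L.input c q) m) d₁ d₂ = L.pathCostOf c q m (keep k d₁ d₂) := by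
  have hfst : (if 0 < d₁ then
      pathVal (L.input c q) m - (L.input c q).c (m, d₁) -
        (if 1 < d₁ then pairVal (L.input c q) m (d₁ - 1) d₁ else 0) -
        (if d₁ + 1 < k then pairVal (L.input c q) m d₁ (d₁ + 1) else 0)
    else pathVal (L.input c q) m) = L.pathCostOf c q m (keep k 0 d₁) := by
    rw [pathVal_eq hk hm hq, ← keep_zero]
    rcases Nat.eq_zero_or_pos d₁ with rfl | h0
    · rw [if_neg (lt_irrefl 0)]
    · rw [if_pos h0, keep_comm k 0 d₁, pathCostOf_delete hk hm hq h0 h₁ (by omega),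
        if_congr (show 1 < d₁ ∧ ¬ d₁ - 1 = 0 ↔ 1 < d₁ by omega) rfl rfl,
        if_congr (show d₁ + 1 < k ∧ ¬ d₁ + 1 = 0 ↔ d₁ + 1 < k by omega) rfl rfl]
  have hk' : (L.input c q).k = k := rfl
  simp only [restVal, hk', hfst]
  rcases Nat.eq_zero_or_pos d₂ with rfl | h0
  · rw [if_neg (lt_irrefl 0), keep_comm]
  · rw [if_pos h0, keep_comm k d₁ d₂, pathCostOf_delete hk hm hq h0 h₂ (by omega)]

theorem cands_bounds {p d₁ d₂ : ℕ} {j j' : Entry} (hp1 : 2 ≤ p) (hp2 : p + 2 ≤ k)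
    (h : (j', d₁, d₂) ∈ cands k p j) : d₁ < k ∧ d₂ < k ∧ (d₂ = 0 ∨ d₁ ≠ d₂) := by
  cases j
  case T4 | F3 =>
    rcases h with ⟨_, h⟩ | ⟨_, t, h1, h2, h3, h⟩ <;> rw [Prod.mk.injEq] at h <;> omega
  all_goals
    have h := h.2
    rw [Prod.mk.injEq] at h
    omega

/-- The interaction costs `x` and `y` are correct for the old objects before cycle `m` is fused. -/
def InteractionCosts (L : Labelling G k n) (q : Sym2 V → Sym2 V → ℝ) (m : ℕ) (x y : Entry → ℝ) :
    Prop :=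
  ∀ j A, L.OldAdmissible m j A →
    ∑ e ∈ A, (q (L.edge m 1) e + q e (L.edge m 1)) = x j ∧
    ∑ e ∈ A, (q (L.edge m (k - 1)) e + q e (L.edge m (k - 1))) = y j

/-- The term `z j'` cancels against the one inside `candVal`, so nothing is assumed about `z`. The
formula isolates `cost c q A - z j'` as the only part that depends on the choice of `A` among
objects of the same name. -/
theorem cost_combine_keep (hk : 4 ≤ k) (hm : m < n) (hq : AdjacentOnly G q) {z x y : Entry → ℝ}
    (hxy : L.InteractionCosts q m x y) {j j' : Entry} {d₁ d₂ : ℕ}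
    (ha : (j', d₁, d₂) ∈ cands k (L.pos m) j) {A : Finset (Sym2 V)}
    (hA : L.OldAdmissible m j' A) :
    cost c q (L.combine m A (keep k d₁ d₂)) = cost c q A - z j' +
      candVal (L.input c q) m (pathVal (L.input c q) m) z x y (j', d₁, d₂) := by
  obtain ⟨hp1, hp2⟩ := L.pos_free hk m hm
  obtain ⟨h₁, h₂, hd⟩ := cands_bounds hp1 hp2 ha
  rw [cost_combine hk hm hq (hA.oldKind hk hm).subset (keep_subset _ _ _), (hxy j' A hA).1,
    (hxy j' A hA).2, candVal, restVal_eq hk hm hq h₁ h₂ hd, pathCostOf,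
    if_congr (show 1 ∈ keep k d₁ d₂ ↔ ¬ (d₁ = 1 ∨ d₂ = 1) by rw [mem_keep]; omega) rfl rfl,
    if_congr (show k - 1 ∈ keep k d₁ d₂ ↔ ¬ (d₁ = k - 1 ∨ d₂ = k - 1) by rw [mem_keep]; omega)
      rfl rfl]
  have hk' : (L.input c q).k = k := rfl
  rw [hk']
  ring

/-- The lists `l` and the costs `z` are correct for the objects on which cycle `m` is fused. -/
def Solved (L : Labelling G k n) (c : Sym2 V → ℝ) (q : Sym2 V → Sym2 V → ℝ) (m : ℕ)
    (z : Entry → ℝ) (l : Entry → List (ℕ × ℕ)) : Prop :=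
  ∀ j, IsOptimal (cost c q) (L.OldAdmissible m j) (L.edgeFinset (l j)) ∧
    z j = cost c q (L.edgeFinset (l j)) ∧ ((l j).map fun a => L.edge a.1 a.2).Nodup

theorem edgeFinset_pathList (i d₁ d₂ : ℕ) (l : List (ℕ × ℕ)) :
    L.edgeFinset (pathList k i d₁ d₂ l) = L.combine i (L.edgeFinset l) (keep k d₁ d₂) := by
  ext e
  simp only [edgeFinset, pathList, combine, List.mem_toFinset, Finset.mem_union, Finset.mem_image,
    List.map_append, List.mem_append, List.mem_map, List.mem_reverse, List.mem_filter,
    List.mem_range'_1, mem_keep, decide_eq_true_eq]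
  constructor
  · rintro (⟨_, ⟨t, ⟨h1, h2⟩, rfl⟩, rfl⟩ | h)
    · exact Or.inr ⟨t, ⟨by omega, h2⟩, rfl⟩
    · exact Or.inl h
  · rintro (h | ⟨t, ⟨h1, h2⟩, rfl⟩)
    · exact Or.inr h
    · exact Or.inl ⟨(i, t), ⟨t, ⟨by omega, h2⟩, rfl⟩, rfl⟩

theorem nodup_pathList (hk : 3 ≤ k) (hm : m < n) (d₁ d₂ : ℕ) {l : List (ℕ × ℕ)}
    (hl : (l.map fun a => L.edge a.1 a.2).Nodup)
    (hA : (L.edgeFinset l : Set (Sym2 V)) ⊆ L.oldEdges m) :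
    ((pathList k m d₁ d₂ l).map fun a => L.edge a.1 a.2).Nodup := by
  rw [pathList, List.map_append, List.nodup_append']
  refine ⟨?_, hl, ?_⟩
  · rw [List.map_reverse, List.nodup_reverse, List.map_map]
    refine List.Nodup.map_on ?_ (List.Nodup.filter _ List.nodup_range')
    intro s hs t ht h
    rw [List.mem_filter, List.mem_range'_1] at hs ht
    exact L.edge_inj hk hm (by omega) (by omega) h
  · rw [List.disjoint_left]
    intro e he he'
    simp only [List.mem_map, List.mem_reverse, List.mem_filter, List.mem_range'_1] at he
    obtain ⟨_, ⟨t, ⟨h1, _⟩, rfl⟩, rfl⟩ := he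
    refine L.edge_notMem_oldEdges hk hm (t := t) (by omega) (by omega) (hA ?_)
    rw [Finset.mem_coe, edgeFinset, List.mem_toFinset]
    exact he'

/-- The principle of optimality: replacing the old part of a competitor by the stored optimum of the
same name keeps it admissible and does not raise its cost, and the stored candidate is the best of
what remains. -/
theorem Solved.next (hk : 4 ≤ k) (hm : m < n) (hq : AdjacentOnly G q) {z x y : Entry → ℝ}
    {l : Entry → List (ℕ × ℕ)} (h : L.Solved c q m z l) (hxy : L.InteractionCosts q m x y)
    {s : State} (hs : Updated (L.input c q) m z x y l s) :
    L.Solved c q (m + 1) (fun j => s.real (.z j)) fun j => s.list (.tree j) := by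
  intro j
  obtain ⟨⟨j', d₁, d₂⟩, ha, hz, hl, hmin⟩ := hs j
  have hk' : (L.input c q).k = k := rfl
  have hpos : (L.input c q).pos m = L.pos m := rfl
  rw [hk', hpos] at ha hmin
  rw [hk'] at hl
  dsimp only at hl ⊢
  obtain ⟨hopt, hcost, hnodup⟩ := h j'
  have hcost' : s.real (.z j) = cost c q (L.edgeFinset (s.list (.tree j))) := by
    rw [hz, hl, edgeFinset_pathList, cost_combine_keep (z := z) hk hm hq hxy ha hopt.1, hcost, sub_self,
      zero_add]
  refine ⟨⟨?_, fun T hT => ?_⟩, hcost', ?_⟩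
  · rw [hl, edgeFinset_pathList]
    exact (admissible_iff hk hm j _).2 ⟨_, ha, _, hopt.1, rfl⟩
  -- The competitor extends an old object `A` of name `i`; its cost exceeds its candidate value by
  -- `cost c q A - z i`, which is nonnegative.
  · obtain ⟨⟨i, e₁, e₂⟩, hb, A, hA, rfl⟩ := (admissible_iff hk hm j T).1 hT
    rw [← hcost', cost_combine_keep (z := z) hk hm hq hxy hb hA]
    have h1 := hmin _ hb
    have h2 := (h i).1.2 A hA
    rw [← (h i).2.1] at h2
    linarith
  · rw [hl]
    exact nodup_pathList (by omega) hm _ _ hnodup (hopt.1.oldKind hk hm).subset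

theorem solved_base (c : Sym2 V → ℝ) (q : Sym2 V → Sym2 V → ℝ) :
    L.Solved c q 0 (baseCost (L.input c q)) baseList := by
  intro j
  have h : L.edgeFinset (baseList j) = if j ∈ trees then {L.edge 0 0} else ∅ := by
    unfold baseList
    split_ifs <;> simp [edgeFinset]
  refine ⟨⟨h, fun T hT => ?_⟩, ?_, ?_⟩
  · rw [OldAdmissible] at hT
    rw [h, hT]
  · rw [h, baseCost]
    split_ifs
    · simp [cost, Labelling.input]
    · rw [cost_empty]
  · unfold baseList
    split_ifs <;> simp

theorem sweep_solved (hk : 4 ≤ k) (hq : AdjacentOnly G q) (hm : 1 ≤ m) (hmn : m ≤ n) {e : NExp}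
    (he : ∀ s, e.eval (L.input c q) s = m) (s : State) :
    L.Solved c q m (fun j => ((sweep e).exec (L.input c q) s).1.real (.z j))
      fun j => ((sweep e).exec (L.input c q) s).1.list (.tree j) := by
  have hk2 : 2 ≤ (L.input c q).k := by change 2 ≤ k; omega
  refine sweep_spec hk2 hm he
    (fun v s => L.Solved c q v (fun j => s.real (.z j)) fun j => s.list (.tree j))
    (fun s' hs => (solved_base c q).next hk (by omega) hq (fun j A hA => ⟨?_, ?_⟩) hs)
    (fun i s' s'' hi h hs => h.next hk (by omega) hq (fun j A hA => ⟨?_, ?_⟩) hs) s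
  · exact sum_base hA
  · exact sum_base hA
  · exact sum_near hk (by omega) hq le_rfl (by omega) hA
  · exact sum_near hk (by omega) hq (by omega) (by omega) hA

end LadderCosts

end Labelling

end AQMST

namespace AQMST

/-! ### Triangles -/

section ExplicitLists

variable {I : Input} {s : State}

/-- Edge names are computed from natural-number registers only, so writing costs or lists does not
affect them. -/
theorem eval_congr {s s' : State} (h : s'.nat = s.nat) : EExp.eval I s' = EExp.eval I s := by
  have hn : ∀ a : NExp, a.eval I s' = a.eval I s := by
    intro a
    induction a with
    | reg r => simp only [NExp.eval, h]
    | num | k | n => rfl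
    | pos a ih => simp only [NExp.eval, ih]
    | add a b iha ihb => simp only [NExp.eval, iha, ihb]
    | sub a b iha ihb => simp only [NExp.eval, iha, ihb]
  funext e
  simp only [EExp.eval, hn]

/-- The cost of an explicit list of edge names. -/
def listVal (I : Input) : List (ℕ × ℕ) → ℝ
  | [] => 0
  | a :: l => I.c a + (l.map fun b => I.q a b + I.q b a).sum + listVal I l

theorem listCost_eval (es : List EExp) :
    (listCost es).eval I s = listVal I (es.map (EExp.eval I s)) := by
  have hsum : ∀ (e : EExp) (es : List EExp), (sumExp (es.map (pairCost e))).eval I s =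
      ((es.map (EExp.eval I s)).map fun b => I.q (e.eval I s) b + I.q b (e.eval I s)).sum := by
    intro e es
    induction es with
    | nil => rfl
    | cons f es ih => simp [sumExp, RExp.eval, pairCost, ih]
  induction es with
  | nil => rfl
  | cons e es ih => simp only [listCost, RExp.eval, ih, hsum, List.map_cons, listVal]

/-- The state holds the best of the lists in `S`. -/
def BestList (I : Input) (S : Set (List (ℕ × ℕ))) (s : State) : Prop :=
  ∃ l ∈ S, s.list .out = l.reverse ∧ s.real .best = listVal I l ∧
    ∀ l' ∈ S, s.real .best ≤ listVal I l'

theorem takeList_spec (es : List EExp) (s : State) :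
    ((takeList es).exec I s).1.nat = s.nat ∧
    ((takeList es).exec I s).1.real .best = s.real .cand ∧
    ((takeList es).exec I s).1.list .out = (es.map (EExp.eval I s)).reverse := by
  have key : ∀ (es : List EExp) (s' : State), s'.nat = s.nat →
      ((seqs (es.map fun e => Cmd.list .out (.cons e .out))).exec I s').1.nat = s.nat ∧
      ((seqs (es.map fun e => Cmd.list .out (.cons e .out))).exec I s').1.real = s'.real ∧
      ((seqs (es.map fun e => Cmd.list .out (.cons e .out))).exec I s').1.list .out =
        (es.map (EExp.eval I s)).reverse ++ s'.list .out := by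
    intro es
    induction es with
    | nil => intro s' h; exact ⟨h, rfl, rfl⟩
    | cons e es ih =>
      intro s' h
      rw [List.map_cons, exec_seqs_cons, exec_list]
      obtain ⟨h1, h2, h3⟩ := ih (s'.setList .out ((LExp.cons e .out).eval I s')) h
      refine ⟨h1, h2, ?_⟩
      rw [h3]
      simp [LExp.eval, eval_congr h]
  rw [takeList, exec_seqs_cons, exec_seqs_cons, exec_seqs_cons, exec_seqs_nil, exec_real, exec_list]
  obtain ⟨h1, h2, h3⟩ := key es ((s.setReal .best (s.real .cand)).setList .out []) rfl
  refine ⟨h1, ?_, ?_⟩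
  · simp only [RExp.eval, LExp.eval]; rw [h2]; simp
  · simp only [RExp.eval, LExp.eval]; rw [h3]; simp

theorem startList_spec (es : List EExp) (s : State) :
    BestList I {es.map (EExp.eval I s)} ((startList es).exec I s).1 := by
  rw [startList, exec_seqs_cons, exec_seqs_cons, exec_seqs_nil, exec_real]
  obtain ⟨_, h2, h3⟩ := takeList_spec (I := I) es (s.setReal .cand ((listCost es).eval I s))
  have h4 : (((takeList es).exec I (s.setReal .cand ((listCost es).eval I s))).1.real .best) =
      listVal I (es.map (EExp.eval I s)) := by
    rw [h2, ← listCost_eval]; simp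
  rw [eval_congr (s := s) (s' := s.setReal _ _) rfl] at h3
  refine ⟨_, rfl, h3, h4, ?_⟩
  rintro l rfl
  exact h4.le

theorem considerList_spec (es : List EExp) {S : Set (List (ℕ × ℕ))} (h : BestList I S s) :
    BestList I (insert (es.map (EExp.eval I s)) S) ((considerList es).exec I s).1 := by
  classical
  rw [considerList, exec_seqs_cons, exec_seqs_cons, exec_seqs_nil, exec_real, exec_cond]
  obtain ⟨l, hl, g1, g2, g3⟩ := h
  have hlt' : (BExp.rlt (.reg .cand) (.reg .best)).holds I
      (s.setReal .cand ((listCost es).eval I s)) ↔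
      listVal I (es.map (EExp.eval I s)) < s.real .best := by
    simp [BExp.holds, RExp.eval, listCost_eval]
  split_ifs with hlt
  · rw [hlt'] at hlt
    obtain ⟨_, h2, h3⟩ := takeList_spec (I := I) es (s.setReal .cand ((listCost es).eval I s))
    rw [eval_congr (s := s) (s' := s.setReal _ _) rfl] at h3
    have h4 : ((takeList es).exec I (s.setReal .cand ((listCost es).eval I s))).1.real .best =
        listVal I (es.map (EExp.eval I s)) := by
      rw [h2, ← listCost_eval]; simp
    refine ⟨_, Set.mem_insert _ _, h3, h4, ?_⟩
    rw [h4]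
    rintro l' (rfl | hl')
    · exact le_rfl
    · exact hlt.le.trans (g3 l' hl')
  · rw [hlt', not_lt] at hlt
    refine ⟨l, Set.mem_insert_of_mem _ hl, by simpa using g1, by simpa using g2, ?_⟩
    rintro l' (rfl | hl')
    · simpa using hlt
    · simpa using g3 l' hl'

/-- The spanning trees of a triangle. -/
def triangleTrees : Set (List (ℕ × ℕ)) :=
  {[(0, 1), (0, 2)], [(0, 0), (0, 2)], [(0, 0), (0, 1)]}

/-- The spanning trees of two triangles that share the edge at position `p` of the first one, up to
those that contain both other edges of the second one and an edge of the first one at a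
position at least `v`. -/
def twoTriangleTrees (p v : ℕ) : Set (List (ℕ × ℕ)) :=
  {l | (∃ l₀ ∈ triangleTrees, ∃ u, (u = 1 ∨ u = 2) ∧ l = l₀ ++ [(1, u)]) ∨
    ∃ t, t < v ∧ t ≠ p ∧ l = [(0, t), (1, 1), (1, 2)]}

theorem small_spec_one (hn : I.n = 1) (s : State) :
    BestList I triangleTrees (small.exec I s).1 := by
  have hb : (BExp.eq .n (.num 1)).holds I s := hn
  rw [small, Cmd.exec, if_pos hb]
  simp only [exec_seqs_cons, exec_seqs_nil]
  exact considerList_spec [fixed 0 1, fixed 0 2] (considerList_spec [fixed 0 0, fixed 0 2]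
    (startList_spec [fixed 0 0, fixed 0 1] s))

/-- The six explicit lists are the trees with one edge of the second triangle besides the shared
one. The loop adds the trees with both of them and one unshared edge of the first triangle, found by
testing all three positions against the marked one. -/
theorem small_spec_two (hn : I.n ≠ 1) (s : State) :
    BestList I (twoTriangleTrees (I.pos 0) 3) (small.exec I s).1 := by
  classical
  have hb : ¬ (BExp.eq .n (.num 1)).holds I s := hn
  rw [small, Cmd.exec, if_neg hb]
  simp only [exec_seqs_cons, exec_seqs_nil]
  refine exec_loop (I := I) (a := 0) (b := 3) (fun v s => BestList I (twoTriangleTrees (I.pos 0) v) s)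
    rfl rfl (by omega) ?_ ?_
  · convert considerList_spec _ (considerList_spec _ (considerList_spec _ (considerList_spec _
      (considerList_spec _ (startList_spec _ s))))) using 1
    ext l
    simp only [twoTriangleTrees, triangleTrees, Set.mem_insert_iff, Set.mem_singleton_iff,
      Set.mem_ofPred_eq, exists_eq_left, or_and_right, exists_or, List.map_cons,
      List.map_nil, List.cons_append, List.nil_append, EExp.eval, fixed, NExp.eval, not_lt_zero,
      false_and, exists_false, or_false]
    tauto
  · intro v s' _ _ h
    rw [exec_cond]
    have h' : BestList I (twoTriangleTrees (I.pos 0) v) (s'.setNat .t v) := by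
      simpa [BestList] using h
    have hv : (BExp.not (.eq (.reg .t) (.pos (.num 0)))).holds I (s'.setNat .t v) ↔
        v ≠ I.pos 0 := by
      simp [BExp.holds, NExp.eval]
    split_ifs with hc
    · rw [hv] at hc
      convert considerList_spec _ h' using 1
      ext l
      simp only [twoTriangleTrees, Set.mem_insert_iff, Set.mem_ofPred_eq, List.map_cons, List.map_nil,
        EExp.eval, fixed, NExp.eval, nat_setNat, if_true]
      constructor
      · rintro (h | ⟨t, h1, h2, h3⟩)
        · exact Or.inr (Or.inl h)
        · rcases Nat.lt_succ_iff_lt_or_eq.1 h1 with h4 | rfl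
          · exact Or.inr (Or.inr ⟨t, h4, h2, h3⟩)
          · exact Or.inl h3
      · rintro (h | h | ⟨t, h1, h2, h3⟩)
        · exact Or.inr ⟨v, by omega, hc, h⟩
        · exact Or.inl h
        · exact Or.inr ⟨t, by omega, h2, h3⟩
    · rw [hv, not_not] at hc
      convert h' using 1
      ext l
      simp only [twoTriangleTrees, Set.mem_ofPred_eq]
      refine or_congr_right (exists_congr fun t => ⟨?_, ?_⟩)
      · rintro ⟨h1, h2, h3⟩
        exact ⟨by omega, h2, h3⟩
      · rintro ⟨h1, h2, h3⟩
        exact ⟨by omega, h2, h3⟩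

end ExplicitLists

namespace Labelling

section Triangles

variable {V : Type*} {G : SimpleGraph V} {n : ℕ}

theorem nodup_triangleTrees {L : Labelling G 3 n} (hn : 0 < n) {l : List (ℕ × ℕ)}
    (hl : l ∈ triangleTrees) : (l.map fun a => L.edge a.1 a.2).Nodup := by
  have hedge : ∀ {s t : ℕ}, s < 3 → t < 3 → s ≠ t → L.edge 0 s ≠ L.edge 0 t := fun hs ht hst h =>
    hst (L.edge_inj le_rfl hn hs ht h)
  rcases hl with rfl | rfl | rfl
  · simpa using hedge (s := 1) (t := 2) (by omega) (by omega) (by omega)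
  · simpa using hedge (s := 0) (t := 2) (by omega) (by omega) (by omega)
  · simpa using hedge (s := 0) (t := 1) (by omega) (by omega) (by omega)

theorem nodup_twoTriangleTrees {L : Labelling G 3 n} (hn : 1 < n) {p : ℕ} {l : List (ℕ × ℕ)}
    (hl : l ∈ twoTriangleTrees p 3) : (l.map fun a => L.edge a.1 a.2).Nodup := by
  have hne : ∀ {t u : ℕ}, t < 3 → 1 ≤ u → u < 3 → L.edge 0 t ≠ L.edge 1 u := fun ht h1 hu h =>
    L.edge_notMem_oldEdges le_rfl hn h1 hu (h ▸ Or.inl ⟨0, by omega, _, ht, rfl⟩)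
  rcases hl with ⟨l, hl, u, hu, rfl⟩ | ⟨t, ht, _, rfl⟩
  · rw [List.map_append, List.nodup_append']
    refine ⟨nodup_triangleTrees (by omega) hl, by simp, ?_⟩
    have h0 := hne (t := 0) (u := u) (by omega) (by omega) (by omega)
    have h1 := hne (t := 1) (u := u) (by omega) (by omega) (by omega)
    have h2 := hne (t := 2) (u := u) (by omega) (by omega) (by omega)
    rcases hl with rfl | rfl | rfl <;> simp [h0.symm, h1.symm, h2.symm]
  · have h12 : L.edge 1 1 ≠ L.edge 1 2 := fun h => by
      have := L.edge_inj le_rfl hn (by omega) (by omega) h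
      omega
    simp [hne (u := 1) ht (by omega) (by omega), hne (u := 2) ht (by omega) (by omega), h12]

variable [DecidableEq V]

/-- The list formula adds an entry for every occurrence, so it gives the cost of the edge set only
when no edge is listed twice. -/
theorem listVal_eq {k : ℕ} {L : Labelling G k n} {c : Sym2 V → ℝ} {q : Sym2 V → Sym2 V → ℝ}
    {l : List (ℕ × ℕ)} (hl : (l.map fun a => L.edge a.1 a.2).Nodup) :
    listVal (L.input c q) l = cost c q (L.edgeFinset l) := by
  induction l with
  | nil => simp [listVal, edgeFinset, cost_empty]
  | cons a l ih =>
    rw [List.map_cons, List.nodup_cons] at hl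
    have h1 : L.edgeFinset (a :: l) = insert (L.edge a.1 a.2) (L.edgeFinset l) := by
      simp [edgeFinset]
    have h2 : L.edge a.1 a.2 ∉ L.edgeFinset l := by
      rw [edgeFinset, List.mem_toFinset]; exact hl.1
    rw [h1, cost_insert c q h2, listVal, ih hl.2, edgeFinset, List.sum_toFinset _ hl.2, List.map_map]
    have h3 : (L.input c q).c a = c (L.edge a.1 a.2) := rfl
    have h4 : (fun b => (L.input c q).q a b + (L.input c q).q b a) =
        (fun f => q (L.edge a.1 a.2) f + q f (L.edge a.1 a.2)) ∘ fun a => L.edge a.1 a.2 := rfl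
    rw [h3, h4]
    ring

variable {L : Labelling G 3 n}

theorem spanningTree_one_iff (hn : 0 < n) {T : Finset (Sym2 V)} :
    L.SpanningTree 1 T ↔ ∃ l ∈ triangleTrees, T = L.edgeFinset l := by
  have hC : ∀ {A : Finset (Sym2 V)} {S : Finset ℕ}, (A : Set (Sym2 V)) ⊆ L.oldEdges 0 →
      S ⊆ Finset.Ico 1 3 → (L.SpanningTree 1 (L.combine 0 A S) ↔ (A = ∅ ∧ S = {1, 2}) ∨
        ((A = {L.edge 0 0} ∧ S = {2}) ∨ A = {L.edge 0 0} ∧ S = {1})) := by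
    intro A S hA hS
    rw [tree_positions le_rfl hn hA hS, oldForest_zero_iff le_rfl hn, oldTree_zero_iff le_rfl hn]
    refine or_congr Iff.rfl ⟨?_, ?_⟩
    · rintro ⟨t, ⟨h1, h2⟩, h3, rfl⟩
      interval_cases t
      · exact Or.inl ⟨h3, rfl⟩
      · exact Or.inr ⟨h3, rfl⟩
    · rintro (⟨h1, rfl⟩ | ⟨h1, rfl⟩)
      · exact ⟨1, by omega, h1, rfl⟩
      · exact ⟨2, by omega, h1, rfl⟩
  have h0 : (({L.edge 0 0} : Finset (Sym2 V)) : Set (Sym2 V)) ⊆ L.oldEdges 0 := by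
    rw [Finset.coe_singleton, Set.singleton_subset_iff]; exact Or.inr rfl
  have e1 : L.edgeFinset [(0, 1), (0, 2)] = L.combine 0 ∅ {1, 2} := by
    simp [edgeFinset, combine]
  have e2 : L.edgeFinset [(0, 0), (0, 2)] = L.combine 0 {L.edge 0 0} {2} := by
    simp [edgeFinset, combine]
  have e3 : L.edgeFinset [(0, 0), (0, 1)] = L.combine 0 {L.edge 0 0} {1} := by
    simp [edgeFinset, combine]
  simp only [triangleTrees, Set.mem_insert_iff, Set.mem_singleton_iff, exists_eq_or_imp,
    exists_eq_left, e1, e2, e3]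
  constructor
  · intro h
    obtain ⟨A, S, hA, hS, rfl⟩ := exists_combine le_rfl h.1
    rcases (hC hA hS).1 h with ⟨rfl, rfl⟩ | ⟨rfl, rfl⟩ | ⟨rfl, rfl⟩ <;> tauto
  · rintro (rfl | rfl | rfl)
    · exact (hC (by simp) (by decide)).2 (Or.inl ⟨rfl, rfl⟩)
    · exact (hC h0 (by decide)).2 (Or.inr (Or.inl ⟨rfl, rfl⟩))
    · exact (hC h0 (by decide)).2 (Or.inr (Or.inr ⟨rfl, rfl⟩))

/-- Adding the shared edge must give a spanning tree of the triangle, which has two edges, so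
exactly one other edge remains. In a triangle the marked position may be `2`, where the edge wraps
around to vertex `0`; `splitForest_iff` does not cover this, so its argument is repeated with
indices modulo `3`. -/
theorem oldForest_one_iff (hn : 1 < n) {A : Finset (Sym2 V)} :
    L.OldForest 1 A ↔ ∃ t, t < 3 ∧ t ≠ L.pos 0 ∧ A = {L.edge 0 t} := by
  have hp := L.pos_lt 0 (by omega)
  have hmod : (L.pos 0 + 1) % 3 < 3 := Nat.mod_lt _ (by omega)
  have hne : L.x 0 (L.pos 0) ≠ L.x 0 ((L.pos 0 + 1) % 3) := L.x_ne (by omega) hp hmod (by omega)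
  have hv : L.x 0 (L.pos 0) ∈ L.verts 1 := ⟨0, by omega, _, hp, rfl⟩
  have hedge : ∀ {s t : ℕ}, s < 3 → t < 3 → s ≠ t → L.edge 0 s ≠ L.edge 0 t := fun hs ht hst h =>
    hst (L.edge_inj le_rfl (by omega) hs ht h)
  have hmem : L.edge 0 (L.pos 0) ∈ L.edges 1 := ⟨0, by omega, _, hp, rfl⟩
  have h01 := hedge (s := 0) (t := 1) (by omega) (by omega) (by omega)
  have h02 := hedge (s := 0) (t := 2) (by omega) (by omega) (by omega)
  have h12 := hedge (s := 1) (t := 2) (by omega) (by omega) (by omega)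
  have hiff : L.OldForest 1 A ↔ L.edge 0 (L.pos 0) ∉ A ∧
      L.SpanningTree 1 (insert (L.edge 0 (L.pos 0)) A) := by
    rw [oldForest_succ_iff le_rfl hn, spanningTree_iff, Finset.coe_insert, Set.insert_subset_iff]
    constructor
    · rintro ⟨h1, h2⟩
      have hA : L.edge 0 (L.pos 0) ∉ A := fun hA => by
        refine h2.2.1 (SimpleGraph.Adj.reachable ?_)
        rw [SimpleGraph.fromEdgeSet_adj]
        exact ⟨hA, hne⟩
      exact ⟨hA, ⟨hmem, h1⟩, (spans_insert_iff hne hA hv).2 h2⟩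
    · rintro ⟨hA, ⟨_, h1⟩, h2⟩
      exact ⟨h1, (spans_insert_iff hne hA hv).1 h2⟩
  rw [hiff, spanningTree_one_iff (by omega)]
  simp only [triangleTrees, Set.mem_insert_iff, Set.mem_singleton_iff, exists_eq_or_imp,
    exists_eq_left, edgeFinset, List.map_cons, List.map_nil, List.toFinset_cons, List.toFinset_nil,
    insert_empty_eq]
  generalize L.pos 0 = p at hp
  constructor
  · rintro ⟨hA, h⟩
    have key : ∀ i j, i < 3 → j < 3 → i ≠ j → insert (L.edge 0 p) A = {L.edge 0 i, L.edge 0 j} →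
        ∃ t, t < 3 ∧ t ≠ p ∧ A = {L.edge 0 t} := by
      intro i j hi hj hij he
      have hpm : L.edge 0 p ∈ insert (L.edge 0 p) A := Finset.mem_insert_self _ _
      have hA' := Finset.erase_insert hA
      rw [he, Finset.mem_insert, Finset.mem_singleton] at hpm
      rw [he] at hA'
      rcases hpm with hpm | hpm
      · rw [hpm, Finset.erase_insert (by simpa using hedge hi hj hij)] at hA'
        exact ⟨j, hj, fun h => hedge hi hj hij (by rw [← hpm, h]), hA'.symm⟩
      · rw [hpm, Finset.pair_comm, Finset.erase_insert (by simpa using hedge hj hi hij.symm)] at hA'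
        exact ⟨i, hi, fun h => hedge hj hi hij.symm (by rw [← hpm, h]), hA'.symm⟩
    rcases h with h | h | h
    · exact key 1 2 (by omega) (by omega) (by omega) h
    · exact key 0 2 (by omega) (by omega) (by omega) h
    · exact key 0 1 (by omega) (by omega) (by omega) h
  · rintro ⟨t, ht, htp, rfl⟩
    refine ⟨by simpa using hedge hp ht htp.symm, ?_⟩
    interval_cases p <;> interval_cases t <;> simp_all [Finset.pair_comm]

/-- Either one new edge is added to a tree of the first triangle, or both new edges to one of its
two split forests. -/
theorem spanningTree_two_iff (hn : 1 < n) {T : Finset (Sym2 V)} :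
    L.SpanningTree 2 T ↔ ∃ l ∈ twoTriangleTrees (L.pos 0) 3, T = L.edgeFinset l := by
  have happ : ∀ l u, L.edgeFinset (l ++ [(1, u)]) = L.combine 1 (L.edgeFinset l) {u} := by
    intro l u; simp [edgeFinset, combine]
  have hpair : ∀ t, L.edgeFinset [(0, t), (1, 1), (1, 2)] = L.combine 1 {L.edge 0 t} {1, 2} := by
    intro t; simp [edgeFinset, combine, Finset.insert_comm]
  have hold : ∀ {A : Finset (Sym2 V)}, L.OldTree 1 A ↔ ∃ l ∈ triangleTrees, A = L.edgeFinset l := by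
    intro A
    rw [oldTree_succ_iff le_rfl hn, spanningTree_one_iff (by omega)]
  constructor
  · intro h
    obtain ⟨A, S, hA, hS, rfl⟩ := exists_combine le_rfl h.1
    rcases (tree_positions le_rfl hn hA hS).1 h with ⟨h1, rfl⟩ | ⟨t, ⟨h1, h2⟩, h3, rfl⟩
    · obtain ⟨t, ht, htp, rfl⟩ := (oldForest_one_iff hn).1 h1
      exact ⟨_, Or.inr ⟨t, ht, htp, rfl⟩, (hpair t).symm⟩
    · obtain ⟨l, hl, rfl⟩ := hold.1 h3
      interval_cases t
      · exact ⟨_, Or.inl ⟨l, hl, 2, Or.inr rfl, rfl⟩, (happ l 2).symm⟩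
      · exact ⟨_, Or.inl ⟨l, hl, 1, Or.inl rfl, rfl⟩, (happ l 1).symm⟩
  · rintro ⟨_, ⟨l, hl, u, hu, rfl⟩ | ⟨t, ht, htp, rfl⟩, rfl⟩
    · have h3 := hold.2 ⟨l, hl, rfl⟩
      rw [happ]
      rcases hu with rfl | rfl
      · exact (tree_positions le_rfl hn h3.1 (by decide)).2 (Or.inr ⟨2, by omega, h3, rfl⟩)
      · exact (tree_positions le_rfl hn h3.1 (by decide)).2 (Or.inr ⟨1, by omega, h3, rfl⟩)
    · have h3 := (oldForest_one_iff hn).2 ⟨t, ht, htp, rfl⟩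
      rw [hpair]
      exact (tree_positions le_rfl hn h3.1 (by decide)).2 (Or.inl ⟨h3, rfl⟩)

end Triangles

/-! ### Optimality of the final output -/

section Output

variable {V : Type*} {G : SimpleGraph V} {k n : ℕ} {L : Labelling G k n}
  {c : Sym2 V → ℝ} {q : Sym2 V → Sym2 V → ℝ}

theorem isSpanningTree_iff {T : Finset (Sym2 V)} :
    IsSpanningTree G T ↔ L.SpanningTree n T := by
  have hE : G.edgeSet = L.edges n := by
    ext e
    rw [L.edges_eq]
    constructor
    · rintro ⟨i, hi, t, ht, rfl⟩; exact ⟨i, hi, t, ht, rfl⟩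
    · rintro ⟨i, hi, t, ht, rfl⟩; exact ⟨i, hi, t, ht, rfl⟩
  have hV : ∀ v, v ∈ L.verts n := fun v => L.verts_eq v
  have : Nonempty V := ⟨L.x 0 0⟩
  rw [IsSpanningTree, SpanningTree, hE, SimpleGraph.isTree_iff, SimpleGraph.connected_iff,
    SimpleGraph.Preconnected]
  constructor
  · rintro ⟨h1, ⟨h2, _⟩, h3⟩
    exact ⟨h1, h3, fun u _ w _ => h2 u w⟩
  · rintro ⟨h1, h2, h3⟩
    exact ⟨h1, ⟨fun u w => h3 u (hV u) w (hV w), this⟩, h2⟩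

variable [DecidableEq V]

/-- The state holds an optimal tree and its cost. -/
def Correct (L : Labelling G k n) (c : Sym2 V → ℝ) (q : Sym2 V → Sym2 V → ℝ) (s : State) : Prop :=
  ((s.list .out).map fun a => L.edge a.1 a.2).Nodup ∧
    IsOptimal (cost c q) (IsSpanningTree G) (L.edgeFinset (s.list .out)) ∧
    s.real .best = cost c q (L.edgeFinset (s.list .out))

theorem correct_of_bestList {S : Set (List (ℕ × ℕ))} {s : State} (h : BestList (L.input c q) S s)
    (hnodup : ∀ l ∈ S, (l.map fun a => L.edge a.1 a.2).Nodup)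
    (hS : ∀ T, IsSpanningTree G T ↔ ∃ l ∈ S, T = L.edgeFinset l) : L.Correct c q s := by
  obtain ⟨l, hl, h1, h2, h3⟩ := h
  have hrev : L.edgeFinset l.reverse = L.edgeFinset l := by
    rw [edgeFinset, edgeFinset, List.map_reverse, List.toFinset_reverse]
  have hcost : s.real .best = cost c q (L.edgeFinset l) := by rw [h2, listVal_eq (hnodup l hl)]
  unfold Correct
  rw [h1, hrev]
  refine ⟨?_, ⟨(hS _).2 ⟨l, hl, rfl⟩, fun T hT => ?_⟩, hcost⟩
  · rw [List.map_reverse, List.nodup_reverse]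
    exact hnodup l hl
  · obtain ⟨l', hl', rfl⟩ := (hS T).1 hT
    rw [← hcost, ← listVal_eq (hnodup l' hl')]
    exact h3 l' hl'

theorem correct_small {L : Labelling G 3 n} (hn : n = 1 ∨ n = 2) (s : State) :
    L.Correct c q (small.exec (L.input c q) s).1 := by
  rcases hn with rfl | rfl
  · exact correct_of_bestList (small_spec_one rfl s) (fun l hl => nodup_triangleTrees (by omega) hl)
      fun T => isSpanningTree_iff.trans (spanningTree_one_iff (by omega))
  · have h2 : (L.input c q).n ≠ 1 := by change 2 ≠ 1; omega
    exact correct_of_bestList (small_spec_two h2 s)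
      (fun l hl => nodup_twoTriangleTrees (by omega) hl)
      fun T => isSpanningTree_iff.trans (spanningTree_two_iff (by omega))

/-- The four tree names exhaust the spanning trees of the whole ladder, so the cheapest of their
optima is optimal. -/
theorem correct_sweep (hk : 4 ≤ k) (hn : 1 ≤ n) (hq : AdjacentOnly G q) (s : State) :
    L.Correct c q ((Cmd.seq (sweep .n) finish).exec (L.input c q) s).1 := by
  have hsol := sweep_solved (L := L) (c := c) hk hq hn le_rfl (e := .n) (fun _ => rfl) s
  obtain ⟨j, hj, h1, h2, h3⟩ := finish_spec (I := L.input c q)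
    ((sweep .n).exec (L.input c q) s).1
  change L.Correct c q (finish.exec (L.input c q) ((sweep .n).exec (L.input c q) s).1).1
  obtain ⟨m, rfl⟩ : ∃ m, n = m + 1 := ⟨n - 1, by omega⟩
  unfold Correct
  rw [h1]
  obtain ⟨hopt, hcost, hnodup⟩ := hsol j
  refine ⟨hnodup, ⟨?_, fun T hT => ?_⟩, h2.trans hcost⟩
  · exact isSpanningTree_iff.2
      ((exists_tree_admissible hk (by omega)).2 ⟨j, hj, hopt.1⟩)
  · rw [isSpanningTree_iff (L := L)] at hT
    obtain ⟨j', hj', hT'⟩ := (exists_tree_admissible hk (by omega)).1 hT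
    have h4 := h3 j' hj'
    have h5 := (hsol j').1.2 T hT'
    rw [h2] at h4
    have h6 := (hsol j').2.1
    dsimp only at h5 h6 hcost ⊢
    linarith

end Output

end Labelling

end AQMST

/-! ### The main theorem -/

theorem mainTheorem6 : ∃ C : ℕ, ∀ {V : Type*} [DecidableEq V] (k n : ℕ) (G : SimpleGraph V),
    AQMST.IsLadder k n G →
      -- every ladder can be presented to the algorithm, and for every presentation and all costs:
      Nonempty (AQMST.Labelling G k n) ∧
      ∀ (L : AQMST.Labelling G k n) (c : Sym2 V → ℝ) (q : Sym2 V → Sym2 V → ℝ)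
        (s₀ : AQMST.State), AQMST.AdjacentOnly G q →
        let I := L.input c q
        let final := (AQMST.ladderAlgorithm.exec I s₀).1
        let steps := (AQMST.ladderAlgorithm.exec I s₀).2
        let T := L.edgeFinset (final.list .out)
        -- the running time
        steps ≤ C * (k * n) ∧
        -- the output is an optimal tree, each edge listed once, together with its cost
        ((final.list .out).map fun a => L.edge a.1 a.2).Nodup ∧
        AQMST.IsOptimal (AQMST.cost c q) (AQMST.IsSpanningTree G) T ∧
        final.real .best = AQMST.cost c q T ∧
        -- after the first `m` cycles the seven objects and their costs are known
        (4 ≤ k → ∀ m, 1 ≤ m → m ≤ n → ∀ j : AQMST.Entry,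
          let s := ((AQMST.sweep (.num m)).exec I s₀).1
          AQMST.IsOptimal (AQMST.cost c q) (L.Admissible m j) (L.edgeFinset (s.list (.tree j))) ∧
          s.real (.z j) = AQMST.cost c q (L.edgeFinset (s.list (.tree j)))) := by
  obtain ⟨C, hC⟩ := AQMST.runs_ladderAlgorithm
  refine ⟨C, fun k n G hG => ⟨hG.nonempty_labelling, fun L c q s₀ hq => ?_⟩⟩
  obtain ⟨hk, F, hF⟩ := hG
  have hn := hF.one_le
  have hcorrect : L.Correct c q (AQMST.ladderAlgorithm.exec (L.input c q) s₀).1 := by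
    by_cases hk4 : 4 ≤ k
    · have hb : ¬ (AQMST.BExp.lt .k (.num 4)).holds (L.input c q) s₀ := by
        change ¬ k < 4; omega
      rw [AQMST.ladderAlgorithm, AQMST.Cmd.exec, if_neg hb]
      exact AQMST.Labelling.correct_sweep hk4 hn hq s₀
    · have hb : (AQMST.BExp.lt .k (.num 4)).holds (L.input c q) s₀ := by
        change k < 4; omega
      obtain rfl : k = 3 := by omega
      have hn2 := hF.le_two
      rw [AQMST.ladderAlgorithm, AQMST.Cmd.exec, if_pos hb]
      exact AQMST.Labelling.correct_small (by omega) s₀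
  refine ⟨hC (L.input c q) (le_trans (by norm_num) hk) hn s₀, hcorrect.1, hcorrect.2.1,
    hcorrect.2.2, fun hk4 m hm hmn j => ?_⟩
  have h := AQMST.Labelling.sweep_solved (L := L) (c := c) hk4 hq hm hmn (e := .num m)
    (fun _ => rfl) s₀ j
  -- At a successor `OldAdmissible` is `Admissible` by definition.
  obtain ⟨m, rfl⟩ : ∃ m', m = m' + 1 := ⟨m - 1, by omega⟩
  exact ⟨h.1, h.2.1⟩
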